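/- Let $(V,Y,\mathbf 1,\omega)$ be a vertex operator algebra over $\mathbb C$, let $k\ge 1$, and let $g=(1,2,\dots,k)$ act on $V^{\otimes k}$ by permuting the tensor factors. Define complex numbers $a_n$ ($n\ge1$) by $\exp\bigl(\sum_{n\ge1}-a_nx^{n+1}\tfrac{d}{dx}\bigr)x=\tfrac1k(1+x)^k-\tfrac1k$ and put $$\Delta_k(z)=\exp\Bigl(\sum_{n\ge1}a_nz^{-n/k}L(n)\Bigr)\,k^{-L(0)}\,z^{(1/k-1)L(0)} .$$ For a $k$-cycle $\sigma$ and a $V$-module $(W,Y_W)$, let $T_\sigma(W)$ denote the (Barron--Dong--Mason) $\sigma$-twisted $V^{\otimes k}$-module with underlying space $W$ whose vertex operator map is the unique one with $Y_{T_\sigma(W)}(u\otimes\mathbf 1^{\otimes(k-1)},z)=Y_W(\Delta_k(z)u,z^{1/k})$ for all $u\in V$. For a (twisted) module $(M,Y_M)$ that is the direct sum of its $L(0)$-eigenspaces $M_\lambda$, the contragredient module is $M'=\bigoplus_\lambda M_\lambda^*$ with $\langle Y_{M'}(v,z)f,w\rangle=\langle f,Y_M(e^{zL(1)}(-z^{-2})^{L(0)}v,z^{-1})w\rangle$.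 Then for every (ordinary) $V$-module $W$, the contragredient module of the $g$-twisted $V^{\otimes k}$-module $T_g(W)$ is the $g^{-1}$-twisted $V^{\otimes k}$-module attached to the contragredient module $W'$ of $W$: the two have the same underlying space $W'$ and the same vertex operator map, that is, $$T_g(W)'=T_{g^{-1}}(W').$$ -/

import Mathlib

open scoped TensorProduct

noncomputable section

/-! ### Vertex operator algebras and twisted modules -/

/-- The data of a vertex algebra with conformal vector on a complex vector space `V`:
`Y v n` is the mode `v_n`, where `Y(v, z) = ∑ₙ v_n z^(-n-1)`; `vac` is the vacuum vector and
`conf` is the conformal vector `ω`. The axioms are imposed in `VOA` below. -/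
structure VertexData (V : Type*) [AddCommGroup V] [Module ℂ V] where
  Y : V →ₗ[ℂ] (ℤ → Module.End ℂ V)
  vac : V
  conf : V

namespace VertexData

variable {V : Type*} [AddCommGroup V] [Module ℂ V]

/-- `L(n) = ω_{n+1}`. -/
def L (A : VertexData V) (n : ℤ) : Module.End ℂ V := A.Y A.conf (n + 1)

/-- The subspace of vectors of conformal weight `n`. -/
def wt (A : VertexData V) (n : ℤ) : Submodule ℂ V :=
  Module.End.eigenspace (A.L 0) (n : ℂ)

end VertexData

/-- The binomial coefficient `a (a - 1) ⋯ (a - i + 1) / i!` of a complex number `a`. -/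
def binom (a : ℂ) (i : ℕ) : ℂ := (∏ j ∈ Finset.range i, (a - j)) / (i.factorial : ℂ)

/-- Weak `g`-twisted modules, where `T` is a positive period of `g` (so `g ^ T = 1`).
A vertex operator map `Y_M(v, z) = ∑_{n ∈ (1/T)ℤ} v_n z^(-n-1)` on `M` is given by its modes:
`Y v p` is the mode `v_{p/T}`, for `p : ℤ`.
Write `V^r` for the eigenspace of `g` with eigenvalue `exp (2 π i r / T)`.

The field `jacobi` is the twisted Jacobi identity
`z₀⁻¹ δ((z₁ - z₂)/z₀) Y_M(u, z₁) Y_M(v, z₂) - z₀⁻¹ δ((z₂ - z₁)/(-z₀)) Y_M(v, z₂) Y_M(u, z₁)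
  = z₂⁻¹ ((z₁ - z₀)/z₂)^(-r/T) δ((z₁ - z₀)/z₂) Y_M(Y(u, z₀) v, z₂)` for `u ∈ V^r`, applied to `w`,
coefficient by coefficient: it compares the coefficients of `z₀^(-l-1) z₁^(-m/T-1) z₂^(-n/T-1)`.
(If `m` is not congruent to `r` modulo `T`, both coefficients vanish by `support`.)
All the sums have finitely many non-zero terms, by truncation. -/
structure IsWeakTwistedModule {V M : Type*} [AddCommGroup V] [Module ℂ V]
    [AddCommGroup M] [Module ℂ M] (A : VertexData V) (g : V →ₗ[ℂ] V) (T : ℕ)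
    (Y : V →ₗ[ℂ] (ℤ → Module.End ℂ M)) : Prop where
  /-- `Y_M(u, z)` only involves the modes `u_n` with `n ∈ r/T + ℤ`, for `u ∈ V^r`. -/
  support : ∀ (r : ℤ) (u : V), g u = Complex.exp (2 * Real.pi * Complex.I * r / T) • u →
    ∀ p : ℤ, ¬ p ≡ r [ZMOD T] → Y u p = 0
  truncation : ∀ (u : V) (w : M), ∃ N : ℤ, ∀ p : ℤ, N ≤ p → Y u p w = 0
  /-- `Y_M(𝟏, z) = Id`. -/
  vacuum : ∀ p : ℤ, Y A.vac p = if p = -(T : ℤ) then 1 else 0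
  jacobi : ∀ (r : ℤ) (u : V), g u = Complex.exp (2 * Real.pi * Complex.I * r / T) • u →
    ∀ (v : V) (w : M) (l m n : ℤ), m ≡ r [ZMOD T] →
      ∑ᶠ i : ℕ, binom ((m : ℂ) / T) i • Y (A.Y u (l + i) v) (m + n - T * i) w =
      ∑ᶠ i : ℕ, ((-1 : ℂ) ^ i * binom l i) •
        (Y u (m + T * l - T * i) (Y v (n + T * i) w) -
          (-1 : ℂ) ^ l • Y v (n + T * l - T * i) (Y u (m + T * i) w))

/-- Ordinary `g`-twisted modules: `M` is the direct sum of the eigenspaces of `L(0) = ω_1`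
(eigenspaces for distinct eigenvalues are independent, so that it is enough that they span), these
are finite-dimensional, and for each `μ` the eigenvalue `μ + n/T` does not occur for sufficiently
small integers `n`. -/
structure IsTwistedModule {V M : Type*} [AddCommGroup V] [Module ℂ V]
    [AddCommGroup M] [Module ℂ M] (A : VertexData V) (g : V →ₗ[ℂ] V) (T : ℕ)
    (Y : V →ₗ[ℂ] (ℤ → Module.End ℂ M)) : Prop extends IsWeakTwistedModule A g T Y where
  graded : ⨆ μ : ℂ, Module.End.eigenspace (Y A.conf T) μ = ⊤
  finite : ∀ μ : ℂ, FiniteDimensional ℂ (Module.End.eigenspace (Y A.conf T) μ)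
  lower_bound : ∀ μ : ℂ, ∃ N : ℤ, ∀ n : ℤ, n < N →
    Module.End.eigenspace (Y A.conf T) (μ + n / T) = ⊥

/-- Vertex operator algebras. The first field consists of truncation, `Y(𝟏, z) = Id` and the
Jacobi identity. -/
structure VOA (V : Type*) [AddCommGroup V] [Module ℂ V] extends VertexData V where
  adjoint : IsWeakTwistedModule toVertexData LinearMap.id 1 Y
  /-- `Y(v, z) 𝟏` is a power series in `z` with constant term `v`. -/
  creation : ∀ v : V, Y v (-1) vac = v ∧ ∀ n : ℤ, 0 ≤ n → Y v n vac = 0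
  /-- The Virasoro relations, for some central charge `c`. -/
  virasoro : ∃ c : ℂ, ∀ m n : ℤ,
    toVertexData.L m * toVertexData.L n - toVertexData.L n * toVertexData.L m =
      ((m : ℂ) - n) • toVertexData.L (m + n) +
        (if m + n = 0 then ((m : ℂ) ^ 3 - m) / 12 * c else 0) • (1 : Module.End ℂ V)
  /-- `Y(L(-1) v, z) = d/dz Y(v, z)`. -/
  derivative : ∀ (v : V) (n : ℤ), Y (toVertexData.L (-1) v) n = -(n : ℂ) • Y v (n - 1)
  /-- `V` is the direct sum of its weight spaces `V_n`, for `n` an integer. -/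
  graded : ⨆ n : ℤ, toVertexData.wt n = ⊤
  finite : ∀ n : ℤ, FiniteDimensional ℂ (toVertexData.wt n)
  lower_bound : ∃ N : ℤ, ∀ n : ℤ, n < N → toVertexData.wt n = ⊥

/-- `V`-modules: ordinary modules, that is, ordinary twisted modules for `g = 1`. -/
def IsVOAModule {V W : Type*} [AddCommGroup V] [Module ℂ V] [AddCommGroup W] [Module ℂ W]
    (A : VOA V) (Y : V →ₗ[ℂ] (ℤ → Module.End ℂ W)) : Prop :=
  IsTwistedModule A.toVertexData LinearMap.id 1 Y

/-! ### Contragredient modules -/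

/-- For an endomorphism `L₀` of `M`, the restricted dual `M' = ⨁_μ (M_μ)^*` with respect to the
eigenspaces `M_μ` of `L₀`, as the space of all the linear functionals on `M` that vanish on all but
finitely many of the `M_μ`. -/
def restrictedDual {M : Type*} [AddCommGroup M] [Module ℂ M] (L₀ : Module.End ℂ M) :
    Submodule ℂ (Module.Dual ℂ M) where
  carrier := {f | {μ : ℂ | ∃ w ∈ Module.End.eigenspace L₀ μ, f w ≠ 0}.Finite}
  zero_mem' := by simp
  add_mem' := by
    intro f h hf hh
    refine (hf.union hh).subset ?_
    rintro μ ⟨w, hw, hne⟩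
    by_cases h0 : f w = 0
    · exact Or.inr ⟨w, hw, fun h1 => hne (by simp [h0, h1])⟩
    · exact Or.inl ⟨w, hw, h0⟩
  smul_mem' := by
    intro c f hf
    refine hf.subset ?_
    rintro μ ⟨w, hw, hne⟩
    exact ⟨w, hw, fun h0 => hne (by simp [h0])⟩

/-- For `v` of weight `n`, the coefficient of `z^(-p/T-1)` in
`Y_M(e^(z L(1)) (-z⁻²)^(L(0)) v, z⁻¹)`. Here `(-z⁻²)^(L(0)) v = (-1)^n z^(-2n) v`, and
`L(1)^j v = 0` for large `j`. -/
def contragredientMode {V M : Type*} [AddCommGroup V] [Module ℂ V] [AddCommGroup M] [Module ℂ M]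
    (A : VertexData V) (T : ℕ) (Y : V →ₗ[ℂ] (ℤ → Module.End ℂ M)) (n : ℤ) (v : V) (p : ℤ) :
    Module.End ℂ M :=
  (-1 : ℂ) ^ n • ∑ᶠ j : ℕ, (j.factorial : ℂ)⁻¹ •
    Y ((A.L 1 ^ j) v) (-p + T * (2 * n - j - 2))

/-- `(D, Y')` is the contragredient module of the twisted module `(M, Y)`: as a space, `D` is the
restricted dual of `M` with respect to the operator `L(0)` of `M`, and
`⟨Y'(v, z) f, w⟩ = ⟨f, Y(e^(z L(1)) (-z⁻²)^(L(0)) v, z⁻¹) w⟩` for all (homogeneous) `v`. -/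
def IsContragredient {V M : Type*} [AddCommGroup V] [Module ℂ V] [AddCommGroup M] [Module ℂ M]
    (A : VertexData V) (T : ℕ) (Y : V →ₗ[ℂ] (ℤ → Module.End ℂ M))
    (D : Submodule ℂ (Module.Dual ℂ M)) (Y' : V →ₗ[ℂ] (ℤ → Module.End ℂ D)) : Prop :=
  D = restrictedDual (Y A.conf T) ∧
  ∀ (n : ℤ) (v : V), v ∈ A.wt n → ∀ (p : ℤ) (f : D) (w : M),
    (Y' v p f : Module.Dual ℂ M) w =
      (f : Module.Dual ℂ M) (contragredientMode A T Y n v p w)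

/-! ### The vertex operator algebra `V^{⊗k}` -/

section TensorPower

variable {V : Type*} [AddCommGroup V] [Module ℂ V] (A : VOA V) (k : ℕ)

/-- For `n = (n₁, …, n_k)`, the linear extension of
`u₁ ⊗ ⋯ ⊗ u_k ↦ (u₁)_{n₁} ⊗ ⋯ ⊗ (u_k)_{n_k}`. -/
def multiMode (n : Fin k → ℤ) :
    (⨂[ℂ] _ : Fin k, V) →ₗ[ℂ] Module.End ℂ (⨂[ℂ] _ : Fin k, V) :=
  PiTensorProduct.lift
    ((PiTensorProduct.mapMultilinear ℂ (fun _ : Fin k => V) (fun _ : Fin k => V)).compLinearMap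
      (fun i => (LinearMap.proj (n i)).comp A.Y))

theorem multiMode_tprod (n : Fin k → ℤ) (u v : Fin k → V) :
    multiMode A k n (PiTensorProduct.tprod ℂ u) (PiTensorProduct.tprod ℂ v) =
      PiTensorProduct.tprod ℂ (fun i => A.Y (u i) (n i) (v i)) := by
  simp [multiMode]

theorem multiMode_finite (s : ℤ) (u v : ⨂[ℂ] _ : Fin k, V) :
    (Function.support fun n : {n : Fin k → ℤ // ∑ i, (n i + 1) = s} =>
      multiMode A k n.1 u v).Finite := by
  induction u using PiTensorProduct.induction_on with
  | add x y hx hy =>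
    refine (hx.union hy).subset ?_
    intro n hn
    by_contra hc
    simp only [Set.mem_union, Function.mem_support, not_or, not_not] at hc
    exact hn (by simp [hc.1, hc.2])
  | smul_tprod r u =>
    induction v using PiTensorProduct.induction_on with
    | add x y hx hy =>
      refine (hx.union hy).subset ?_
      intro n hn
      by_contra hc
      simp only [Set.mem_union, Function.mem_support, not_or, not_not] at hc
      exact hn (by simp only [map_add, hc.1, hc.2, add_zero])
    | smul_tprod r' v =>
      choose N hN using fun i => A.adjoint.truncation (u i) (v i)
      -- Non-zero terms have `n i < N i` for all `i`; with the sum fixed, `n` is bounded below too.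
      set B : ℤ := ∑ i, |N i + 1| with hB
      refine Set.Finite.of_finite_image (f := Subtype.val) ?_ Subtype.val_injective.injOn
      refine (Set.Finite.pi' (fun i : Fin k => Set.finite_Icc (s - B - 1) (N i))).subset ?_
      rintro _ ⟨n, hn, rfl⟩ i
      have hlt : ∀ j, n.1 j < N j := by
        intro j
        by_contra hj
        apply hn
        have h0 : A.Y (u j) (n.1 j) (v j) = 0 := hN j _ (not_lt.mp hj)
        simp only [map_smul, LinearMap.smul_apply, multiMode_tprod]
        rw [MultilinearMap.map_coord_zero _ j h0]
        simp
      refine ⟨?_, (hlt i).le⟩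
      have hsum := n.2
      rw [← Finset.add_sum_erase _ _ (Finset.mem_univ i)] at hsum
      have h1 : ∑ j ∈ Finset.univ.erase i, (n.1 j + 1) ≤
          ∑ j ∈ Finset.univ.erase i, |N j + 1| :=
        Finset.sum_le_sum fun j _ => by
          have := hlt j
          have := le_abs_self (N j + 1)
          omega
      have h2 : ∑ j ∈ Finset.univ.erase i, |N j + 1| ≤ B :=
        Finset.sum_le_sum_of_subset_of_nonneg (Finset.erase_subset _ _)
          (fun _ _ _ => abs_nonneg _)
      omega

/-- The vector `u` in position `i` and the vacuum in all the other positions of `V^{⊗k}`. -/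
def inPosition (i : Fin k) (u : V) : ⨂[ℂ] _ : Fin k, V :=
  PiTensorProduct.tprod ℂ (Function.update (fun _ => A.vac) i u)

/-- The tensor power `V^{⊗k}`, with vertex operators
`Y(u₁ ⊗ ⋯ ⊗ u_k, z) = Y(u₁, z) ⊗ ⋯ ⊗ Y(u_k, z)`, vacuum `𝟏 ⊗ ⋯ ⊗ 𝟏` and conformal vector
`∑ᵢ 𝟏 ⊗ ⋯ ⊗ ω ⊗ ⋯ ⊗ 𝟏`. In modes, `(u₁ ⊗ ⋯ ⊗ u_k)_p` is the (pointwise finite) sum of the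
`(u₁)_{n₁} ⊗ ⋯ ⊗ (u_k)_{n_k}` with `∑ (nᵢ + 1) = p + 1`. -/
def tensorPower : VertexData (⨂[ℂ] _ : Fin k, V) where
  Y :=
    { toFun := fun u p =>
        { toFun := fun v =>
            ∑ᶠ n : {n : Fin k → ℤ // ∑ i, (n i + 1) = p + 1}, multiMode A k n.1 u v
          map_add' := fun v w => by
            simp only [map_add]
            exact finsum_add_distrib (multiMode_finite A k _ u v) (multiMode_finite A k _ u w)
          map_smul' := fun c v => by
            simp only [map_smul, RingHom.id_apply]
            exact (smul_finsum' c (multiMode_finite A k _ u v)).symm }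
      map_add' := fun u u' => by
        ext1 p
        apply LinearMap.ext
        intro v
        simp only [map_add, LinearMap.add_apply, LinearMap.coe_mk, AddHom.coe_mk, Pi.add_apply]
        exact finsum_add_distrib (multiMode_finite A k _ u v) (multiMode_finite A k _ u' v)
      map_smul' := fun c u => by
        ext1 p
        apply LinearMap.ext
        intro v
        simp only [map_smul, LinearMap.smul_apply, LinearMap.coe_mk, AddHom.coe_mk, Pi.smul_apply,
          RingHom.id_apply]
        exact (smul_finsum' c (multiMode_finite A k _ u v)).symm }
  vac := PiTensorProduct.tprod ℂ (fun _ => A.vac)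
  conf := ∑ i, inPosition A k i A.conf

/-- The action of a permutation `σ` on `V^{⊗k}`: it moves the `i`-th tensor factor to position
`σ i`. -/
def permAction (V : Type*) [AddCommGroup V] [Module ℂ V] {k : ℕ} (σ : Equiv.Perm (Fin k)) :
    (⨂[ℂ] _ : Fin k, V) →ₗ[ℂ] (⨂[ℂ] _ : Fin k, V) :=
  (PiTensorProduct.reindex ℂ (fun _ : Fin k => V) σ).toLinearMap

end TensorPower

/-! ### The operator `Δ_k(z)` -/

/-- The operator `∑_{n ≥ 1} (-a_n) x^(n+1) d/dx` on `ℂ⟦x⟧`, where `a_n` is `a (n - 1)`. -/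
def vectorField (a : ℕ → ℂ) (f : PowerSeries ℂ) : PowerSeries ℂ :=
  -(PowerSeries.X ^ 2 * PowerSeries.mk a) * PowerSeries.derivative ℂ f

/-- The power series `exp (∑_{n ≥ 1} (-a_n) x^(n+1) d/dx) x`. (The `j`-th power of the
operator raises the degree by at least `j`, so that only `j ≤ m` contributes to the coefficient of
`x^m`.) -/
def expVectorField (a : ℕ → ℂ) : PowerSeries ℂ :=
  PowerSeries.mk fun m => ∑ j ∈ Finset.range (m + 1),
    (j.factorial : ℂ)⁻¹ * PowerSeries.coeff m ((vectorField a)^[j] PowerSeries.X)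

/-- The power series `((1 + x)^k - 1) / k`. -/
def targetSeries (k : ℕ) : PowerSeries ℂ :=
  PowerSeries.C ((k : ℂ)⁻¹) * ((1 + PowerSeries.X) ^ k - 1)

theorem X_pow_dvd_derivative {e : ℕ} {f : PowerSeries ℂ} (h : PowerSeries.X ^ (e + 1) ∣ f) :
    PowerSeries.X ^ e ∣ PowerSeries.derivative ℂ f := by
  rw [PowerSeries.X_pow_dvd_iff] at h ⊢
  intro m hm
  rw [PowerSeries.coeff_derivative, h (m + 1) (by omega), zero_mul]

theorem X_pow_dvd_vectorField (a : ℕ → ℂ) {c : ℕ} {f : PowerSeries ℂ}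
    (h : PowerSeries.X ^ (c + 1) ∣ f) : PowerSeries.X ^ (c + 2) ∣ vectorField a f := by
  obtain ⟨q, hq⟩ := X_pow_dvd_derivative h
  exact ⟨-(PowerSeries.mk a * q), by rw [vectorField, hq]; ring⟩

theorem X_pow_dvd_iterate (a : ℕ → ℂ) (j : ℕ) :
    PowerSeries.X ^ (j + 1) ∣ (vectorField a)^[j] PowerSeries.X := by
  induction j with
  | zero => simp
  | succ j ih => rw [Function.iterate_succ_apply']; exact X_pow_dvd_vectorField a ih

theorem vectorField_sub_dvd {a b : ℕ → ℂ} {i c d e : ℕ} (hab : ∀ t < i, a t = b t)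
    {f h : PowerSeries ℂ} (hfh : PowerSeries.X ^ (d + 1) ∣ f - h)
    (hf : PowerSeries.X ^ (c + 1) ∣ f) (hc : e ≤ i + 2 + c) (hd : e ≤ d + 2) :
    PowerSeries.X ^ e ∣ vectorField a f - vectorField b h := by
  have hA : PowerSeries.X ^ i ∣ PowerSeries.mk a - PowerSeries.mk b := by
    rw [PowerSeries.X_pow_dvd_iff]
    intro m hm
    simp [hab m hm]
  obtain ⟨A, hA⟩ := hA
  obtain ⟨q, hq⟩ := X_pow_dvd_derivative hf
  obtain ⟨s, hs⟩ := X_pow_dvd_derivative hfh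
  have key : vectorField a f - vectorField b h =
      PowerSeries.X ^ (i + 2 + c) * (-(A * q)) +
        PowerSeries.X ^ (d + 2) * (-(PowerSeries.mk b * s)) := by
    rw [map_sub] at hs
    have : PowerSeries.derivative ℂ h = PowerSeries.derivative ℂ f - PowerSeries.X ^ d * s := by
      rw [← hs]; ring
    have h2 : PowerSeries.mk a = PowerSeries.mk b + PowerSeries.X ^ i * A := by rw [← hA]; ring
    rw [vectorField, vectorField, this, hq, h2]
    ring
  rw [key]
  exact dvd_add ((pow_dvd_pow _ hc).mul_right _) ((pow_dvd_pow _ hd).mul_right _)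

theorem iterate_sub_dvd {a b : ℕ → ℂ} {i : ℕ} (hab : ∀ t < i, a t = b t) (j : ℕ) :
    PowerSeries.X ^ (i + 3) ∣
      (vectorField a)^[j + 2] PowerSeries.X - (vectorField b)^[j + 2] PowerSeries.X := by
  induction j with
  | zero =>
    refine vectorField_sub_dvd (c := 1) (d := i + 1) hab ?_ (X_pow_dvd_iterate a 1)
      (by omega) (by omega)
    exact vectorField_sub_dvd (c := 0) (d := i + 1) hab (by simp) (by simp) (by omega) (by omega)
  | succ j ih =>
    rw [Function.iterate_succ_apply' _ (j + 2), Function.iterate_succ_apply' _ (j + 2)]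
    exact vectorField_sub_dvd (c := 1) (d := i + 2) hab ih
      ((pow_dvd_pow _ (by omega)).trans (X_pow_dvd_iterate a (j + 2))) (by omega) (by omega)

/-- The equation for the coefficient of `x^(i+2)`, solved for `a i`. -/
def deltaRec (k : ℕ) (a : ℕ → ℂ) (i : ℕ) : ℂ :=
  (∑ j ∈ Finset.range (i + 1), ((j + 2).factorial : ℂ)⁻¹ *
    PowerSeries.coeff (i + 2) ((vectorField a)^[j + 2] PowerSeries.X)) -
      PowerSeries.coeff (i + 2) (targetSeries k)

theorem deltaRec_congr (k : ℕ) {a b : ℕ → ℂ} {i : ℕ} (hab : ∀ t < i, a t = b t) :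
    deltaRec k a i = deltaRec k b i := by
  unfold deltaRec
  congr 1
  refine Finset.sum_congr rfl fun j _ => ?_
  have := PowerSeries.X_pow_dvd_iff.mp (iterate_sub_dvd hab j) (i + 2) (by omega)
  rw [map_sub, sub_eq_zero] at this
  rw [this]

theorem expVectorField_eq_iff (k : ℕ) [NeZero k] (a : ℕ → ℂ) :
    expVectorField a = targetSeries k ↔ ∀ i, a i = deltaRec k a i := by
  have hk : (k : ℂ) ≠ 0 := Nat.cast_ne_zero.mpr (NeZero.ne k)
  have h1 : vectorField a PowerSeries.X = -(PowerSeries.X ^ 2 * PowerSeries.mk a) := by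
    simp [vectorField]
  have h2 : ∀ i, PowerSeries.coeff (i + 2) (expVectorField a) =
      PowerSeries.coeff (i + 2) (targetSeries k) + (deltaRec k a i - a i) := by
    intro i
    rw [expVectorField, PowerSeries.coeff_mk, Finset.sum_range_succ', Finset.sum_range_succ']
    have h3 : PowerSeries.coeff (i + 2) (PowerSeries.X ^ 2 * PowerSeries.mk a) = a i := by
      rw [PowerSeries.coeff_X_pow_mul, PowerSeries.coeff_mk]
    simp [deltaRec, h1, h3, PowerSeries.coeff_X]
    ring
  constructor
  · intro h i
    have := h2 i
    rw [h] at this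
    linear_combination this
  · intro h
    ext m
    match m with
    | 0 => simp [expVectorField, targetSeries]
    | 1 =>
      have h4 : PowerSeries.coeff 1 ((1 + PowerSeries.X : PowerSeries ℂ) ^ k) = k := by
        rw [show (1 + PowerSeries.X : PowerSeries ℂ) ^ k =
          (((1 + Polynomial.X) ^ k : Polynomial ℂ) : PowerSeries ℂ) by simp,
          Polynomial.coeff_coe, Polynomial.coeff_one_add_X_pow]
        simp
      have h5 : PowerSeries.coeff 1 (PowerSeries.X ^ 2 * PowerSeries.mk a) = 0 := by
        rw [PowerSeries.coeff_X_pow_mul', if_neg (by omega)]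
      simp [expVectorField, targetSeries, Finset.sum_range_succ, h1, h4, h5, PowerSeries.coeff_one,
        PowerSeries.coeff_C_mul, inv_mul_cancel₀ hk]
    | i + 2 => rw [h2 i, ← h i, sub_self, add_zero]

/-- The numbers `a_n` with `exp (∑_{n ≥ 1} (-a_n) x^(n+1) d/dx) x = ((1 + x)^k - 1) / k` exist and
are unique. -/
theorem existsUnique_deltaSeq (k : ℕ) [NeZero k] :
    ∃! a : ℕ → ℂ, expVectorField a = targetSeries k := by
  simp only [expVectorField_eq_iff]
  let F : (i : ℕ) → (∀ t, t < i → ℂ) → ℂ := fun i r =>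
    deltaRec k (fun t => if h : t < i then r t h else 0) i
  let a : ℕ → ℂ := Nat.lt_wfRel.wf.fix F
  have ha : ∀ i, a i = deltaRec k a i := by
    intro i
    have h1 : a i = F i (fun t _ => a t) := Nat.lt_wfRel.wf.fix_eq F i
    rw [h1]
    exact deltaRec_congr k fun t ht => by simp [ht]
  refine ⟨a, ha, fun b hb => ?_⟩
  funext i
  induction i using Nat.strong_induction_on with
  | _ i ih => rw [hb i, ha i]; exact deltaRec_congr k ih

/-- The sequence `a` of the preceding theorem; `a_n` is `deltaSeq k (n - 1)`. -/
def deltaSeq (k : ℕ) [NeZero k] : ℕ → ℂ := (existsUnique_deltaSeq k).choose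

theorem deltaSeq_spec (k : ℕ) [NeZero k] : expVectorField (deltaSeq k) = targetSeries k :=
  (existsUnique_deltaSeq k).choose_spec.1

section Delta

variable {V : Type*} [AddCommGroup V] [Module ℂ V] (A : VertexData V) (k : ℕ) [NeZero k]

/-- The series `∑_{n ≥ 1} a_n L(n) y^n`, with coefficients in `End V`. -/
def deltaExponent : PowerSeries (Module.End ℂ V) :=
  PowerSeries.mk fun n => if n = 0 then 0 else deltaSeq k (n - 1) • A.L n

/-- The coefficient of `y^j` in `exp (∑_{n ≥ 1} a_n L(n) y^n)`. (The `m`-th power of the exponent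
is divisible by `y^m`.) -/
def deltaExpCoeff (j : ℕ) : Module.End ℂ V :=
  ∑ m ∈ Finset.range (j + 1),
    (m.factorial : ℂ)⁻¹ • PowerSeries.coeff j (deltaExponent A k ^ m)

/-- With `x = z^(1/k)` and for `u` of weight `n`,
`Δ_k(z) u = exp (∑_{i ≥ 1} a_i z^(-i/k) L(i)) k^(-L(0)) z^((1/k - 1) L(0)) u` is
`∑_{j ≥ 0} deltaCoeff n j u x^((1 - k) n - j)`; this is a Laurent polynomial in `x`, because
`deltaExpCoeff j` lowers weights by `j`. -/
def deltaCoeff (n : ℤ) (j : ℕ) : Module.End ℂ V :=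
  (k : ℂ) ^ (-n) • deltaExpCoeff A k j

/-- For `u` of weight `n`, the coefficient of `z^(-p/k-1)` in `Y_W(Δ_k(z) u, z^(1/k))`. -/
def deltaFieldMode {W : Type*} [AddCommGroup W] [Module ℂ W]
    (Y : V →ₗ[ℂ] (ℤ → Module.End ℂ W)) (n : ℤ) (u : V) (p : ℤ) : Module.End ℂ W :=
  ∑ᶠ j : ℕ, Y (deltaCoeff A k n j u) (p + k - 1 + (1 - k) * n - j)

end Delta

/-- `(W, Y_T)` is the twisted module `T_σ(W)` attached to the module `(W, Y_W)`, for a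
`k`-cycle `σ`: it is a (weak) `σ`-twisted `V^{⊗k}`-module on the space `W` with
`Y_T(u ⊗ 𝟏 ⊗ ⋯ ⊗ 𝟏, z) = Y_W(Δ_k(z) u, z^(1/k))` for all (homogeneous) `u`. These conditions
determine `Y_T`; it is ordinary when `(W, Y_W)` is. -/
structure IsCycleTwist {V W : Type*} [AddCommGroup V] [Module ℂ V] [AddCommGroup W] [Module ℂ W]
    (A : VOA V) (k : ℕ) [NeZero k] (σ : Equiv.Perm (Fin k))
    (YW : V →ₗ[ℂ] (ℤ → Module.End ℂ W))
    (YT : (⨂[ℂ] _ : Fin k, V) →ₗ[ℂ] (ℤ → Module.End ℂ W)) : Prop where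
  twisted : IsWeakTwistedModule (tensorPower A k) (permAction V σ) k YT
  field : ∀ (n : ℤ) (u : V), u ∈ A.wt n → ∀ p : ℤ,
    YT (inPosition A k 0 u) p = deltaFieldMode A.toVertexData k YW n u p

end

/-! ### Exponentials of power series -/

/-! A twisted structure on `V^{⊗k}` is determined by the fields of the vectors `u ⊗ 𝟏 ⊗ ⋯ ⊗ 𝟏`: the
cycle carries them to the other positions, changing each mode only by a root of unity, and the
Jacobi identity recovers the field of `u_l v` from those of `u` and `v`. So it suffices that
`T_g(W)'` is `g⁻¹`-twisted and that its fields on these vectors are those of `T_{g⁻¹}(W')`.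

Put `x = z^(1/k)`. The two fields to compare are the transposes of `Y_W(Δ_k(z⁻¹) e^(zL(1))
(-z⁻²)^(L(0)) u, x⁻¹)` and `Y_W(e^(xL(1)) (-x⁻²)^(L(0)) Δ_k(z) u, x⁻¹)`. Once powers of `k` and `x`
are collected, equality says, degree by degree, that `exp(A) exp(k L(1)) = exp(L(1)) exp(A⁻)` with
`A = ∑ aₙ L(n)` and `A⁻ = ∑ (-1)ⁿ aₙ L(n)` (`exp_identity`).

This identity comes from formal vector fields. If `φ = ((1+x)^κ - 1)/κ`, then `log(1+κφ) = κ
log(1+x)`. Proportional coordinates have the same Euler field, so the change of variables `φ`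
carries `b_κ = (1+κx) log(1+κx)/κ d/dx` to `b_1` (`expFieldBracket_logField`). Hence `exp(A)`
intertwines `b_k` with `b_1`, and `exp(L(1))`, the case `κ = -1`, intertwines `b_{-1}` with `b_1`.
After rescaling `x`, both sides of the identity intertwine `b_{-k}` with `b_1`. The lowest nonzero
coefficient of their difference would commute with the leading term `L(0)` of `b_κ`, yet it lowers
weights by its positive degree; so there is none. Only the relations of the `L(n)` with `n ≥ 0`
enter.

That contragredients of twisted modules are twisted is the classical argument: conjugating a field
by `exp(t L(1))` (`dividedL_mode`) and applying Chu–Vandermonde turn the Jacobi identity for the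
adjoint fields into the one for the original fields at shifted modes, with the two orders of
composition exchanged. Since `p` becomes `-p` modulo `T`, the automorphism is inverted. Only the
formulas for `L(-1)`, `L(0)`, `L(1)` in `IsConformal` are used, and these pass to `V^{⊗k}` factor by
factor. The underlying spaces agree because `L(0)` of `T_g(W)` is `L(0)/k` plus a constant. -/

section AdicSum

variable {R : Type*} [Ring R]

/-- The sum of a family of power series whose `j`-th member has no terms of degree below `j`. -/
noncomputable def adicSum (F : ℕ → PowerSeries R) : PowerSeries R :=
  PowerSeries.mk fun m => ∑ j ∈ Finset.range (m + 1), PowerSeries.coeff m (F j)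

/-- The `j`-th member has no terms of degree below `j`. -/
def IsAdicFamily (F : ℕ → PowerSeries R) : Prop := ∀ j m, m < j → PowerSeries.coeff m (F j) = 0

theorem coeff_adicSum {F : ℕ → PowerSeries R} (hF : IsAdicFamily F) {m M : ℕ} (h : m < M) :
    PowerSeries.coeff m (adicSum F) = ∑ j ∈ Finset.range M, PowerSeries.coeff m (F j) := by
  rw [adicSum, PowerSeries.coeff_mk]
  refine Finset.sum_subset (Finset.range_mono h) fun j _ hj => hF j m ?_
  simpa using hj

/-- In a fixed degree `m` only indices at most `m` contribute, so both sides are finite sums over a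
square, regrouped along its antidiagonals. This is the Cauchy product used for exponentials. -/
theorem adicSum_mul {F G : ℕ → PowerSeries R} (hF : IsAdicFamily F) (hG : IsAdicFamily G) :
    adicSum F * adicSum G =
      adicSum fun n => ∑ ij ∈ Finset.HasAntidiagonal.antidiagonal n, F ij.1 * G ij.2 := by
  ext m
  have h1 : PowerSeries.coeff m (adicSum F * adicSum G) =
      ∑ x ∈ Finset.range (m + 1) ×ˢ Finset.range (m + 1),
        PowerSeries.coeff m (F x.1 * G x.2) := by
    rw [PowerSeries.coeff_mul]
    calc _ = ∑ p ∈ Finset.HasAntidiagonal.antidiagonal m, ∑ x ∈ Finset.range (m + 1) ×ˢ Finset.range (m + 1),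
          PowerSeries.coeff p.1 (F x.1) * PowerSeries.coeff p.2 (G x.2) := by
            refine Finset.sum_congr rfl fun p hp => ?_
            have := Finset.HasAntidiagonal.mem_antidiagonal.mp hp
            rw [coeff_adicSum hF (show p.1 < m + 1 by omega),
              coeff_adicSum hG (show p.2 < m + 1 by omega), Finset.sum_mul_sum,
              Finset.sum_product]
      _ = _ := by
            rw [Finset.sum_comm]
            simp only [PowerSeries.coeff_mul]
  rw [h1, adicSum, PowerSeries.coeff_mk]
  simp only [map_sum]
  rw [Finset.sum_sigma']
  symm
  refine Finset.sum_of_injOn (fun x => x.2) ?_ ?_ ?_ ?_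
  · rintro ⟨a, x⟩ hx ⟨b, y⟩ hy hxy
    simp only [Finset.coe_sigma, Set.mem_sigma_iff, Finset.mem_coe, Finset.HasAntidiagonal.mem_antidiagonal]
      at hx hy hxy
    subst hxy
    have : a = b := by omega
    subst this
    rfl
  · rintro ⟨a, x⟩ hx
    simp only [Finset.coe_sigma, Set.mem_sigma_iff, Finset.mem_coe, Finset.HasAntidiagonal.mem_antidiagonal,
      Finset.mem_range, Finset.coe_product, Set.mem_prod] at hx ⊢
    omega
  -- Pairs in the square with `i + j > m`: since `p.1 + p.2 = m`, one of the two factors is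
  -- evaluated below its order.
  · rintro ⟨i, j⟩ _ hx
    rw [PowerSeries.coeff_mul]
    refine Finset.sum_eq_zero fun p hp => ?_
    have := Finset.HasAntidiagonal.mem_antidiagonal.mp hp
    by_cases hi : p.1 < i
    · rw [hF _ _ hi, zero_mul]
    · by_cases hj : p.2 < j
      · rw [hG _ _ hj, mul_zero]
      · exact absurd ⟨⟨i + j, (i, j)⟩, by simp; omega, rfl⟩ hx
  · rintro ⟨a, x⟩ _
    rfl

theorem adicSum_mul_right {F : ℕ → PowerSeries R} (hF : IsAdicFamily F) (Y : PowerSeries R) :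
    adicSum F * Y = adicSum fun n => F n * Y := by
  have hG : IsAdicFamily fun n : ℕ => if n = 0 then Y else 0 := by
    intro j m h
    simp [show j ≠ 0 by omega]
  have h0 : adicSum (fun n : ℕ => if n = 0 then Y else 0) = Y := by
    ext m
    rw [adicSum, PowerSeries.coeff_mk, Finset.sum_range_succ']
    simp
  have h := adicSum_mul hF hG
  rw [h0] at h
  rw [h]
  congr 1
  ext1 n
  rw [Finset.sum_eq_single (n, 0)]
  · simp
  · rintro ⟨i, j⟩ hij hne
    rw [Finset.HasAntidiagonal.mem_antidiagonal] at hij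
    have : j ≠ 0 := by
      rintro rfl
      exact hne (by simp_all)
    simp [this]
  · simp

theorem coeff_pow_eq_zero_of_lt {X : PowerSeries R} (hX : PowerSeries.coeff 0 X = 0) (j : ℕ) :
    ∀ m, m < j → PowerSeries.coeff m (X ^ j) = 0 := by
  induction j with
  | zero => intro m hm; omega
  | succ j ih =>
    intro m hm
    rw [pow_succ, PowerSeries.coeff_mul]
    refine Finset.sum_eq_zero fun p hp => ?_
    have := Finset.HasAntidiagonal.mem_antidiagonal.mp hp
    by_cases h2 : p.2 = 0
    · rw [h2, hX, mul_zero]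
    · rw [ih _ (by omega), zero_mul]

end AdicSum

/-! ### Exponentials in an associative algebra and conjugation by them -/

section Exp

variable {R : Type*} [Ring R] [Algebra ℂ R]

/-- If `Y (i + 1) = [X, Y i]`, then
`X^m / m! * Y 0` is the sum of the `(Y i / i!) * (X^j / j!)` with `i + j = m`. -/
theorem dividedPow_mul_eq_sum (X : R) (Y : ℕ → R) (h : ∀ i, X * Y i - Y i * X = Y (i + 1))
    (m : ℕ) :
    ((m.factorial : ℂ)⁻¹ • X ^ m) * Y 0 = ∑ ij ∈ Finset.HasAntidiagonal.antidiagonal m,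
      ((ij.1.factorial : ℂ)⁻¹ • Y ij.1) * ((ij.2.factorial : ℂ)⁻¹ • X ^ ij.2) := by
  induction m with
  | zero => simp
  | succ m ih =>
    have hf : ∀ n : ℕ, ((n + 1 : ℕ) : ℂ) * (((n + 1).factorial : ℂ)⁻¹) = (n.factorial : ℂ)⁻¹ := by
      intro n
      have h1 : ((n + 1 : ℕ) : ℂ) ≠ 0 := Nat.cast_ne_zero.mpr (by omega)
      have h2 : (n.factorial : ℂ) ≠ 0 := Nat.cast_ne_zero.mpr n.factorial_ne_zero
      rw [Nat.factorial_succ, Nat.cast_mul, mul_inv, ← mul_assoc, mul_inv_cancel₀ h1, one_mul]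
    have hm : ((m + 1 : ℕ) : ℂ) ≠ 0 := Nat.cast_ne_zero.mpr (by omega)
    -- After multiplication by `m + 1` the induction is the Leibniz rule: on the term `(i, j)` the
    -- factor `m + 1` splits as `i + j`.
    refine smul_right_injective R hm ?_
    show ((m + 1 : ℕ) : ℂ) • (_ * _) = ((m + 1 : ℕ) : ℂ) • _
    have hX : ∀ i, X * Y i = Y i * X + Y (i + 1) := fun i => by rw [← h i]; abel
    calc ((m + 1 : ℕ) : ℂ) • ((((m + 1).factorial : ℂ)⁻¹ • X ^ (m + 1)) * Y 0)
        = X * (((m.factorial : ℂ)⁻¹ • X ^ m) * Y 0) := by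
          rw [← smul_mul_assoc, smul_smul, hf, pow_succ']
          simp only [smul_mul_assoc, mul_smul_comm, mul_assoc]
      _ = ∑ ij ∈ Finset.HasAntidiagonal.antidiagonal m, (((ij.1 + 1 : ℕ) : ℂ) •
            (((ij.1 + 1).factorial : ℂ)⁻¹ • Y (ij.1 + 1)) * ((ij.2.factorial : ℂ)⁻¹ • X ^ ij.2)) +
          ∑ ij ∈ Finset.HasAntidiagonal.antidiagonal m, (((ij.2 + 1 : ℕ) : ℂ) •
            ((ij.1.factorial : ℂ)⁻¹ • Y ij.1) *
              (((ij.2 + 1).factorial : ℂ)⁻¹ • X ^ (ij.2 + 1))) := by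
          rw [ih, Finset.mul_sum, ← Finset.sum_add_distrib]
          refine Finset.sum_congr rfl fun ij _ => ?_
          rw [smul_smul, hf]
          rw [smul_mul_assoc (((ij.2 + 1 : ℕ) : ℂ)), ← mul_smul_comm (((ij.2 + 1 : ℕ) : ℂ)),
            smul_smul, hf]
          simp only [smul_mul_assoc, mul_smul_comm]
          rw [← mul_assoc, hX, pow_succ', add_mul, smul_add, smul_add, mul_assoc]
          abel
      _ = ∑ ij ∈ Finset.HasAntidiagonal.antidiagonal (m + 1), (((ij.1 : ℕ) : ℂ) •
            (((ij.1).factorial : ℂ)⁻¹ • Y (ij.1)) * ((ij.2.factorial : ℂ)⁻¹ • X ^ ij.2)) +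
          ∑ ij ∈ Finset.HasAntidiagonal.antidiagonal (m + 1), (((ij.2 : ℕ) : ℂ) •
            ((ij.1.factorial : ℂ)⁻¹ • Y ij.1) *
              (((ij.2).factorial : ℂ)⁻¹ • X ^ (ij.2))) := by
          congr 1
          · rw [Finset.Nat.sum_antidiagonal_succ]
            simp
          · rw [Finset.Nat.sum_antidiagonal_succ']
            simp
      _ = _ := by
          rw [← Finset.sum_add_distrib, Finset.smul_sum]
          refine Finset.sum_congr rfl fun ij hij => ?_
          rw [← Finset.HasAntidiagonal.mem_antidiagonal.mp hij]
          push_cast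
          simp only [smul_mul_assoc, add_smul]

theorem coeff_smul_complex (n : ℕ) (c : ℂ) (X : PowerSeries R) :
    PowerSeries.coeff n (c • X) = c • PowerSeries.coeff n X := rfl

theorem isAdic_dividedPow {X : PowerSeries R} (hX : PowerSeries.coeff 0 X = 0) :
    IsAdicFamily fun m => (m.factorial : ℂ)⁻¹ • X ^ m := fun j m h => by
  rw [coeff_smul_complex, coeff_pow_eq_zero_of_lt hX j m h, smul_zero]

/-- The exponential of a power series without constant term. -/
noncomputable def expSeries (X : PowerSeries R) : PowerSeries R :=
  adicSum fun m => (m.factorial : ℂ)⁻¹ • X ^ m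

/-- This is `e^X Y e^(-X) = e^(ad X) Y`, written without the inverse of `e^X`; `Y i` plays the role
of `(ad X)^i Y`. -/
theorem expSeries_mul {X : PowerSeries R} (hX : PowerSeries.coeff 0 X = 0)
    {Y : ℕ → PowerSeries R} (h : ∀ i, X * Y i - Y i * X = Y (i + 1)) (hY : IsAdicFamily Y) :
    expSeries X * Y 0 = adicSum (fun i => (i.factorial : ℂ)⁻¹ • Y i) * expSeries X := by
  rw [expSeries, adicSum_mul_right (isAdic_dividedPow hX), adicSum_mul _ (isAdic_dividedPow hX)]
  · congr 1
    ext1 m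
    exact dividedPow_mul_eq_sum X Y h m
  · intro j m hm
    rw [coeff_smul_complex, hY j m hm, smul_zero]

/-- The substitution `t ↦ c t`. -/
noncomputable def scaleSeries (c : ℂ) (X : PowerSeries R) : PowerSeries R :=
  PowerSeries.mk fun n => c ^ n • PowerSeries.coeff n X

theorem scaleSeries_mul (c : ℂ) (X Y : PowerSeries R) :
    scaleSeries c (X * Y) = scaleSeries c X * scaleSeries c Y := by
  ext n
  simp only [scaleSeries, PowerSeries.coeff_mk, PowerSeries.coeff_mul, Finset.smul_sum]
  refine Finset.sum_congr rfl fun p hp => ?_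
  rw [← Finset.HasAntidiagonal.mem_antidiagonal.mp hp, pow_add, smul_mul_smul_comm]

end Exp

/-! ### Formal vector fields -/

section VectorField

open PowerSeries

/-- The operator `vectorField a` as a linear map. -/
noncomputable def vectorFieldEnd (a : ℕ → ℂ) : Module.End ℂ (PowerSeries ℂ) :=
  LinearMap.mulLeft ℂ (-(X ^ 2 * mk a)) ∘ₗ (derivative ℂ).toLinearMap

theorem vectorFieldEnd_apply (a : ℕ → ℂ) (f : PowerSeries ℂ) :
    vectorFieldEnd a f = -(X ^ 2 * mk a) * derivative ℂ f := rfl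

theorem vectorFieldEnd_pow (a : ℕ → ℂ) (j : ℕ) (f : PowerSeries ℂ) :
    (vectorFieldEnd a ^ j) f = (vectorField a)^[j] f := by
  rw [Module.End.pow_apply]
  rfl

/-- The bracket `[x² a(x), q(x)] = (x² a)' q - x² a q'`. -/
noncomputable def fieldBracket (a : ℕ → ℂ) (q : PowerSeries ℂ) : PowerSeries ℂ :=
  derivative ℂ (X ^ 2 * mk a) * q - X ^ 2 * mk a * derivative ℂ q

/-- The field `x² a(x) d/dx` vanishes to order two at the origin, so bracketing with it raises the
order of vanishing by one. This makes `exp (ad (x² a))` converge adically. -/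
theorem X_pow_dvd_fieldBracket (a : ℕ → ℂ) {e : ℕ} {q : PowerSeries ℂ} (h : X ^ e ∣ q) :
    X ^ (e + 1) ∣ fieldBracket a q := by
  have h1 : X ∣ derivative ℂ (X ^ 2 * mk a : PowerSeries ℂ) := by
    simpa using X_pow_dvd_derivative (e := 1) (f := X ^ 2 * mk a) (Dvd.intro _ rfl)
  refine dvd_sub ?_ ?_
  · rw [pow_succ']
    exact mul_dvd_mul h1 h
  · cases e with
    | zero => exact Dvd.dvd.mul_right ((pow_dvd_pow _ (by omega)).mul_right _) _
    | succ e =>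
      have := X_pow_dvd_derivative h
      have h2 : (X : PowerSeries ℂ) ^ 2 ∣ X ^ 2 * mk a := Dvd.intro _ rfl
      rw [show e + 1 + 1 = 2 + e by ring, pow_add]
      exact mul_dvd_mul h2 this

theorem X_pow_dvd_iterate_fieldBracket (a : ℕ → ℂ) {e : ℕ} {q : PowerSeries ℂ} (h : X ^ e ∣ q)
    (i : ℕ) : X ^ (e + i) ∣ (fieldBracket a)^[i] q := by
  induction i with
  | zero => simpa
  | succ i ih =>
    rw [Function.iterate_succ_apply']
    exact X_pow_dvd_fieldBracket a ih

theorem X_pow_dvd_vectorFieldEnd_pow (a : ℕ → ℂ) (f : PowerSeries ℂ) (j : ℕ) :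
    X ^ (j + 2) ∣ (vectorFieldEnd a ^ (j + 1)) f := by
  induction j with
  | zero =>
    rw [pow_one, vectorFieldEnd_apply]
    exact ⟨-(mk a * derivative ℂ f), by ring⟩
  | succ j ih =>
    rw [pow_succ' (vectorFieldEnd a), Module.End.mul_apply]
    exact X_pow_dvd_vectorField a (c := j + 1) ih

/-- The series `exp (-x² a(x) d/dx) f`. -/
noncomputable def expField (a : ℕ → ℂ) (f : PowerSeries ℂ) : PowerSeries ℂ :=
  adicSum fun j => (j.factorial : ℂ)⁻¹ • (vectorFieldEnd a ^ j) f

/-- The series `exp (ad (x² a(x))) q`. -/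
noncomputable def expFieldBracket (a : ℕ → ℂ) (q : PowerSeries ℂ) : PowerSeries ℂ :=
  adicSum fun j => (j.factorial : ℂ)⁻¹ • (fieldBracket a)^[j] q

theorem expField_X (a : ℕ → ℂ) : expField a X = expVectorField a := by
  ext m
  simp only [expField, adicSum, expVectorField, coeff_mk, coeff_smul_complex,
    vectorFieldEnd_pow, smul_eq_mul]

theorem expField_add (a : ℕ → ℂ) (f g : PowerSeries ℂ) :
    expField a (f + g) = expField a f + expField a g := by
  ext m
  simp [expField, adicSum, Finset.sum_add_distrib]

theorem expField_smul (a : ℕ → ℂ) (c : ℂ) (f : PowerSeries ℂ) :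
    expField a (c • f) = c • expField a f := by
  ext m
  simp [expField, adicSum, Finset.mul_sum, mul_left_comm]

theorem expField_one (a : ℕ → ℂ) : expField a 1 = 1 := by
  ext m
  simp only [expField, adicSum, coeff_mk]
  rw [Finset.sum_range_succ', Finset.sum_eq_zero]
  · simp
  · intro j _
    have : (vectorFieldEnd a) 1 = 0 := by simp [vectorFieldEnd_apply]
    rw [pow_succ, Module.End.mul_apply, this]
    simp

theorem coeff_zero_expField (a : ℕ → ℂ) (f : PowerSeries ℂ) :
    coeff 0 (expField a f) = coeff 0 f := by
  simp [expField, adicSum]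

theorem isAdic_smul_of_dvd {F : ℕ → PowerSeries ℂ} (h : ∀ j, X ^ j ∣ F j) :
    IsAdicFamily fun j => (j.factorial : ℂ)⁻¹ • F j := fun j m hm => by
  rw [coeff_smul_complex, X_pow_dvd_iff.mp (h j) m hm, smul_zero]

/-- Conjugating the operator `q d/dx` by the exponential of a vector field gives the operator `(exp
(ad) q) d/dx`. Applied to `f = x`, this computes the transformed field from the change of
coordinates. -/
theorem expField_mul_derivative (a : ℕ → ℂ) (q f : PowerSeries ℂ) :
    expField a (q * derivative ℂ f) = expFieldBracket a q * derivative ℂ (expField a f) := by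
  have hd : ∀ j, X ^ j ∣ derivative ℂ ((vectorFieldEnd a ^ j) f) := by
    intro j
    cases j with
    | zero => simp
    | succ j => exact X_pow_dvd_derivative (X_pow_dvd_vectorFieldEnd_pow a f j)
  have hv : ∀ j, X ^ j ∣ (vectorFieldEnd a ^ j) f := by
    intro j
    cases j with
    | zero => simp
    | succ j => exact (pow_dvd_pow _ (by omega)).trans (X_pow_dvd_vectorFieldEnd_pow a f j)
  have hq : ∀ j, X ^ j ∣ (fieldBracket a)^[j] q := by
    intro j
    simpa using X_pow_dvd_iterate_fieldBracket a (e := 0) (q := q) (by simp) j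
  have h1 : derivative ℂ (expField a f) =
      adicSum fun j => (j.factorial : ℂ)⁻¹ • derivative ℂ ((vectorFieldEnd a ^ j) f) := by
    ext m
    rw [coeff_derivative, expField,
      coeff_adicSum (isAdic_smul_of_dvd hv) (show m + 1 < m + 2 by omega),
      coeff_adicSum (isAdic_smul_of_dvd hd) (show m < m + 2 by omega), Finset.sum_mul]
    refine Finset.sum_congr rfl fun j _ => ?_
    rw [coeff_smul_complex, coeff_smul_complex, coeff_derivative, smul_mul_assoc]
  rw [h1, expFieldBracket, adicSum_mul (isAdic_smul_of_dvd hq) (isAdic_smul_of_dvd hd), expField]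
  congr 1
  ext1 m
  -- In `End ℂ⟦x⟧` the commutator of `-x² a d/dx` with `q d/dx` is `fieldBracket a q` times `d/dx`;
  -- this accounts for the sign in `fieldBracket`.
  have key := dividedPow_mul_eq_sum (vectorFieldEnd a)
    (fun i => LinearMap.mulLeft ℂ ((fieldBracket a)^[i] q) ∘ₗ (derivative ℂ).toLinearMap) (by
      intro i
      ext1 h
      simp only [LinearMap.sub_apply, Module.End.mul_apply, LinearMap.comp_apply,
        LinearMap.mulLeft_apply, vectorFieldEnd_apply,
        Derivation.coeFn_coe, Function.iterate_succ_apply', fieldBracket]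
      generalize (fieldBracket a)^[i] q = s
      simp only [Derivation.leibniz, map_neg, smul_eq_mul, neg_mul]
      ring) m
  have := LinearMap.congr_fun key f
  simpa only [LinearMap.sum_apply, Module.End.mul_apply, LinearMap.smul_apply,
    LinearMap.comp_apply, LinearMap.mulLeft_apply,
    Derivation.coeFn_coe, Function.iterate_zero_apply, map_smul, mul_smul_comm,
    smul_mul_assoc] using this

/-- The series `(1 + κ x) log (1 + κ x) / κ`. -/
noncomputable def logField (κ : ℂ) : PowerSeries ℂ :=
  mk fun n => κ ^ (n - 1) * if n = 1 then 1 else (-1) ^ n / ((n : ℂ) * (n - 1))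

/-- From `q' = log (1 + κx) + 1` for `q = (1 + κx) log (1 + κx) / κ`. The equation replaces all use
of logarithms below. -/
theorem logField_ode (κ : ℂ) : (1 + κ • X) * derivative ℂ (logField κ) =
    κ • logField κ + (1 + κ • X) := by
  ext n
  rw [add_mul, one_mul, smul_mul_assoc]
  simp only [map_add, coeff_smul_complex, smul_eq_mul]
  match n with
  | 0 => simp [coeff_derivative, logField]
  | 1 =>
    rw [show (1 : ℕ) = 0 + 1 from rfl, coeff_succ_X_mul]
    simp [coeff_derivative, logField, coeff_one, coeff_X]
    ring
  | n + 2 =>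
    rw [show n + 2 = (n + 1) + 1 from rfl, coeff_succ_X_mul]
    have h1 : ((n : ℂ) + 1) ≠ 0 := by exact_mod_cast Nat.succ_ne_zero n
    have h2 : ((n : ℂ) + 2) ≠ 0 := by exact_mod_cast Nat.succ_ne_zero (n + 1)
    have h3 : ((n : ℂ) + 3) ≠ 0 := by exact_mod_cast Nat.succ_ne_zero (n + 2)
    have e1 : coeff (n + 2) (logField κ) =
        κ ^ (n + 1) * ((-1) ^ n / (((n : ℂ) + 2) * (n + 1))) := by
      simp only [logField, coeff_mk]
      rw [if_neg (by omega), show n + 2 - 1 = n + 1 by omega]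
      push_cast
      congr 2
      · ring
      · ring
    have e2 : coeff (n + 3) (logField κ) =
        κ ^ (n + 2) * (-(-1) ^ n / (((n : ℂ) + 3) * (n + 2))) := by
      simp only [logField, coeff_mk]
      rw [if_neg (by omega), show n + 3 - 1 = n + 2 by omega]
      push_cast
      congr 2
      · ring
      · ring
    simp only [coeff_derivative, coeff_one, coeff_X]
    rw [show n + 1 + 1 + 1 = n + 3 from rfl, show n + 1 + 1 = n + 2 from rfl, e1, e2]
    simp only [show n + 2 ≠ 0 by omega, show n + 2 ≠ 1 by omega, if_false]
    push_cast
    field_simp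
    ring

/-- For `n = 0` the formula for the coefficient divides by zero, and the default value `0` is the
right one. -/
theorem coeff_zero_logField (κ : ℂ) : coeff 0 (logField κ) = 0 := by
  simp [logField]

/-- The solutions are the multiples of `(1 + x)^κ`, determined by the constant term: the equation is
a first-order recursion for the coefficients. -/
theorem eq_zero_of_ode {κ : ℂ} {d : PowerSeries ℂ} (h0 : coeff 0 d = 0)
    (h : (1 + X) * derivative ℂ d = κ • d) : d = 0 := by
  have h1 : ∀ n, coeff n d = 0 := by
    intro n
    induction n with
    | zero => exact h0
    | succ n ih =>
      have h2 := congrArg (coeff n) h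
      rw [coeff_smul_complex, ih, add_mul, one_mul, map_add, coeff_derivative] at h2
      have h3 : coeff n (X * derivative ℂ d) = 0 := by
        cases n with
        | zero => simp
        | succ n => rw [coeff_succ_X_mul, coeff_derivative, ih, zero_mul]
      rw [h3, smul_zero, add_zero] at h2
      exact (mul_eq_zero.mp h2).resolve_right (by exact_mod_cast Nat.succ_ne_zero n)
  ext n
  simp [h1]

/-- If `φ = exp (-x² a(x) d/dx) x` satisfies `(1 + x) φ' = 1 + κ φ`, that is,
`φ = ((1 + x)^κ - 1) / κ`, then `exp (ad (x² a))` maps `(1 + κ x) log (1 + κ x) / κ` to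
`(1 + x) log (1 + x)`. -/
theorem expFieldBracket_logField {a : ℕ → ℂ} {κ : ℂ}
    (h : (1 + X) * derivative ℂ (expVectorField a) = 1 + κ • expVectorField a) :
    expFieldBracket a (logField κ) = logField 1 := by
  set φ := expVectorField a with hφ
  have hφX : expField a X = φ := expField_X a
  have hφ0 : coeff 0 φ = 0 := by rw [← hφX, coeff_zero_expField, coeff_zero_X]
  have hne : derivative ℂ φ ≠ 0 := by
    intro h0
    have := congrArg (coeff 0) h
    rw [h0, mul_zero, map_add, coeff_smul_complex, hφ0] at this
    simp at this
  -- The hypothesis says that the simpler field `(1 + κx) d/dx` goes to `(1 + x) d/dx`.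
  have hq : expFieldBracket a (1 + κ • X) = 1 + X := by
    have h1 := expField_mul_derivative a (1 + κ • X) X
    rw [derivative_X, mul_one, hφX, expField_add, expField_smul, expField_one, hφX, ← h] at h1
    exact (mul_right_cancel₀ hne h1).symm
  have h2 := expField_mul_derivative a (1 + κ • X) (logField κ)
  rw [hq, logField_ode, expField_add, expField_smul, expField_add, expField_one, expField_smul,
    hφX, ← h] at h2
  have h3 := expField_mul_derivative a (logField κ) X
  rw [derivative_X, mul_one, hφX] at h3
  have hl := logField_ode 1
  rw [one_smul, one_smul] at hl
  have hdd := congrArg (derivative ℂ) h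
  simp only [Derivation.leibniz, map_add, Derivation.map_one_eq_zero, derivative_X, smul_eq_mul,
    Derivation.map_smul, zero_add, mul_one] at hdd
  -- The expected value of `logField κ` after substituting `φ` is `logField 1 * φ'`. The difference
  -- has no constant term, and by the equations of both logarithmic fields together with the
  -- derivative of `h` it solves `(1 + x) d' = κ d`.
  have h4 : expField a (logField κ) - logField 1 * derivative ℂ φ = 0 := by
    refine eq_zero_of_ode (κ := κ) ?_ ?_
    · rw [map_sub, coeff_zero_expField, coeff_zero_logField, coeff_mul]
      simp [coeff_zero_logField]
    · rw [map_sub, Derivation.leibniz, smul_eq_mul, smul_eq_mul, smul_sub, mul_sub, ← h2]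
      rw [← smul_mul_assoc]
      have e1 : κ • logField 1 * derivative ℂ φ = logField 1 * (κ • derivative ℂ φ) := by
        rw [smul_mul_assoc, mul_smul_comm]
      rw [e1, ← hdd]
      linear_combination (-derivative ℂ φ) * hl
  rw [h3] at h4
  exact mul_right_cancel₀ hne (sub_eq_zero.mp h4)

end VectorField

/-! ### Representations of the Lie algebra of formal vector fields -/

section Witt

open PowerSeries

variable {R : Type*} [Ring R] [Algebra ℂ R] (L : ℕ → R)

/-- The image of `q(x) d/dx`, with `x^(n+1) d/dx` acting as `L n`, graded by powers of `t`. -/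
noncomputable def fieldSeries (q : PowerSeries ℂ) : PowerSeries R :=
  mk fun n => coeff (n + 1) q • L n

theorem coeff_X_mul_derivative (P : PowerSeries ℂ) (n : ℕ) :
    coeff n (X * derivative ℂ P) = n * coeff n P := by
  cases n with
  | zero => simp
  | succ n => rw [coeff_succ_X_mul, coeff_derivative]; push_cast; ring

variable {L}

/-- The relation `[L m, L n] = (m - n) L (m + n)` has the opposite sign to the bracket of the fields
`x^(n+1) d/dx`, and so does `fieldBracket`; the two sign conventions match. -/
theorem fieldSeries_commutator
    (hL : ∀ m n, L m * L n - L n * L m = ((m : ℂ) - n) • L (m + n)) (a : ℕ → ℂ)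
    {q : PowerSeries ℂ} (hq : X ∣ q) :
    fieldSeries L (X ^ 2 * mk a) * fieldSeries L q - fieldSeries L q * fieldSeries L (X ^ 2 * mk a)
      = fieldSeries L (fieldBracket a q) := by
  obtain ⟨Q, rfl⟩ := hq
  set P : PowerSeries ℂ := X * mk a with hP
  have hPX : (X ^ 2 * mk a : PowerSeries ℂ) = X * P := by rw [hP]; ring
  ext N
  have h1 : coeff (N + 1) (fieldBracket a (X * Q)) =
      ∑ p ∈ Finset.HasAntidiagonal.antidiagonal N, ((p.1 : ℂ) - p.2) * (coeff p.1 P * coeff p.2 Q) := by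
    have : fieldBracket a (X * Q) = X * (X * derivative ℂ P * Q - P * (X * derivative ℂ Q)) := by
      rw [fieldBracket, hPX]
      simp only [Derivation.leibniz, derivative_X, smul_eq_mul]
      ring
    rw [this, coeff_succ_X_mul, map_sub, coeff_mul, coeff_mul, ← Finset.sum_sub_distrib]
    refine Finset.sum_congr rfl fun p _ => ?_
    rw [coeff_X_mul_derivative, coeff_X_mul_derivative]
    ring
  rw [hPX, map_sub, coeff_mul, coeff_mul,
    ← Finset.Nat.sum_antidiagonal_swap (f := fun p => coeff p.1 (fieldSeries L (X * Q)) *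
      coeff p.2 (fieldSeries L (X * P))), ← Finset.sum_sub_distrib]
  simp only [fieldSeries, coeff_mk, coeff_succ_X_mul, h1, Prod.fst_swap, Prod.snd_swap,
    Finset.sum_smul]
  refine Finset.sum_congr rfl fun p hp => ?_
  rw [← Finset.HasAntidiagonal.mem_antidiagonal.mp hp, smul_mul_smul_comm, smul_mul_smul_comm,
    mul_comm (coeff p.2 Q), ← smul_sub, hL, smul_smul, mul_comm]

/-- Conjugation by `exp(∑ aₙ L(n) tⁿ)` is computed inside the Lie algebra of vector fields, so the
one-variable calculation holds in every representation. -/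
theorem expSeries_fieldSeries_mul
    (hL : ∀ m n, L m * L n - L n * L m = ((m : ℂ) - n) • L (m + n)) (a : ℕ → ℂ)
    {q : PowerSeries ℂ} (hq : X ∣ q) :
    expSeries (fieldSeries L (X ^ 2 * mk a)) * fieldSeries L q =
      fieldSeries L (expFieldBracket a q) * expSeries (fieldSeries L (X ^ 2 * mk a)) := by
  have hd : ∀ i, X ^ (1 + i) ∣ (fieldBracket a)^[i] q := fun i =>
    X_pow_dvd_iterate_fieldBracket a (by simpa using hq) i
  have hd' : ∀ i, X ^ i ∣ (fieldBracket a)^[i] q := fun i =>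
    (pow_dvd_pow _ (by omega)).trans (hd i)
  have h0 : coeff 0 (fieldSeries L (X ^ 2 * mk a)) = 0 := by
    simp [fieldSeries, coeff_X_pow_mul']
  have hA : IsAdicFamily fun i => fieldSeries L ((fieldBracket a)^[i] q) := by
    intro i m hm
    simp only [fieldSeries, coeff_mk]
    rw [X_pow_dvd_iff.mp (hd i) _ (by omega), zero_smul]
  have key := expSeries_mul h0 (Y := fun i => fieldSeries L ((fieldBracket a)^[i] q)) (by
    intro i
    rw [fieldSeries_commutator hL a, Function.iterate_succ_apply']
    exact (dvd_pow_self X (by omega)).trans (hd i)) hA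
  rw [Function.iterate_zero_apply] at key
  rw [key]
  congr 1
  ext m
  rw [coeff_adicSum (M := m + 2) _ (by omega), fieldSeries, coeff_mk, expFieldBracket,
    coeff_adicSum (isAdic_smul_of_dvd hd') (show m + 1 < m + 2 by omega), Finset.sum_smul]
  · refine Finset.sum_congr rfl fun j _ => ?_
    rw [coeff_smul_complex, coeff_smul_complex, fieldSeries, coeff_mk, smul_assoc]
  · intro j m hm
    rw [coeff_smul_complex, hA j m hm, smul_zero]

/-- The field `b_κ` depends on `κ` and `x` only through rescaling, as the Euler field of `log (1 +
κx)`. -/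
theorem scaleSeries_logField (c κ : ℂ) :
    scaleSeries c (fieldSeries L (logField κ)) = fieldSeries L (logField (c * κ)) := by
  ext n
  simp only [scaleSeries, fieldSeries, logField, coeff_mk, smul_smul, Nat.add_sub_cancel]
  rw [mul_pow, mul_assoc]

/-- `(1 + x) φ' = 1 + k φ` for `φ = ((1 + x)^k - 1) / k`. -/
theorem targetSeries_ode (k : ℕ) [NeZero k] :
    (1 + X) * derivative ℂ (targetSeries k) = 1 + (k : ℂ) • targetSeries k := by
  have hk : (k : ℂ) ≠ 0 := Nat.cast_ne_zero.mpr (NeZero.ne k)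
  obtain ⟨n, hn⟩ := Nat.exists_eq_succ_of_ne_zero (NeZero.ne k)
  have hC : (C (k : ℂ)⁻¹ : PowerSeries ℂ) * (k : PowerSeries ℂ) = 1 := by
    rw [show (k : PowerSeries ℂ) = C (k : ℂ) by simp, ← map_mul, inv_mul_cancel₀ hk, map_one]
  have h1 : derivative ℂ (targetSeries k) = (1 + X) ^ n := by
    rw [targetSeries, Derivation.leibniz, derivative_C, smul_zero, add_zero, map_sub,
      Derivation.leibniz_pow]
    simp only [map_add, Derivation.map_one_eq_zero, derivative_X, sub_zero, zero_add, smul_eq_mul,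
      mul_one, nsmul_eq_mul]
    rw [← mul_assoc, hC, one_mul, hn]
    rfl
  rw [h1, ← pow_succ', ← Nat.succ_eq_add_one, ← hn, targetSeries, smul_eq_C_mul, ← mul_assoc,
    ← map_mul, mul_inv_cancel₀ hk, map_one, one_mul]
  ring

/-- The sequence `1, 0, 0, …`, with `exp (-x² d/dx) x = x / (1 + x)`. -/
def invSeq (n : ℕ) : ℂ := if n = 0 then 1 else 0

theorem mk_invSeq : (mk invSeq : PowerSeries ℂ) = 1 := by
  ext n
  simp [invSeq, coeff_one]

/-- The series is `x / (1 + x) = ((1 + x)^κ - 1) / κ` for `κ = -1`, so `exp(L(1))` falls under the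
same lemma as `exp(∑ aₙ L(n))`. -/
theorem expVectorField_invSeq_ode :
    (1 + X) * derivative ℂ (expVectorField invSeq) = 1 + (-1 : ℂ) • expVectorField invSeq := by
  have h1 : ∀ j, (vectorField invSeq)^[j] X =
      ((-1 : ℂ) ^ j * (j.factorial : ℂ)) • (X ^ (j + 1) : PowerSeries ℂ) := by
    intro j
    induction j with
    | zero => simp
    | succ j ih =>
      rw [Function.iterate_succ_apply', ih, vectorField, mk_invSeq, mul_one, Derivation.map_smul,
        Derivation.leibniz_pow, derivative_X, Nat.factorial_succ, Nat.add_sub_cancel]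
      simp only [smul_eq_C_mul, smul_eq_mul, nsmul_eq_mul, mul_one]
      rw [show ((j + 1 : ℕ) : PowerSeries ℂ) = C ((j : ℂ) + 1) by simp]
      rw [show C ((-1 : ℂ) ^ (j + 1) * (((j + 1) * j.factorial : ℕ) : ℂ)) =
        -(C ((-1 : ℂ) ^ j * (j.factorial : ℂ)) * C ((j : ℂ) + 1)) by
          rw [← map_mul, ← map_neg]; congr 1; push_cast; ring]
      ring
  have h2 : ∀ m, coeff (m + 1) (expVectorField invSeq) = (-1) ^ m := by
    intro m
    rw [expVectorField, coeff_mk, Finset.sum_eq_single m]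
    · have : (m.factorial : ℂ) ≠ 0 := Nat.cast_ne_zero.mpr m.factorial_ne_zero
      rw [h1, coeff_smul_complex, coeff_X_pow_self, smul_eq_mul, mul_one]
      field_simp
    · intro j _ hj
      rw [h1, coeff_smul_complex, coeff_X_pow, if_neg (by omega), smul_zero, mul_zero]
    · intro h
      exact absurd (Finset.mem_range.mpr (by omega)) h
  have h3 : coeff 0 (expVectorField invSeq) = 0 := by
    rw [← expField_X, coeff_zero_expField, coeff_zero_X]
  ext n
  rw [add_mul, one_mul, map_add, coeff_X_mul_derivative, coeff_derivative, map_add,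
    coeff_smul_complex, h2]
  cases n with
  | zero => simp [h3]
  | succ n => rw [h2]; simp [coeff_one]; ring

/-- The identity `exp(A) exp(k L(1)) = exp(L(1)) exp(A⁻)` in degree `s`, where
`A = ∑ aₙ L(n)` and `A⁻ = ∑ (-1)ⁿ aₙ L(n)`, for the numbers `aₙ` with
`exp (-∑ aₙ x^(n+1) d/dx) x = ((1 + x)^k - 1) / k`. -/
theorem exp_identity (hL : ∀ m n, L m * L n - L n * L m = ((m : ℂ) - n) • L (m + n))
    (k : ℕ) [NeZero k] (s : ℕ) :
    ∑ p ∈ Finset.HasAntidiagonal.antidiagonal s,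
      coeff p.1 (expSeries (fieldSeries L (X ^ 2 * mk (deltaSeq k)))) *
        ((k : ℂ) ^ p.2 • ((p.2.factorial : ℂ)⁻¹ • L 1 ^ p.2)) =
    ∑ p ∈ Finset.HasAntidiagonal.antidiagonal s, ((p.1.factorial : ℂ)⁻¹ • L 1 ^ p.1) *
      ((-1 : ℂ) ^ p.2 •
        coeff p.2 (expSeries (fieldSeries L (X ^ 2 * mk (deltaSeq k))))) := by
  set E := expSeries (fieldSeries L (X ^ 2 * mk (deltaSeq k))) with hE
  set F := expSeries (fieldSeries L (X ^ 2 * mk invSeq)) with hF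
  have hX : ∀ κ : ℂ, (X : PowerSeries ℂ) ∣ logField κ := fun κ =>
    X_dvd_iff.mpr (by rw [← coeff_zero_eq_constantCoeff_apply]; exact coeff_zero_logField κ)
  have hFc : ∀ j, coeff j F = (j.factorial : ℂ)⁻¹ • L 1 ^ j := by
    have h1 : fieldSeries L (X ^ 2 * mk invSeq) = X * C (L 1) := by
      ext n
      rw [mk_invSeq, mul_one, fieldSeries, coeff_mk, X_mul, ]
      cases n with
      | zero => simp [coeff_X_pow]
      | succ n =>
        rw [coeff_succ_mul_X, coeff_C, coeff_X_pow]
        cases n <;> simp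
    have h2 : ∀ m, (X * C (L 1)) ^ m = X ^ m * C (L 1 ^ m) := by
      intro m
      rw [(commute_X (C (L 1))).symm.mul_pow, map_pow]
    intro j
    rw [hF, expSeries, h1, adicSum, coeff_mk, Finset.sum_eq_single j]
    · rw [coeff_smul_complex, h2, coeff_X_pow_mul']
      simp
    · intro m hm hmj
      rw [coeff_smul_complex, h2, coeff_X_pow_mul']
      split_ifs
      · rw [coeff_C, if_neg (by omega), smul_zero]
      · rw [smul_zero]
    · intro h
      exact absurd (Finset.mem_range.mpr (by omega)) h
  have hEb : E * fieldSeries L (logField k) = fieldSeries L (logField 1) * E := by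
    rw [hE, expSeries_fieldSeries_mul hL _ (hX _), expFieldBracket_logField]
    rw [deltaSeq_spec]
    exact targetSeries_ode k
  have hFb : F * fieldSeries L (logField (-1)) = fieldSeries L (logField 1) * F := by
    rw [hF, expSeries_fieldSeries_mul hL _ (hX _), expFieldBracket_logField]
    exact expVectorField_invSeq_ode
  have hFk := congrArg (scaleSeries (k : ℂ)) hFb
  have hEm := congrArg (scaleSeries (-1 : ℂ)) hEb
  rw [scaleSeries_mul, scaleSeries_mul, scaleSeries_logField, scaleSeries_logField, mul_one,
    mul_neg, mul_one] at hFk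
  rw [scaleSeries_mul, scaleSeries_mul, scaleSeries_logField, scaleSeries_logField, mul_one,
    neg_mul, one_mul] at hEm
  -- `scaleSeries k F` carries `b_{-k}` to `b_k`, which `E` carries to `b_1`; `scaleSeries (-1) E`
  -- carries `b_{-k}` to `b_{-1}`, which `F` carries to `b_1`.
  set D := E * scaleSeries (k : ℂ) F - F * scaleSeries (-1) E with hD
  have hDb : D * fieldSeries L (logField (-k)) = fieldSeries L (logField 1) * D := by
    rw [hD, sub_mul, mul_sub, mul_assoc, hFk, ← mul_assoc, hEb, mul_assoc, mul_assoc, hEm,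
      ← mul_assoc F, hFb, mul_assoc]
  -- Series whose degree `n` coefficient lowers `L(0)`-weights by `n` are closed under products; `D`
  -- is built from such series.
  have hwt : ∀ (G H : PowerSeries R), (∀ n, L 0 * coeff n G - coeff n G * L 0 =
      (-(n : ℂ)) • coeff n G) → (∀ n, L 0 * coeff n H - coeff n H * L 0 =
      (-(n : ℂ)) • coeff n H) → ∀ n, L 0 * coeff n (G * H) - coeff n (G * H) * L 0 =
      (-(n : ℂ)) • coeff n (G * H) := by
    intro G H hG hH n
    rw [coeff_mul, Finset.mul_sum, Finset.sum_mul, ← Finset.sum_sub_distrib, Finset.smul_sum]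
    refine Finset.sum_congr rfl fun p hp => ?_
    have e1 := hG p.1
    have e2 := hH p.2
    calc _ = (L 0 * coeff p.1 G - coeff p.1 G * L 0) * coeff p.2 H +
          coeff p.1 G * (L 0 * coeff p.2 H - coeff p.2 H * L 0) := by noncomm_ring
      _ = _ := by
        rw [e1, e2, ← Finset.HasAntidiagonal.mem_antidiagonal.mp hp, smul_mul_assoc, mul_smul_comm, ← add_smul]
        congr 1
        push_cast
        ring
  have hwtf : ∀ q n, L 0 * coeff n (fieldSeries L q) - coeff n (fieldSeries L q) * L 0 =
      (-(n : ℂ)) • coeff n (fieldSeries L q) := by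
    intro q n
    rw [fieldSeries, coeff_mk, mul_smul_comm, smul_mul_assoc, ← smul_sub, hL, zero_add,
      Nat.cast_zero, zero_sub, smul_comm]
  have hwtp : ∀ q m n, L 0 * coeff n (fieldSeries L q ^ m) - coeff n (fieldSeries L q ^ m) * L 0 =
      (-(n : ℂ)) • coeff n (fieldSeries L q ^ m) := by
    intro q m
    induction m with
    | zero =>
      intro n
      rw [pow_zero, coeff_one]
      split_ifs with h <;> simp [h]
    | succ m ih =>
      rw [pow_succ]
      exact hwt _ _ ih (hwtf q)
  have hwte : ∀ q n, L 0 * coeff n (expSeries (fieldSeries L q)) -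
      coeff n (expSeries (fieldSeries L q)) * L 0 =
      (-(n : ℂ)) • coeff n (expSeries (fieldSeries L q)) := by
    intro q n
    rw [expSeries, adicSum, coeff_mk, Finset.mul_sum, Finset.sum_mul, ← Finset.sum_sub_distrib,
      Finset.smul_sum]
    refine Finset.sum_congr rfl fun m _ => ?_
    rw [coeff_smul_complex, mul_smul_comm, smul_mul_assoc, ← smul_sub, hwtp, smul_comm]
  have hwts : ∀ (c : ℂ) (G : PowerSeries R), (∀ n, L 0 * coeff n G - coeff n G * L 0 =
      (-(n : ℂ)) • coeff n G) → ∀ n, L 0 * coeff n (scaleSeries c G) -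
      coeff n (scaleSeries c G) * L 0 = (-(n : ℂ)) • coeff n (scaleSeries c G) := by
    intro c G hG n
    rw [scaleSeries, coeff_mk, mul_smul_comm, smul_mul_assoc, ← smul_sub, hG, smul_comm]
  have hwtD : ∀ n, L 0 * coeff n D - coeff n D * L 0 = (-(n : ℂ)) • coeff n D := by
    intro n
    have e1 := hwt _ _ (hwte (X ^ 2 * mk (deltaSeq k))) (hwts k _ (hwte (X ^ 2 * mk invSeq))) n
    have e2 := hwt _ _ (hwte (X ^ 2 * mk invSeq)) (hwts (-1) _ (hwte (X ^ 2 * mk (deltaSeq k)))) n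
    rw [← hE, ← hF] at e1 e2
    rw [hD, map_sub, smul_sub, ← e1, ← e2]
    noncomm_ring
  have hlog : ∀ κ, coeff 0 (fieldSeries L (logField κ)) = L 0 := by
    intro κ
    simp [fieldSeries, logField]
  -- In degree zero both products are `1`. If the lower coefficients vanish, degree `n + 1` of `hDb`
  -- says that `L 0` commutes with that coefficient, while the weight relation makes the commutator
  -- `-(n + 1)` times it.
  have hz : ∀ n, coeff n D = 0 := by
    intro n
    induction n using Nat.strong_induction_on with
    | _ n ih =>
      cases n with
      | zero => simp [hD, hE, hF, expSeries, adicSum, scaleSeries]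
      | succ n =>
        have h1 := congrArg (coeff (n + 1)) hDb
        rw [coeff_mul, coeff_mul, Finset.sum_eq_single (n + 1, 0), Finset.sum_eq_single (0, n + 1),
          hlog, hlog] at h1
        · have h2 := hwtD (n + 1)
          rw [h1, sub_self] at h2
          refine (smul_eq_zero.mp h2.symm).resolve_left ?_
          exact neg_ne_zero.mpr (Nat.cast_ne_zero.mpr (by omega))
        · rintro ⟨i, j⟩ hij hne
          rw [Finset.HasAntidiagonal.mem_antidiagonal] at hij
          have : i ≠ 0 := by
            rintro rfl
            exact hne (by simp_all)
          simp only at hij ⊢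
          rw [ih j (by omega), mul_zero]
        · simp
        · rintro ⟨i, j⟩ hij hne
          rw [Finset.HasAntidiagonal.mem_antidiagonal] at hij
          have : j ≠ 0 := by
            rintro rfl
            exact hne (by simp_all)
          simp only at hij ⊢
          rw [ih i (by omega), zero_mul]
        · simp
  have h1 := hz s
  rw [hD, map_sub, sub_eq_zero, coeff_mul, coeff_mul] at h1
  simpa only [scaleSeries, coeff_mk, hFc] using h1

end Witt

/-! ### Sums over pairs and triples of natural numbers -/

section Sums

open Finset.HasAntidiagonal

variable {M : Type*} [AddCommGroup M]

theorem sum_antidiagonal_assoc (f : ℕ → ℕ → ℕ → M) (s : ℕ) :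
    ∑ p ∈ antidiagonal s, ∑ q ∈ antidiagonal p.1, f q.1 q.2 p.2 =
      ∑ p ∈ antidiagonal s, ∑ q ∈ antidiagonal p.2, f p.1 q.1 q.2 := by
  rw [Finset.sum_sigma', Finset.sum_sigma']
  refine Finset.sum_nbij' (fun x => ⟨(x.2.1, x.2.2 + x.1.2), (x.2.2, x.1.2)⟩)
    (fun x => ⟨(x.1.1 + x.2.1, x.2.2), (x.1.1, x.2.1)⟩) ?_ ?_ ?_ ?_ ?_
  · rintro ⟨⟨a, b⟩, ⟨c, d⟩⟩ h
    simp only [Finset.mem_sigma, mem_antidiagonal] at h ⊢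
    exact ⟨by omega, trivial⟩
  · rintro ⟨⟨a, b⟩, ⟨c, d⟩⟩ h
    simp only [Finset.mem_sigma, mem_antidiagonal] at h ⊢
    exact ⟨by omega, trivial⟩
  · rintro ⟨⟨a, b⟩, ⟨c, d⟩⟩ h
    simp only [Finset.mem_sigma, mem_antidiagonal] at h ⊢
    obtain ⟨h1, rfl⟩ := h
    rfl
  · rintro ⟨⟨a, b⟩, ⟨c, d⟩⟩ h
    simp only [Finset.mem_sigma, mem_antidiagonal] at h ⊢
    obtain ⟨h1, rfl⟩ := h
    rfl
  · rintro ⟨⟨a, b⟩, ⟨c, d⟩⟩ _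
    rfl

theorem sum_range_sum_range_eq (F : ℕ → ℕ → M) (N : ℕ) (h : ∀ i j, N ≤ i + j → F i j = 0) :
    ∑ i ∈ Finset.range N, ∑ j ∈ Finset.range N, F i j =
      ∑ s ∈ Finset.range N, ∑ p ∈ antidiagonal s, F p.1 p.2 := by
  rw [← Finset.sum_product', Finset.sum_sigma']
  symm
  refine Finset.sum_of_injOn (fun x => x.2) ?_ ?_ ?_ ?_
  · rintro ⟨a, x⟩ hx ⟨b, y⟩ hy hxy
    simp only [Finset.coe_sigma, Set.mem_sigma_iff, Finset.mem_coe, mem_antidiagonal]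
      at hx hy hxy
    subst hxy
    have : a = b := by omega
    subst this
    rfl
  · rintro ⟨a, x⟩ hx
    simp only [Finset.coe_sigma, Set.mem_sigma_iff, Finset.mem_coe, mem_antidiagonal,
      Finset.mem_range, Finset.coe_product, Set.mem_prod] at hx ⊢
    omega
  · rintro ⟨i, j⟩ _ hx
    refine h i j ?_
    by_contra hlt
    exact hx ⟨⟨i + j, (i, j)⟩, by simp; omega, rfl⟩
  · rintro ⟨a, x⟩ _
    rfl

theorem sum_range_sum_range_sum_range_eq (F : ℕ → ℕ → ℕ → M) (N : ℕ)
    (h : ∀ i j l, N ≤ i + j + l → F i j l = 0) :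
    ∑ i ∈ Finset.range N, ∑ j ∈ Finset.range N, ∑ l ∈ Finset.range N, F i j l =
      ∑ s ∈ Finset.range N, ∑ p ∈ antidiagonal s, ∑ q ∈ antidiagonal p.1, F q.1 q.2 p.2 := by
  have h1 : ∀ l ∈ Finset.range N, ∑ i ∈ Finset.range N, ∑ j ∈ Finset.range N, F i j l =
      ∑ s ∈ Finset.range N, ∑ p ∈ antidiagonal s, F p.1 p.2 l := fun l _ =>
    sum_range_sum_range_eq (fun i j => F i j l) N fun i j hij => h i j l (by omega)
  calc _ = ∑ i ∈ Finset.range N, ∑ l ∈ Finset.range N, ∑ j ∈ Finset.range N, F i j l :=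
        Finset.sum_congr rfl fun i _ => Finset.sum_comm
    _ = ∑ l ∈ Finset.range N, ∑ i ∈ Finset.range N, ∑ j ∈ Finset.range N, F i j l :=
        Finset.sum_comm
    _ = ∑ l ∈ Finset.range N, ∑ s ∈ Finset.range N, ∑ p ∈ antidiagonal s, F p.1 p.2 l :=
        Finset.sum_congr rfl h1
    _ = ∑ s ∈ Finset.range N, ∑ l ∈ Finset.range N, ∑ p ∈ antidiagonal s, F p.1 p.2 l :=
        Finset.sum_comm
    _ = _ := sum_range_sum_range_eq (fun s l => ∑ p ∈ antidiagonal s, F p.1 p.2 l) N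
        fun s l hsl => Finset.sum_eq_zero fun p hp => h _ _ _ (by
          rw [mem_antidiagonal.mp hp]; exact hsl)

theorem finsum_eq_sum_range {f : ℕ → M} {N : ℕ} (h : ∀ j, N ≤ j → f j = 0) :
    ∑ᶠ j, f j = ∑ j ∈ Finset.range N, f j := by
  refine finsum_eq_sum_of_support_subset f fun j hj => ?_
  rw [Finset.coe_range, Set.mem_Iio]
  by_contra hc
  exact hj (h j (not_lt.mp hc))

theorem sum_range_eq_of_le {f : ℕ → M} {N N' : ℕ} (h : ∀ j, N ≤ j → f j = 0) (hN : N ≤ N') :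
    ∑ j ∈ Finset.range N', f j = ∑ j ∈ Finset.range N, f j := by
  rw [← finsum_eq_sum_range h, ← finsum_eq_sum_range fun j hj => h j (hN.trans hj)]

end Sums

/-! ### Binomial coefficients -/

section Binom

open Finset.HasAntidiagonal

theorem binom_zero_right (a : ℂ) : binom a 0 = 1 := by simp [binom]

theorem binom_one_right (a : ℂ) : binom a 1 = a := by simp [binom]

theorem succ_mul_binom_succ (a : ℂ) (i : ℕ) :
    ((i : ℂ) + 1) * binom a (i + 1) = (a - i) * binom a i := by
  have h1 : ((i : ℂ) + 1) ≠ 0 := by exact_mod_cast Nat.succ_ne_zero i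
  have h2 : (i.factorial : ℂ) ≠ 0 := Nat.cast_ne_zero.mpr i.factorial_ne_zero
  rw [binom, binom, Finset.prod_range_succ, Nat.factorial_succ]
  push_cast
  field_simp

theorem binom_eq_choose (a : ℂ) (i : ℕ) : binom a i = Ring.choose a i := by
  have h : (descPochhammer ℤ i).smeval a = ∏ j ∈ Finset.range i, (a - j) := by
    induction i with
    | zero => simp
    | succ i ih =>
      rw [descPochhammer_succ_right, Polynomial.smeval_mul, ih, Finset.prod_range_succ,
        Polynomial.smeval_sub, Polynomial.smeval_X, Polynomial.smeval_natCast]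
      simp
  rw [Ring.choose_eq_smul, binom, smul_eq_mul, div_eq_inv_mul, h]

theorem binom_add_one (a : ℂ) (i : ℕ) : binom (a + 1) (i + 1) = binom a (i + 1) + binom a i := by
  simp only [binom_eq_choose, Ring.choose_succ_succ, add_comm]

theorem binom_add (a b : ℂ) (q : ℕ) :
    binom (a + b) q = ∑ p ∈ antidiagonal q, binom a p.1 * binom b p.2 := by
  simp only [binom_eq_choose]
  exact Ring.add_choose_eq q (Commute.all a b)

theorem binom_reflect (a : ℂ) (n : ℕ) : binom (n - 1 - a) n = (-1) ^ n * binom a n := by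
  rw [binom, binom, ← mul_div_assoc]
  congr 1
  rw [← Finset.prod_range_reflect, ← Finset.card_range n, ← Finset.prod_const, Finset.card_range,
    ← Finset.prod_mul_distrib]
  refine Finset.prod_congr rfl fun j hj => ?_
  have := Finset.mem_range.mp hj
  rw [Nat.cast_sub (by omega), Nat.cast_sub (by omega)]
  push_cast
  ring

/-- Chu–Vandermonde after reflecting the upper argument, `binom (n - 1 - a) n = (-1)^n binom a n`,
in the second factor and in the result. -/
theorem sum_neg_one_pow_mul_binom (a b : ℂ) (q : ℕ) :
    ∑ p ∈ antidiagonal q, (-1 : ℂ) ^ p.1 * binom b p.1 * binom (a - p.1) p.2 =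
      binom (a - b) q := by
  have h1 : binom (a - b) q = (-1) ^ q * binom (b + (q - 1 - a)) q := by
    rw [← binom_reflect]
    congr 1
    ring
  rw [h1, binom_add, Finset.mul_sum]
  refine Finset.sum_congr rfl fun p hp => ?_
  have hq := mem_antidiagonal.mp hp
  have h2 : binom ((q : ℂ) - 1 - a) p.2 = (-1) ^ p.2 * binom (a - p.1) p.2 := by
    rw [← binom_reflect]
    congr 1
    rw [← hq]
    push_cast
    ring
  rw [h2, ← hq, pow_add]
  have h3 : ((-1 : ℂ) ^ p.2) * (-1) ^ p.2 = 1 := by rw [← mul_pow]; simp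
  linear_combination (-(-1 : ℂ) ^ p.1 * binom b p.1 * binom (a - p.1) p.2) * h3

end Binom

/-! ### Graded vector spaces -/

section Graded

variable {ι M N : Type*} [AddCommGroup M] [Module ℂ M] [AddCommGroup N] [Module ℂ N]

/-- Maps defined only on homogeneous vectors extend linearly. This provides the projections onto
graded pieces and the adjoint fields, whose formula depends on the weight. -/
theorem exists_linearMap_of_iSup_eq_top {S : ι → Submodule ℂ M} (hS : iSupIndep S)
    (htop : ⨆ i, S i = ⊤) (φ : ∀ i, S i →ₗ[ℂ] N) :
    ∃ Φ : M →ₗ[ℂ] N, ∀ i (x : S i), Φ x = φ i x := by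
  classical
  have h := (DirectSum.isInternal_submodule_iff_iSupIndep_and_iSup_eq_top S).mpr ⟨hS, htop⟩
  let e := LinearEquiv.ofBijective (DirectSum.coeLinearMap S) h
  refine ⟨DirectSum.toModule ℂ ι N φ ∘ₗ e.symm.toLinearMap, fun i x => ?_⟩
  have : e.symm (x : M) = DirectSum.lof ℂ ι (fun i => S i) i x := by
    rw [LinearEquiv.symm_apply_eq]
    exact (DirectSum.coeLinearMap_lof S i x).symm
  rw [LinearMap.comp_apply, LinearEquiv.coe_coe, this, DirectSum.toModule_lof]

theorem linearMap_ext_of_iSup_eq_top {S : ι → Submodule ℂ M} (htop : ⨆ i, S i = ⊤)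
    {f g : M →ₗ[ℂ] N} (h : ∀ i, ∀ x ∈ S i, f x = g x) : f = g := by
  have : ⨆ i, S i ≤ LinearMap.eqLocus f g := iSup_le fun i x hx => h i x hx
  rw [htop] at this
  exact LinearMap.ext fun x => this trivial

/-- The components of an eigenvector of `g` are eigenvectors if `g` preserves the grading. -/
theorem mem_iSup_inf_ker {S : ι → Submodule ℂ M} (hS : iSupIndep S)
    (htop : ⨆ i, S i = ⊤) {g : M →ₗ[ℂ] M} (hg : ∀ i, ∀ x ∈ S i, g x ∈ S i) {x : M}
    (hx : g x = 0) : x ∈ ⨆ i, S i ⊓ LinearMap.ker g := by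
  classical
  have hx' : x ∈ ⨆ i, S i := htop ▸ trivial
  obtain ⟨y, rfl⟩ := (Submodule.mem_iSup_iff_exists_dfinsupp' _ _).mp hx'
  have h0 : ∀ i, g (y i) = 0 := by
    intro j
    have hex := exists_linearMap_of_iSup_eq_top hS htop
      (fun i => if i = j then (S i).subtype else 0)
    obtain ⟨π, hπ⟩ := hex
    have h1 : π (g (y.sum fun i xi => (xi : M))) = g (y j) := by
      rw [DFinsupp.sum, map_sum, map_sum, Finset.sum_eq_single j]
      · have := hπ j ⟨g (y j), hg j _ (y j).2⟩
        simpa using this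
      · intro i _ hij
        have := hπ i ⟨g (y i), hg i _ (y i).2⟩
        simpa [hij] using this
      · intro hj
        rw [DFinsupp.notMem_support_iff.mp hj]
        simp
    rw [← h1, hx, map_zero]
  rw [DFinsupp.sum]
  exact Submodule.sum_mem _ fun i _ => Submodule.mem_iSup_of_mem i ⟨(y i).2, h0 i⟩

end Graded

/-! ### Vertex data with a good action of `L(-1)`, `L(0)` and `L(1)` -/

namespace VertexData

open Finset.HasAntidiagonal

variable {V : Type*} [AddCommGroup V] [Module ℂ V]

/-- The properties of vertex operator algebras that do not involve the product of two vertex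
operators, for a grading by the integers. -/
structure IsConformal (A : VertexData V) : Prop where
  truncation : ∀ u v : V, ∃ N : ℤ, ∀ p : ℤ, N ≤ p → A.Y u p v = 0
  creation : ∀ v : V, A.Y v (-1) A.vac = v ∧ ∀ n : ℤ, 0 ≤ n → A.Y v n A.vac = 0
  creation_two : ∀ v : V, A.Y v (-2) A.vac = A.L (-1) v
  bracket_zero : ∀ (h : ℤ) (v : V), v ∈ A.wt h → ∀ (p : ℤ) (x : V),
    A.L 0 (A.Y v p x) = ((h : ℂ) - p - 1) • A.Y v p x + A.Y v p (A.L 0 x)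
  bracket_one : ∀ (h : ℤ) (v : V), v ∈ A.wt h → ∀ (p : ℤ) (x : V),
    A.L 1 (A.Y v p x) =
      A.Y (A.L 1 v) p x + A.Y v p (A.L 1 x) + (2 * (h : ℂ) - p - 2) • A.Y v (p + 1) x
  L_zero_L_one : ∀ v : V, A.L 0 (A.L 1 v) = A.L 1 (A.L 0 v) - A.L 1 v
  conf_mem : A.conf ∈ A.wt 2
  L_one_conf : A.L 1 A.conf = 0
  graded : ⨆ n : ℤ, A.wt n = ⊤
  lower_bound : ∃ N : ℤ, ∀ n : ℤ, n < N → A.wt n = ⊥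

theorem mem_wt_iff {A : VertexData V} {n : ℤ} {v : V} : v ∈ A.wt n ↔ A.L 0 v = (n : ℂ) • v :=
  Module.End.mem_eigenspace_iff

theorem wt_iSupIndep (A : VertexData V) : iSupIndep A.wt :=
  (Module.End.eigenspaces_iSupIndep (A.L 0)).comp Int.cast_injective

/-- `L(1)^j / j!`. -/
noncomputable def dividedL (A : VertexData V) (j : ℕ) : Module.End ℂ V :=
  (j.factorial : ℂ)⁻¹ • A.L 1 ^ j

theorem succ_mul_inv_factorial (n : ℕ) :
    ((n : ℂ) + 1) * (((n + 1).factorial : ℂ)⁻¹) = (n.factorial : ℂ)⁻¹ := by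
  have h1 : ((n : ℂ) + 1) ≠ 0 := by exact_mod_cast Nat.succ_ne_zero n
  rw [Nat.factorial_succ, Nat.cast_mul, mul_inv, ← mul_assoc, Nat.cast_add, Nat.cast_one,
    mul_inv_cancel₀ h1, one_mul]

theorem L_one_dividedL (A : VertexData V) (j : ℕ) (v : V) :
    A.L 1 (A.dividedL j v) = ((j : ℂ) + 1) • A.dividedL (j + 1) v := by
  rw [dividedL, dividedL, ← LinearMap.smul_apply, smul_smul, succ_mul_inv_factorial, pow_succ',
    LinearMap.smul_apply, map_smul]
  rfl

theorem dividedL_zero (A : VertexData V) (v : V) : A.dividedL 0 v = v := by simp [dividedL]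

namespace IsConformal

variable {A : VertexData V} (hA : A.IsConformal)
include hA

theorem L_one_mem {h : ℤ} {v : V} (hv : v ∈ A.wt h) : A.L 1 v ∈ A.wt (h - 1) := by
  rw [mem_wt_iff] at hv ⊢
  rw [hA.L_zero_L_one, hv, map_smul]
  push_cast
  module

theorem L_one_pow_mem {h : ℤ} {v : V} (hv : v ∈ A.wt h) (j : ℕ) :
    (A.L 1 ^ j) v ∈ A.wt (h - j) := by
  induction j with
  | zero => simpa
  | succ j ih =>
    rw [pow_succ', Module.End.mul_apply]
    convert hA.L_one_mem ih using 2
    push_cast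
    ring

theorem dividedL_mem {h : ℤ} {v : V} (hv : v ∈ A.wt h) (j : ℕ) :
    A.dividedL j v ∈ A.wt (h - j) :=
  Submodule.smul_mem _ _ (hA.L_one_pow_mem hv j)

theorem mode_mem {h h' : ℤ} {u v : V} (hu : u ∈ A.wt h) (hv : v ∈ A.wt h') (p : ℤ) :
    A.Y u p v ∈ A.wt (h + h' - p - 1) := by
  rw [mem_wt_iff, hA.bracket_zero h u hu, mem_wt_iff.mp hv, map_smul]
  push_cast
  module

theorem exists_wt_eq_bot (h : ℤ) : ∃ N : ℕ, ∀ j : ℕ, N ≤ j → A.wt (h - j) = ⊥ := by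
  obtain ⟨B, hB⟩ := hA.lower_bound
  exact ⟨(h - B + 1).toNat, fun j hj => hB _ (by omega)⟩

/-- The part of degree `s` of `exp(t L(1)) Y(v, z) exp(-t L(1))`, where `v` has weight `h`. -/
theorem dividedL_mode {h : ℤ} {v : V} (hv : v ∈ A.wt h) (p : ℤ) (s : ℕ) (x : V) :
    A.dividedL s (A.Y v p x) = ∑ q ∈ antidiagonal s, ∑ r ∈ antidiagonal q.1,
      binom (2 * h - p - 2 - r.2) r.1 • A.Y (A.dividedL r.2 v) (p + r.1) (A.dividedL q.2 x) := by
  set Z : ℕ → ℕ → Module.End ℂ V := fun i j => A.Y (A.dividedL j v) (p + i) with hZ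
  set c : ℕ → Module.End ℂ V := fun s => ∑ r ∈ antidiagonal s,
    binom (2 * h - p - 2 - r.2) r.1 • Z r.1 r.2 with hc
  have hZ1 : ∀ i j, A.L 1 * Z i j - Z i j * A.L 1 = ((j : ℂ) + 1) • Z i (j + 1) +
      ((2 * h - p - 2 - j) - j - i : ℂ) • Z (i + 1) j := by
    intro i j
    ext1 y
    have := hA.bracket_one _ _ (hA.dividedL_mem hv j) (p + i) y
    simp only [hZ, LinearMap.sub_apply, Module.End.mul_apply, LinearMap.add_apply,
      LinearMap.smul_apply]
    rw [this, A.L_one_dividedL, map_smul, Pi.smul_apply, LinearMap.smul_apply]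
    push_cast
    rw [add_assoc p]
    module
  -- Thus `c s` is `(ad L(1))^s / s!` applied to the mode `v_p`, the form that
  -- `dividedPow_mul_eq_sum` requires.
  have hshift : ∀ s, A.L 1 * c s - c s * A.L 1 = ((s : ℂ) + 1) • c (s + 1) := by
    intro s
    set a : ℕ → ℂ := fun j => 2 * h - p - 2 - j with ha
    have ha1 : ∀ j, a (j + 1) + 1 = a j := by intro j; simp only [ha]; push_cast; ring
    have e1 : ∑ r ∈ antidiagonal (s + 1), ((r.2 : ℂ) * binom (a r.2 + 1) r.1) • Z r.1 r.2 =
        ∑ r ∈ antidiagonal s, (((r.2 : ℂ) + 1) * binom (a r.2) r.1) • Z r.1 (r.2 + 1) := by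
      rw [Finset.Nat.sum_antidiagonal_succ']
      simp [ha1]
    -- The total factor `s + 1 = r.1 + r.2` is distributed by Pascal's rule: `e1` collects the terms
    -- of `hZ1` that raise the power of `L(1)` on `v`, and `e2` those that raise the mode index.
    have e2 : ∑ r ∈ antidiagonal (s + 1), ((r.1 : ℂ) * binom (a r.2) r.1 -
          r.2 * (binom (a r.2 + 1) r.1 - binom (a r.2) r.1)) • Z r.1 r.2 =
        ∑ r ∈ antidiagonal s, ((2 * h - p - 2 - r.2 - r.2 - r.1) * binom (a r.2) r.1) •
          Z (r.1 + 1) r.2 := by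
      rw [Finset.Nat.sum_antidiagonal_succ]
      simp only [binom_zero_right, Nat.cast_zero, zero_mul, sub_self, mul_zero, zero_smul, zero_add]
      refine Finset.sum_congr rfl fun r _ => ?_
      rw [binom_add_one]
      push_cast
      rw [succ_mul_binom_succ]
      congr 1
      simp only [ha]
      ring
    calc A.L 1 * c s - c s * A.L 1
        = ∑ r ∈ antidiagonal s, binom (a r.2) r.1 • (A.L 1 * Z r.1 r.2 - Z r.1 r.2 * A.L 1) := by
          simp only [hc, Finset.mul_sum, Finset.sum_mul, ← Finset.sum_sub_distrib, mul_smul_comm,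
            smul_mul_assoc, smul_sub, ha]
      _ = _ := by
          simp only [hZ1]
          simp only [smul_add, smul_smul, Finset.sum_add_distrib]
          rw [Finset.sum_congr rfl fun r (_ : r ∈ antidiagonal s) => by rw [mul_comm],
            ← e1, add_comm, Finset.sum_congr rfl fun r (_ : r ∈ antidiagonal s) => by
              rw [mul_comm (binom (a r.2) r.1)], ← e2,
            ← Finset.sum_add_distrib, hc, Finset.smul_sum]
          refine Finset.sum_congr rfl fun r hr => ?_
          have : (s : ℂ) + 1 = r.1 + r.2 := by exact_mod_cast (mem_antidiagonal.mp hr).symm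
          rw [← add_smul, smul_smul, this]
          congr 1
          ring
  have key := dividedPow_mul_eq_sum (A.L 1) (fun i => (i.factorial : ℂ) • c i) (by
    intro i
    rw [mul_smul_comm, smul_mul_assoc, ← smul_sub, hshift, smul_smul, Nat.factorial_succ]
    push_cast
    rw [mul_comm]) s
  have hc0 : c 0 = A.Y v p := by
    simp [hc, hZ, binom_zero_right, dividedL_zero]
  have hf : ∀ i : ℕ, ((i.factorial : ℂ)⁻¹ • ((i.factorial : ℂ) • c i)) = c i := fun i =>
    inv_smul_smul₀ (Nat.cast_ne_zero.mpr i.factorial_ne_zero) _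
  simp only [hf, Nat.factorial_zero, Nat.cast_one, one_smul, hc0] at key
  have := LinearMap.congr_fun key x
  rw [LinearMap.sum_apply] at this
  rw [dividedL]
  refine this.trans (Finset.sum_congr rfl fun q _ => ?_)
  rw [Module.End.mul_apply, hc, LinearMap.sum_apply]
  rfl

/-- The identity behind the Jacobi identity for contragredient modules. -/
theorem sum_binom_dividedL_mode {h : ℤ} {u : V} (hu : u ∈ A.wt h) (v : V) (μ : ℂ) (l : ℤ)
    (s : ℕ) :
    ∑ p ∈ antidiagonal s, ((-1 : ℂ) ^ p.1 * binom μ p.1) • A.dividedL p.2 (A.Y u (l + p.1) v) =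
      ∑ p ∈ antidiagonal s, ∑ q ∈ antidiagonal p.1, binom (2 * h - l - 2 - q.2 - μ) q.1 •
        A.Y (A.dividedL q.2 u) (l + q.1) (A.dividedL p.2 v) := by
  calc _ = ∑ p ∈ antidiagonal s, ∑ q ∈ antidiagonal p.2, ∑ r ∈ antidiagonal q.1,
        ((-1 : ℂ) ^ p.1 * binom μ p.1 * binom (2 * h - l - 2 - r.2 - p.1) r.1) •
          A.Y (A.dividedL r.2 u) (l + (p.1 + r.1 : ℕ)) (A.dividedL q.2 v) := by
        refine Finset.sum_congr rfl fun p _ => ?_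
        rw [hA.dividedL_mode hu, Finset.smul_sum]
        refine Finset.sum_congr rfl fun q _ => ?_
        rw [Finset.smul_sum]
        refine Finset.sum_congr rfl fun r _ => ?_
        rw [smul_smul]
        push_cast
        rw [add_assoc]
        congr 3
        ring
    -- Two regroupings bring the two indices that raise the mode next to each other, so that
    -- Chu–Vandermonde sums them.
    _ = ∑ p ∈ antidiagonal s, ∑ q ∈ antidiagonal p.1, ∑ r ∈ antidiagonal q.2,
        ((-1 : ℂ) ^ q.1 * binom μ q.1 * binom (2 * h - l - 2 - r.2 - q.1) r.1) •
          A.Y (A.dividedL r.2 u) (l + (q.1 + r.1 : ℕ)) (A.dividedL p.2 v) :=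
        (sum_antidiagonal_assoc (fun i j j' => ∑ r ∈ antidiagonal j,
          ((-1 : ℂ) ^ i * binom μ i * binom (2 * h - l - 2 - r.2 - i) r.1) •
          A.Y (A.dividedL r.2 u) (l + (i + r.1 : ℕ)) (A.dividedL j' v)) s).symm
    _ = ∑ p ∈ antidiagonal s, ∑ q ∈ antidiagonal p.1, ∑ r ∈ antidiagonal q.1,
        ((-1 : ℂ) ^ r.1 * binom μ r.1 * binom (2 * h - l - 2 - q.2 - r.1) r.2) •
          A.Y (A.dividedL q.2 u) (l + (r.1 + r.2 : ℕ)) (A.dividedL p.2 v) :=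
        Finset.sum_congr rfl fun p _ => (sum_antidiagonal_assoc (fun i i' j =>
          ((-1 : ℂ) ^ i * binom μ i * binom (2 * h - l - 2 - j - i) i') •
          A.Y (A.dividedL j u) (l + (i + i' : ℕ)) (A.dividedL p.2 v)) p.1).symm
    _ = _ := by
        refine Finset.sum_congr rfl fun p _ => Finset.sum_congr rfl fun q _ => ?_
        rw [← sum_neg_one_pow_mul_binom, Finset.sum_smul]
        refine Finset.sum_congr rfl fun r hr => ?_
        rw [mem_antidiagonal.mp hr]

end IsConformal

end VertexData

namespace VOA

variable {V : Type*} [AddCommGroup V] [Module ℂ V] (A : VOA V)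

theorem exp_zero_smul (v : V) :
    (LinearMap.id : V →ₗ[ℂ] V) v =
      Complex.exp (2 * Real.pi * Complex.I * ((0 : ℤ) : ℂ) / ((1 : ℕ) : ℂ)) • v := by simp

/-- The commutator `[u_m, v_n]`. -/
theorem commutator {W : Type*} [AddCommGroup W] [Module ℂ W] {B : VertexData V}
    {Y : V →ₗ[ℂ] (ℤ → Module.End ℂ W)} (hY : IsWeakTwistedModule B LinearMap.id 1 Y)
    (u v : V) (m n : ℤ) (w : W) :
    ∑ᶠ i : ℕ, binom (m : ℂ) i • Y (B.Y u i v) (m + n - i) w =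
      Y u m (Y v n w) - Y v n (Y u m w) := by
  have h := hY.jacobi 0 u (exp_zero_smul u) v w 0 m n (Int.modEq_one)
  -- With `l = 0` the binomials `binom 0 i` leave only the term `i = 0` on the right, which is the
  -- commutator.
  have h2 := h.trans (finsum_eq_single _ 0 fun i hi => ?_)
  · simpa [binom_zero_right] using h2
  · obtain ⟨i, rfl⟩ := Nat.exists_eq_succ_of_ne_zero hi
    have : binom ((0 : ℤ) : ℂ) (i + 1) = 0 := by
      rw [binom, Finset.prod_eq_zero (Finset.mem_range.mpr (Nat.succ_pos i))] <;> simp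
    rw [this, mul_zero, zero_smul]

/-- The brackets are the commutators of `ω_1` and `ω_2` with a mode: the binomials stop after `L(1)
v`, and `L(-1) v` is removed by the derivative property. The statements on `ω` come from `ω = L(-2)
𝟏`. -/
theorem isConformal : A.toVertexData.IsConformal := by
  have hcr := A.creation
  have hL : ∀ n : ℤ, -1 ≤ n → A.L n A.vac = 0 := fun n hn => (hcr A.conf).2 _ (by omega)
  have hconf : A.L (-2) A.vac = A.conf := (hcr A.conf).1
  obtain ⟨c, hc⟩ := A.virasoro
  have hvir : ∀ m n : ℤ, ∀ v, A.L m (A.L n v) = A.L n (A.L m v) + ((m : ℂ) - n) • A.L (m + n) v +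
      (if m + n = 0 then ((m : ℂ) ^ 3 - m) / 12 * c else 0) • v := by
    intro m n v
    have := LinearMap.congr_fun (hc m n) v
    simp only [LinearMap.sub_apply, Module.End.mul_apply, LinearMap.add_apply,
      LinearMap.smul_apply, Module.End.one_apply] at this
    rw [sub_eq_iff_eq_add] at this
    rw [this]
    abel
  have hbinom : ∀ (m : ℕ) i, m < i → binom (m : ℂ) i = 0 := by
    intro m i hi
    rw [binom, Finset.prod_eq_zero (Finset.mem_range.mpr hi) (sub_self _), zero_div]
  refine ⟨A.adjoint.truncation, hcr, ?_, ?_, ?_, ?_, ?_, ?_, A.graded, A.lower_bound⟩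
  · intro v
    have h := A.derivative v (-1)
    have h2 := (hcr (A.L (-1) v)).1
    rw [h] at h2
    simpa using h2
  · intro h v hv p x
    have := commutator A.adjoint A.conf v 1 p x
    rw [finsum_eq_sum_range (N := 2)] at this
    · simp only [Finset.sum_range_succ, Finset.sum_range_zero, Int.cast_one, binom_zero_right,
        binom_one_right, one_smul, zero_add, Nat.cast_zero, Nat.cast_one, sub_zero] at this
      have e0 : A.Y A.conf 0 v = A.L (-1) v := rfl
      have e1 : A.Y A.conf 1 v = A.L 0 v := rfl
      have e2 : A.Y A.conf 1 = A.L 0 := rfl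
      rw [e0, e1, e2, A.derivative, VertexData.mem_wt_iff.mp hv, map_smul, Pi.smul_apply,
        LinearMap.smul_apply, LinearMap.smul_apply, add_sub_cancel_left] at this
      rw [← sub_eq_iff_eq_add, ← this]
      push_cast
      module
    · intro j hj
      have := hbinom 1 j (by omega)
      rw [Nat.cast_one] at this
      rw [Int.cast_one, this, zero_smul]
  · intro h v hv p x
    have := commutator A.adjoint A.conf v 2 p x
    rw [finsum_eq_sum_range (N := 3)] at this
    · have b2 : binom 2 2 = 1 := by norm_num [binom, Finset.prod_range_succ]
      simp only [Finset.sum_range_succ, Finset.sum_range_zero, Int.cast_ofNat, binom_zero_right,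
        binom_one_right, one_smul, zero_add, Nat.cast_zero, Nat.cast_one, sub_zero, b2,
        Nat.cast_ofNat] at this
      have e0 : A.Y A.conf 0 v = A.L (-1) v := rfl
      have e1 : A.Y A.conf 1 v = A.L 0 v := rfl
      have e2 : A.Y A.conf 2 v = A.L 1 v := rfl
      have e3 : A.Y A.conf 2 = A.L 1 := rfl
      rw [e0, e1, e2, e3, A.derivative, VertexData.mem_wt_iff.mp hv, map_smul, Pi.smul_apply,
        LinearMap.smul_apply, LinearMap.smul_apply, add_sub_cancel_left,
        show 2 + p - 1 = p + 1 by ring] at this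
      rw [eq_sub_iff_add_eq] at this
      rw [← this]
      push_cast
      module
    · intro j hj
      have := hbinom 2 j (by omega)
      rw [Nat.cast_ofNat] at this
      rw [Int.cast_ofNat, this, zero_smul]
  · intro v
    rw [hvir 0 1]
    simp [sub_eq_add_neg]
  · rw [VertexData.mem_wt_iff, ← hconf, hvir 0 (-2), hL 0 (by omega)]
    simp
  · rw [← hconf, hvir 1 (-2), hL 1 (by omega)]
    simp only [map_zero, zero_add]
    rw [show (1 : ℤ) + -2 = -1 by norm_num, hL (-1) (by omega)]
    simp

end VOA

/-! ### Weak twisted modules -/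

section Twisted

variable {V M : Type*} [AddCommGroup V] [Module ℂ V] [AddCommGroup M] [Module ℂ M]

/-- If `g ^ T = 1`, then the eigenvectors of `g` span. -/
theorem iSup_eigenspace_eq_top_of_pow_eq_one {g : Module.End ℂ V} {T : ℕ} (hT : 0 < T)
    (hg : g ^ T = 1) :
    ⨆ r : ℤ, Module.End.eigenspace g (Complex.exp (2 * Real.pi * Complex.I * r / T)) = ⊤ := by
  rw [eq_top_iff]
  intro x _
  set ζ : ℂ := Complex.exp (2 * Real.pi * Complex.I / T) with hζ
  have hprim : IsPrimitiveRoot ζ T := Complex.isPrimitiveRoot_exp T hT.ne'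
  have hζ0 : ζ ≠ 0 := Complex.exp_ne_zero _
  -- Discrete Fourier transform along the orbit of `x`: the sum of `F r s` over `s` is `T` times the
  -- component of `x` for the eigenvalue `ζ^r`.
  set F : ℕ → ℕ → V := fun r s => ζ⁻¹ ^ (r * s) • (g ^ s) x with hF
  have hmem : ∀ r : ℕ, (∑ s ∈ Finset.range T, F r s) ∈ Module.End.eigenspace g
      (Complex.exp (2 * Real.pi * Complex.I * (r : ℤ) / T)) := by
    intro r
    have hexp : Complex.exp (2 * Real.pi * Complex.I * (r : ℤ) / T) = ζ ^ r := by
      rw [hζ, ← Complex.exp_nat_mul]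
      congr 1
      push_cast
      ring
    rw [Module.End.mem_eigenspace_iff, hexp, map_sum]
    have h1 : ∀ s, g (F r s) = ζ ^ r • F r (s + 1) := by
      intro s
      simp only [hF]
      rw [map_smul, smul_smul, pow_succ', Module.End.mul_apply]
      congr 1
      rw [mul_add, mul_one, pow_add, mul_left_comm, ← mul_pow, mul_inv_cancel₀ hζ0, one_pow,
        mul_one]
    rw [Finset.sum_congr rfl fun s _ => h1 s, ← Finset.smul_sum]
    congr 1
    have h2 := Finset.sum_range_succ (F r) T
    rw [Finset.sum_range_succ'] at h2
    have h3 : F r T = F r 0 := by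
      simp only [hF]
      rw [hg, pow_zero, mul_zero, pow_zero, mul_comm, pow_mul, inv_pow, hprim.pow_eq_one, inv_one,
        one_pow]
    rw [h3] at h2
    exact add_right_cancel h2
  have hsum : ∑ r ∈ Finset.range T, ∑ s ∈ Finset.range T, F r s = (T : ℂ) • x := by
    rw [Finset.sum_comm, Finset.sum_eq_single_of_mem 0 (Finset.mem_range.mpr hT)]
    · simp [hF, Nat.cast_smul_eq_nsmul]
    · intro s hs hs0
      simp only [hF]
      rw [← Finset.sum_smul]
      have h1 : ∀ r, ζ⁻¹ ^ (r * s) = ((ζ ^ s)⁻¹) ^ r := by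
        intro r
        rw [mul_comm, pow_mul, inv_pow]
      have hne : (ζ ^ s)⁻¹ ≠ 1 := by
        rw [ne_eq, inv_eq_one]
        exact hprim.pow_ne_one_of_pos_of_lt hs0 (Finset.mem_range.mp hs)
      rw [Finset.sum_congr rfl fun r _ => h1 r, geom_sum_eq hne, inv_pow, ← pow_mul, mul_comm,
        pow_mul, hprim.pow_eq_one]
      simp
  have hx : x = (T : ℂ)⁻¹ • ∑ r ∈ Finset.range T, ∑ s ∈ Finset.range T, F r s := by
    rw [hsum, inv_smul_smul₀ (Nat.cast_ne_zero.mpr hT.ne')]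
  rw [hx]
  exact Submodule.smul_mem _ _ (Submodule.sum_mem _ fun r _ =>
    Submodule.mem_iSup_of_mem (r : ℤ) (hmem r))

/-- An automorphism of finite order, as far as `L(0)` and `L(1)` are concerned. -/
structure IsConformalAut (A : VertexData V) (g : V →ₗ[ℂ] V) (T : ℕ) : Prop where
  pos : 0 < T
  pow_eq_one : (g : Module.End ℂ V) ^ T = 1
  conf : g A.conf = A.conf
  L_zero : ∀ v, g (A.L 0 v) = A.L 0 (g v)
  L_one : ∀ v, g (A.L 1 v) = A.L 1 (g v)

theorem IsConformalAut.dividedL {A : VertexData V} {g : V →ₗ[ℂ] V} {T : ℕ}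
    (hg : IsConformalAut A g T) (j : ℕ) (v : V) : g (A.dividedL j v) = A.dividedL j (g v) := by
  simp only [VertexData.dividedL, LinearMap.smul_apply, map_smul]
  congr 1
  induction j with
  | zero => simp
  | succ j ih => rw [pow_succ', Module.End.mul_apply, Module.End.mul_apply, hg.L_one, ih]

namespace IsWeakTwistedModule

variable {A : VertexData V} {g : V →ₗ[ℂ] V} {T : ℕ} {Y : V →ₗ[ℂ] (ℤ → Module.End ℂ M)}

/-- The Jacobi identity, with finite sums. -/
theorem exists_jacobi_sum (hY : IsWeakTwistedModule A g T Y) (hA : A.IsConformal) (hT : 0 < T)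
    {r : ℤ} {u : V} (hu : g u = Complex.exp (2 * Real.pi * Complex.I * r / T) • u) (v : V) (w : M)
    (l m n : ℤ) (hm : m ≡ r [ZMOD T]) : ∃ N₀ : ℕ, ∀ N : ℕ, N₀ ≤ N →
      ∑ i ∈ Finset.range N, binom ((m : ℂ) / T) i • Y (A.Y u (l + i) v) (m + n - T * i) w =
      ∑ i ∈ Finset.range N, ((-1 : ℂ) ^ i * binom l i) •
        (Y u (m + T * l - T * i) (Y v (n + T * i) w) -
          (-1 : ℂ) ^ l • Y v (n + T * l - T * i) (Y u (m + T * i) w)) := by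
  obtain ⟨N₁, h₁⟩ := hA.truncation u v
  obtain ⟨N₂, h₂⟩ := hY.truncation u w
  obtain ⟨N₃, h₃⟩ := hY.truncation v w
  have hTi : ∀ (a : ℤ) (i : ℕ), a ≤ i → a ≤ T * i := by
    intro a i h
    have : (1 : ℤ) * i ≤ T * i := mul_le_mul_of_nonneg_right (by omega) (by omega)
    omega
  refine ⟨(N₁ - l).toNat + (N₂ - m).toNat + (N₃ - n).toNat, fun N hN => ?_⟩
  rw [← finsum_eq_sum_range, ← finsum_eq_sum_range]
  · exact hY.jacobi r u hu v w l m n hm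
  · intro i hi
    have e1 := hTi (N₂ - m) i (by omega)
    have e2 := hTi (N₃ - n) i (by omega)
    rw [h₂ _ (by omega), h₃ _ (by omega)]
    simp
  · intro i hi
    rw [h₁ _ (by omega)]
    simp

/-- `Y(L(-1) v, z) = d/dz Y(v, z)`. -/
theorem mode_L_neg_one (hY : IsWeakTwistedModule A g T Y) (hA : A.IsConformal)
    (hg : IsConformalAut A g T) (v : V) (p : ℤ) :
    Y (A.L (-1) v) p = -((p : ℂ) / T) • Y v (p - T) := by
  have hT := hg.pos
  have key : ((LinearMap.proj p : (ℤ → Module.End ℂ M) →ₗ[ℂ] _) ∘ₗ Y ∘ₗ A.L (-1)) =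
      -((p : ℂ) / T) • ((LinearMap.proj (p - T) : (ℤ → Module.End ℂ M) →ₗ[ℂ] _) ∘ₗ Y) := by
    refine linearMap_ext_of_iSup_eq_top
      (iSup_eigenspace_eq_top_of_pow_eq_one hT hg.pow_eq_one) fun r u hu => ?_
    replace hu : g u = Complex.exp (2 * Real.pi * Complex.I * r / T) • u :=
      Module.End.mem_eigenspace_iff.mp hu
    ext1 w
    show Y (A.L (-1) u) p w = -((p : ℂ) / T) • Y u (p - T) w
    -- The Jacobi identity with the vacuum as second vector and `l = -2`. On the left only `u_{-2} 𝟏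
    -- = L(-1) u` and `u_{-1} 𝟏 = u` survive; the right vanishes because the vacuum has its only
    -- mode at `-T`, which the condition on `n` avoids.
    have main : ∀ m n : ℤ, m ≡ r [ZMOD T] → (n = 0 ∨ ¬ (T : ℤ) ∣ n) →
        Y (A.L (-1) u) (m + n) w + ((m : ℂ) / T) • Y u (m + n - T) w = 0 := by
      intro m n hm hn
      have h := hY.jacobi r u hu A.vac w (-2) m n hm
      rw [finsum_eq_sum_range (N := 2), finsum_eq_sum_range (N := 0)] at h
      · simpa [Finset.sum_range_succ, binom_zero_right, binom_one_right, hA.creation_two,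
          (hA.creation u).1] using h
      · intro i _
        have hTi : (0 : ℤ) ≤ T * i := by positivity
        have e1 : n + T * i ≠ -T := by
          rcases hn with rfl | hn
          · omega
          · intro h
            exact hn ⟨-1 - i, by linear_combination h⟩
        have e2 : n + T * (-2) - T * i ≠ -T := by
          rcases hn with rfl | hn
          · omega
          · intro h
            exact hn ⟨1 + i, by linear_combination h⟩
        rw [hY.vacuum, hY.vacuum, if_neg e1, if_neg e2]
        simp
      · intro i hi
        rw [(hA.creation u).2 _ (by omega)]
        simp
    by_cases hp : p ≡ r [ZMOD T]
    · have := main p 0 hp (Or.inl rfl)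
      rw [add_zero] at this
      rw [neg_smul]
      exact eq_neg_of_add_eq_zero_left this
    -- Off the coset of `r`, the identity at `m = r`, `n = p - r` reduces the claim to the vanishing
    -- of the mode `p - T` of `u`.
    · have hd : ¬ (T : ℤ) ∣ p - r := fun h => hp (Int.modEq_iff_dvd.mpr h).symm
      have h1 := main r (p - r) (Int.ModEq.refl r) (Or.inr hd)
      rw [add_sub_cancel] at h1
      have h2 : Y u (p - T) = 0 := by
        refine hY.support r u hu _ fun h => hp (Int.ModEq.trans ?_ h)
        exact Int.modEq_iff_dvd.mpr ⟨-1, by ring⟩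
      rw [h2] at h1 ⊢
      simpa using h1
  exact LinearMap.congr_fun key v

/-- `[L(0), v_p]`. -/
theorem L_zero_mode (hY : IsWeakTwistedModule A g T Y) (hA : A.IsConformal)
    (hg : IsConformalAut A g T) {h : ℤ} {v : V} (hv : v ∈ A.wt h) (p : ℤ) (w : M) :
    Y A.conf T (Y v p w) = ((h : ℂ) - p / T - 1) • Y v p w + Y v p (Y A.conf T w) := by
  have hT : (T : ℂ) ≠ 0 := Nat.cast_ne_zero.mpr hg.pos.ne'
  have hu : g A.conf = Complex.exp (2 * Real.pi * Complex.I * (0 : ℤ) / T) • A.conf := by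
    simp [hg.conf]
  -- `ω` is fixed by `g`; `l = 0` gives a commutator, and `m = T` is the mode `ω_1`.
  have key := hY.jacobi 0 A.conf hu v w 0 T p (by simp [Int.ModEq])
  rw [finsum_eq_sum_range (N := 2), finsum_eq_sum_range (N := 1)] at key
  · simp only [Finset.sum_range_succ, Finset.sum_range_zero, Int.cast_natCast, div_self hT,
      binom_zero_right, binom_one_right, one_smul, zero_add, Nat.cast_zero, Nat.cast_one,
      mul_zero, mul_one, sub_zero, add_zero, pow_zero, zpow_zero] at key
    have e0 : A.Y A.conf 0 v = A.L (-1) v := rfl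
    have e1 : A.Y A.conf 1 v = A.L 0 v := rfl
    rw [e0, e1, hY.mode_L_neg_one hA hg, VertexData.mem_wt_iff.mp hv, map_smul, Pi.smul_apply,
      LinearMap.smul_apply, LinearMap.smul_apply, add_sub_cancel_left] at key
    rw [← sub_eq_iff_eq_add, ← key, ← add_smul]
    congr 1
    push_cast
    field_simp
    ring
  · intro i hi
    rw [binom, Finset.prod_eq_zero (i := 0) (Finset.mem_range.mpr (by omega))] <;> simp
  · intro i hi
    rw [Int.cast_natCast, div_self hT, binom, Finset.prod_eq_zero (i := 1)
      (Finset.mem_range.mpr (by omega))] <;> simp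

theorem mode_mem_eigenspace (hY : IsWeakTwistedModule A g T Y) (hA : A.IsConformal)
    (hg : IsConformalAut A g T) {h : ℤ} {v : V} (hv : v ∈ A.wt h) {p : ℤ} {μ ν : ℂ}
    (hν : ν = μ + h - p / T - 1) {w : M} (hw : w ∈ Module.End.eigenspace (Y A.conf T) μ) :
    Y v p w ∈ Module.End.eigenspace (Y A.conf T) ν := by
  rw [Module.End.mem_eigenspace_iff] at hw ⊢
  rw [hY.L_zero_mode hA hg hv, hw, map_smul, ← add_smul, hν]
  congr 1
  ring

end IsWeakTwistedModule

/-! ### The modes of the contragredient module -/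

theorem contragredientMode_eq_sum (A : VertexData V) (T : ℕ) (Y : V →ₗ[ℂ] (ℤ → Module.End ℂ M))
    (n : ℤ) {v : V} (p : ℤ) {N : ℕ} (hN : ∀ j, N ≤ j → A.dividedL j v = 0) :
    contragredientMode A T Y n v p = (-1 : ℂ) ^ n • ∑ j ∈ Finset.range N,
      Y (A.dividedL j v) (-p + T * (2 * n - j - 2)) := by
  have h : ∀ j : ℕ, (j.factorial : ℂ)⁻¹ • Y ((A.L 1 ^ j) v) (-p + T * (2 * n - j - 2)) =
      Y (A.dividedL j v) (-p + T * (2 * n - j - 2)) := by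
    intro j
    rw [VertexData.dividedL, LinearMap.smul_apply, map_smul, Pi.smul_apply]
  rw [contragredientMode, finsum_eq_sum_range (N := N)]
  · simp only [h]
  · intro j hj
    rw [h, hN j hj]
    simp

theorem VertexData.IsConformal.dividedL_eq_zero {A : VertexData V} (hA : A.IsConformal) {h : ℤ}
    {v : V} (hv : v ∈ A.wt h) {j : ℕ} (hj : A.wt (h - j) = ⊥) : A.dividedL j v = 0 := by
  have := hA.dividedL_mem hv j
  rwa [hj, Submodule.mem_bot] at this

theorem exists_contragredientMap {A : VertexData V} (hA : A.IsConformal) (T : ℕ)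
    (Y : V →ₗ[ℂ] (ℤ → Module.End ℂ M)) :
    ∃ S : V →ₗ[ℂ] (ℤ → Module.End ℂ M), ∀ n, ∀ v ∈ A.wt n, ∀ p,
      S v p = contragredientMode A T Y n v p := by
  choose N hN using hA.exists_wt_eq_bot
  obtain ⟨S, hS⟩ := exists_linearMap_of_iSup_eq_top A.wt_iSupIndep hA.graded
    (fun n => (LinearMap.pi fun p : ℤ => (-1 : ℂ) ^ n • ∑ j ∈ Finset.range (N n),
      (LinearMap.proj (-p + T * (2 * n - j - 2)) : (ℤ → Module.End ℂ M) →ₗ[ℂ] _) ∘ₗ Y ∘ₗ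
        A.dividedL j) ∘ₗ (A.wt n).subtype)
  refine ⟨S, fun n v hv p => ?_⟩
  have := congrFun (hS n ⟨v, hv⟩) p
  rw [contragredientMode_eq_sum A T Y n p (N := N n) fun j hj =>
    hA.dividedL_eq_zero hv (hN n j hj)]
  refine this.trans ?_
  simp [LinearMap.sum_apply]

open Finset.HasAntidiagonal in
/-- The Jacobi identity of the contragredient module, before taking transposes. -/
theorem exists_contragredient_jacobi_sum {A : VertexData V} {g : V →ₗ[ℂ] V} {T : ℕ}
    {Y : V →ₗ[ℂ] (ℤ → Module.End ℂ M)} (hY : IsWeakTwistedModule A g T Y) (hA : A.IsConformal)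
    (hg : IsConformalAut A g T) {S : V →ₗ[ℂ] (ℤ → Module.End ℂ M)}
    (hS : ∀ n, ∀ v ∈ A.wt n, ∀ p, S v p = contragredientMode A T Y n v p)
    {r : ℤ} {h h' : ℤ} {u v : V} (hu : u ∈ A.wt h) (hv : v ∈ A.wt h')
    (hgu : g u = Complex.exp (2 * Real.pi * Complex.I * (-r : ℤ) / T) • u) (w : M)
    (l m n : ℤ) (hm : m ≡ r [ZMOD T]) : ∃ N₀ : ℕ, ∀ N : ℕ, N₀ ≤ N →
      ∑ i ∈ Finset.range N, binom ((m : ℂ) / T) i • S (A.Y u (l + i) v) (m + n - T * i) w =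
      ∑ i ∈ Finset.range N, ((-1 : ℂ) ^ i * binom l i) •
        (S v (n + T * i) (S u (m + T * l - T * i) w) -
          (-1 : ℂ) ^ l • S u (m + T * i) (S v (n + T * l - T * i) w)) := by
  have hT : (T : ℂ) ≠ 0 := Nat.cast_ne_zero.mpr hg.pos.ne'
  obtain ⟨N₁, h₁⟩ := hA.exists_wt_eq_bot h
  obtain ⟨N₂, h₂⟩ := hA.exists_wt_eq_bot h'
  obtain ⟨N₃, h₃⟩ := hA.exists_wt_eq_bot (h + h' - l - 1)
  -- Indices at which the Jacobi identity of `Y` is applied, for the `j`-th and `j'`-th terms of the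
  -- adjoint fields. The shift by `-T * l` matches both orders of composition at once.
  set mh : ℕ → ℤ := fun j => -m - T * l + T * (2 * h - j - 2) with hmh
  set nh : ℕ → ℤ := fun j => -n - T * l + T * (2 * h' - j - 2) with hnh
  have hgu' : ∀ j, g (A.dividedL j u) =
      Complex.exp (2 * Real.pi * Complex.I * (-r : ℤ) / T) • A.dividedL j u := by
    intro j
    rw [hg.dividedL, hgu, map_smul]
  have hmod : ∀ j, mh j ≡ -r [ZMOD T] := by
    intro j
    refine Int.ModEq.trans ?_ hm.neg
    exact Int.modEq_iff_dvd.mpr ⟨l - (2 * h - j - 2), by simp only [hmh]; ring⟩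
  choose N₄ h₄ using fun j j' => hY.exists_jacobi_sum hA hg.pos (hgu' j) (A.dividedL j' v) w l
    (mh j) (nh j') (hmod j)
  -- The signs `(-1)^h (-1)^(h')` come from `(-z⁻²)^(L(0))`; the factor `-(-1)^l` comes from
  -- exchanging the two orders of composition.
  set δ : ℂ := (-1) ^ h * (-1) ^ h' * (-(-1) ^ l) with hδ
  have hone : ((-1 : ℂ) ^ l) * (-1) ^ l = 1 := by
    rw [← mul_zpow]
    simp
  set K : ℤ := -m - n + T * (2 * h + 2 * h' - 2 * l - 4) with hK
  refine ⟨N₁ + N₂ + N₃ + ∑ j ∈ Finset.range N₁, ∑ j' ∈ Finset.range N₂, N₄ j j', fun N hN => ?_⟩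
  set G : ℕ → ℕ → ℕ → M := fun i j j' => binom (2 * h - l - 2 - j - m / T) i •
    Y (A.Y (A.dividedL j u) (l + i) (A.dividedL j' v)) (K - T * (i + j + j' : ℕ)) w with hG
  -- both sides are equal to a sum over triples
  trans δ • ∑ s ∈ Finset.range N, ∑ p ∈ antidiagonal s, ∑ q ∈ antidiagonal p.1, G q.1 q.2 p.2
  · set F : ℕ → ℕ → M := fun i s => (δ * ((-1 : ℂ) ^ i * binom ((m : ℂ) / T) i)) •
      Y (A.dividedL s (A.Y u (l + i) v)) (K - T * (i + s : ℕ)) w with hF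
    have hwt : ∀ i : ℕ, A.Y u (l + i) v ∈ A.wt (h + h' - (l + i) - 1) := fun i =>
      hA.mode_mem hu hv _
    have hzero : ∀ i s : ℕ, N ≤ i + s → A.dividedL s (A.Y u (l + i) v) = 0 := by
      intro i s his
      refine hA.dividedL_eq_zero (hwt i) ?_
      rw [← h₃ (i + s) (by omega)]
      congr 1
      push_cast
      ring
    have e1 : ∀ i ∈ Finset.range N,
        binom ((m : ℂ) / T) i • S (A.Y u (l + i) v) (m + n - T * i) w =
          ∑ s ∈ Finset.range N, F i s := by
      intro i _
      rw [hS _ _ (hwt i), contragredientMode_eq_sum A T Y _ _ (N := N) fun s hs =>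
        hzero i s (by omega), LinearMap.smul_apply, LinearMap.sum_apply, smul_smul,
        Finset.smul_sum]
      refine Finset.sum_congr rfl fun s _ => ?_
      simp only [hF]
      have es : (-1 : ℂ) ^ (h + h' - (l + i) - 1) = δ * (-1) ^ i := by
        have h0 : (-1 : ℂ) ≠ 0 := by norm_num
        have hi : ((-1 : ℂ) ^ i) * (-1) ^ i = 1 := by rw [← mul_pow]; simp
        have hl' : ((-1 : ℂ) ^ l)⁻¹ = (-1) ^ l := inv_eq_of_mul_eq_one_left hone
        have hi' : ((-1 : ℂ) ^ i)⁻¹ = (-1) ^ i := inv_eq_of_mul_eq_one_left hi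
        rw [zpow_sub₀ h0, zpow_sub₀ h0, zpow_add₀ h0, zpow_add₀ h0, zpow_natCast, zpow_one,
          div_eq_mul_inv, div_eq_mul_inv, mul_inv, hl', hi', hδ]
        norm_num
        ring
      have ei : -(m + n - T * i) + T * (2 * (h + h' - (l + i) - 1) - s - 2) =
          K - T * (i + s : ℕ) := by
        simp only [hK]
        push_cast
        ring
      rw [es, ei]
      congr 1
      ring
    rw [Finset.sum_congr rfl e1, sum_range_sum_range_eq F N, Finset.smul_sum]
    · refine Finset.sum_congr rfl fun s _ => ?_
      -- All terms with the same `i + s` use one mode index of `Y`, so the identity in `V` can be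
      -- applied inside `Y`.
      have e2 := hA.sum_binom_dividedL_mode hu v ((m : ℂ) / T) l s
      have e3 := congrArg (fun x => Y x (K - T * s) w) e2
      simp only [map_sum, Finset.sum_apply, LinearMap.sum_apply, map_smul, Pi.smul_apply,
        LinearMap.smul_apply] at e3
      calc _ = δ • ∑ p ∈ antidiagonal s, ((-1 : ℂ) ^ p.1 * binom ((m : ℂ) / T) p.1) •
            Y (A.dividedL p.2 (A.Y u (l + p.1) v)) (K - T * s) w := by
            rw [Finset.smul_sum]
            refine Finset.sum_congr rfl fun p hp => ?_
            rw [smul_smul, ← mem_antidiagonal.mp hp]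
        _ = _ := by
            rw [e3]
            congr 1
            refine Finset.sum_congr rfl fun p hp => Finset.sum_congr rfl fun q hq => ?_
            simp only [hG]
            rw [mem_antidiagonal.mp hq, mem_antidiagonal.mp hp]
    · intro i s his
      simp only [hF]
      rw [hzero i s his]
      simp
  · have hzero : ∀ i j j' : ℕ, N ≤ i + j + j' → G i j j' = 0 := by
      intro i j j' hij
      have hw : A.Y (A.dividedL j u) (l + i) (A.dividedL j' v) ∈
          A.wt ((h - j) + (h' - j') - (l + i) - 1) :=
        hA.mode_mem (hA.dividedL_mem hu j) (hA.dividedL_mem hv j') _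
      have : A.wt ((h - j) + (h' - j') - (l + i) - 1) = ⊥ := by
        rw [← h₃ (i + j + j') (by omega)]
        congr 1
        push_cast
        ring
      rw [this, Submodule.mem_bot] at hw
      simp only [hG]
      rw [hw]
      simp
    have hz1 : ∀ j, N₁ ≤ j → A.dividedL j u = 0 := fun j hj => hA.dividedL_eq_zero hu (h₁ j hj)
    have hz2 : ∀ j, N₂ ≤ j → A.dividedL j v = 0 := fun j hj => hA.dividedL_eq_zero hv (h₂ j hj)
    have hSu : ∀ p x, S u p x = (-1 : ℂ) ^ h • ∑ j ∈ Finset.range N₁,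
        Y (A.dividedL j u) (-p + T * (2 * h - j - 2)) x := by
      intro p x
      rw [hS _ _ hu, contragredientMode_eq_sum A T Y _ _ hz1, LinearMap.smul_apply,
        LinearMap.sum_apply]
    have hSv : ∀ p x, S v p x = (-1 : ℂ) ^ h' • ∑ j ∈ Finset.range N₂,
        Y (A.dividedL j v) (-p + T * (2 * h' - j - 2)) x := by
      intro p x
      rw [hS _ _ hv, contragredientMode_eq_sum A T Y _ _ hz2, LinearMap.smul_apply,
        LinearMap.sum_apply]
    symm
    calc _ = δ • ∑ i ∈ Finset.range N, ∑ j ∈ Finset.range N₁, ∑ j' ∈ Finset.range N₂,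
          ((-1 : ℂ) ^ i * binom l i) •
          (Y (A.dividedL j u) (mh j + T * l - T * i) (Y (A.dividedL j' v) (nh j' + T * i) w) -
            (-1 : ℂ) ^ l • Y (A.dividedL j' v) (nh j' + T * l - T * i)
              (Y (A.dividedL j u) (mh j + T * i) w)) := by
          rw [Finset.smul_sum]
          refine Finset.sum_congr rfl fun i _ => ?_
          have a1 : ∀ j : ℕ, -(m + T * l - T * i) + T * (2 * h - j - 2) = mh j + T * i := by
            intro j; simp only [hmh]; ring
          have a2 : ∀ j : ℕ, -(n + T * i) + T * (2 * h' - j - 2) = nh j + T * l - T * i := by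
            intro j; simp only [hnh]; ring
          have a3 : ∀ j : ℕ, -(n + T * l - T * i) + T * (2 * h' - j - 2) = nh j + T * i := by
            intro j; simp only [hnh]; ring
          have a4 : ∀ j : ℕ, -(m + T * i) + T * (2 * h - j - 2) = mh j + T * l - T * i := by
            intro j; simp only [hmh]; ring
          have b1 : S v (n + T * i) (S u (m + T * l - T * i) w) = ((-1 : ℂ) ^ h * (-1) ^ h') •
              ∑ j ∈ Finset.range N₁, ∑ j' ∈ Finset.range N₂,
                Y (A.dividedL j' v) (nh j' + T * l - T * i)
                  (Y (A.dividedL j u) (mh j + T * i) w) := by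
            rw [hSu, hSv]
            simp only [a1, a2, map_smul, map_sum, Finset.smul_sum, smul_smul]
            rw [Finset.sum_comm]
            simp only [mul_comm]
          have b2 : S u (m + T * i) (S v (n + T * l - T * i) w) = ((-1 : ℂ) ^ h * (-1) ^ h') •
              ∑ j ∈ Finset.range N₁, ∑ j' ∈ Finset.range N₂,
                Y (A.dividedL j u) (mh j + T * l - T * i)
                  (Y (A.dividedL j' v) (nh j' + T * i) w) := by
            rw [hSv, hSu]
            simp only [a3, a4, map_smul, map_sum, Finset.smul_sum, smul_smul]
          rw [b1, b2]
          simp only [← Finset.smul_sum, Finset.sum_sub_distrib]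
          generalize (∑ j ∈ Finset.range N₁, ∑ j' ∈ Finset.range N₂,
            Y (A.dividedL j' v) (nh j' + T * l - T * i)
              (Y (A.dividedL j u) (mh j + T * i) w)) = x
          generalize (∑ j ∈ Finset.range N₁, ∑ j' ∈ Finset.range N₂,
            Y (A.dividedL j u) (mh j + T * l - T * i)
              (Y (A.dividedL j' v) (nh j' + T * i) w)) = y
          rw [hδ]
          generalize (-1 : ℂ) ^ l = e at hone
          match_scalars
          · linear_combination (-(-1 : ℂ) ^ i * binom l i * ((-1) ^ h * (-1) ^ h')) * hone
          · ring
      _ = δ • ∑ j ∈ Finset.range N₁, ∑ j' ∈ Finset.range N₂, ∑ i ∈ Finset.range N, G i j j' := by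
          congr 1
          rw [Finset.sum_comm]
          refine Finset.sum_congr rfl fun j hj => ?_
          rw [Finset.sum_comm]
          refine Finset.sum_congr rfl fun j' hj' => ?_
          have hle : N₄ j j' ≤ N := by
            have c1 : N₄ j j' ≤ ∑ j' ∈ Finset.range N₂, N₄ j j' :=
              Finset.single_le_sum (f := fun j' => N₄ j j') (fun _ _ => Nat.zero_le _) hj'
            have c2 : ∑ j' ∈ Finset.range N₂, N₄ j j' ≤
                ∑ j ∈ Finset.range N₁, ∑ j' ∈ Finset.range N₂, N₄ j j' :=
              Finset.single_le_sum (f := fun j => ∑ j' ∈ Finset.range N₂, N₄ j j')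
                (fun _ _ => Nat.zero_le _) hj
            omega
          rw [← h₄ j j' N hle]
          refine Finset.sum_congr rfl fun i _ => ?_
          simp only [hG]
          have ei : mh j + nh j' - T * i = K - T * (i + j + j' : ℕ) := by
            simp only [hmh, hnh, hK]
            push_cast
            ring
          rw [ei]
          congr 2
          simp only [hmh]
          push_cast
          field_simp
          ring
      _ = δ • ∑ i ∈ Finset.range N, ∑ j ∈ Finset.range N, ∑ j' ∈ Finset.range N, G i j j' := by
          congr 1
          have d1 : ∀ j, N₁ ≤ j → ∀ i j', G i j j' = 0 := by
            intro j hj i j'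
            simp only [hG]
            rw [hz1 j hj]
            simp
          have d2 : ∀ j', N₂ ≤ j' → ∀ i j, G i j j' = 0 := by
            intro j hj i j'
            simp only [hG]
            rw [hz2 j hj]
            simp
          have c1 : ∑ j ∈ Finset.range N₁, ∑ j' ∈ Finset.range N₂, ∑ i ∈ Finset.range N, G i j j' =
              ∑ j ∈ Finset.range N₁, ∑ j' ∈ Finset.range N, ∑ i ∈ Finset.range N, G i j j' :=
            Finset.sum_congr rfl fun j _ => (sum_range_eq_of_le (fun j' hj' =>
              Finset.sum_eq_zero fun i _ => d2 j' hj' i j) (by omega)).symm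
          have c2 : ∑ j ∈ Finset.range N₁, ∑ j' ∈ Finset.range N, ∑ i ∈ Finset.range N, G i j j' =
              ∑ j ∈ Finset.range N, ∑ j' ∈ Finset.range N, ∑ i ∈ Finset.range N, G i j j' :=
            (sum_range_eq_of_le (fun j hj => Finset.sum_eq_zero fun j' _ =>
              Finset.sum_eq_zero fun i _ => d1 j hj i j') (by omega)).symm
          rw [c1, c2, Finset.sum_congr rfl fun j _ => Finset.sum_comm, Finset.sum_comm]
      _ = _ := by rw [sum_range_sum_range_sum_range_eq G N hzero]

end Twisted

/-! ### Contragredient modules -/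

section Contragredient

variable {V M : Type*} [AddCommGroup V] [Module ℂ V] [AddCommGroup M] [Module ℂ M]

theorem restrictedDual_eq_zero {L₀ : Module.End ℂ M}
    (htop : ⨆ μ : ℂ, Module.End.eigenspace L₀ μ = ⊤) {f : Module.Dual ℂ M}
    (h : ∀ μ, ∀ w ∈ Module.End.eigenspace L₀ μ, f w = 0) : f = 0 :=
  linearMap_ext_of_iSup_eq_top htop h

variable {A : VertexData V} {g g' : V →ₗ[ℂ] V} {T : ℕ} {Y : V →ₗ[ℂ] (ℤ → Module.End ℂ M)}

theorem contragredientMode_mem_eigenspace (hY : IsWeakTwistedModule A g T Y)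
    (hA : A.IsConformal) (hg : IsConformalAut A g T) {n : ℤ} {v : V} (hv : v ∈ A.wt n) (p : ℤ)
    {μ : ℂ} {w : M} (hw : w ∈ Module.End.eigenspace (Y A.conf T) μ) :
    contragredientMode A T Y n v p w ∈
      Module.End.eigenspace (Y A.conf T) (μ + (p / T - n + 1)) := by
  have hT : (T : ℂ) ≠ 0 := Nat.cast_ne_zero.mpr hg.pos.ne'
  obtain ⟨N, hN⟩ := hA.exists_wt_eq_bot n
  rw [contragredientMode_eq_sum A T Y n p fun j hj => hA.dividedL_eq_zero hv (hN j hj),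
    LinearMap.smul_apply, LinearMap.sum_apply]
  refine Submodule.smul_mem _ _ (Submodule.sum_mem _ fun j _ => ?_)
  refine hY.mode_mem_eigenspace hA hg (hA.dividedL_mem hv j) ?_ hw
  push_cast
  field_simp
  ring

theorem VertexData.IsConformal.dividedL_of_L_one_eq_zero {v : V} (hv : A.L 1 v = 0) :
    ∀ j, 1 ≤ j → A.dividedL j v = 0 := by
  intro j hj
  obtain ⟨j, rfl⟩ := Nat.exists_eq_succ_of_ne_zero (by omega : j ≠ 0)
  rw [VertexData.dividedL, LinearMap.smul_apply, Nat.succ_eq_add_one, pow_succ,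
    Module.End.mul_apply, hv, map_zero, smul_zero]

/-- `L(0)` is its own adjoint: `ω` has even weight and `L(1) ω = 0`, so a single term survives, and
its mode index is again `T`. -/
theorem contragredientMode_conf (hA : A.IsConformal) :
    contragredientMode A T Y 2 A.conf T = Y A.conf T := by
  rw [contragredientMode_eq_sum A T Y 2 T (N := 1)
    (VertexData.IsConformal.dividedL_of_L_one_eq_zero hA.L_one_conf)]
  simp only [Finset.sum_range_one, VertexData.dividedL_zero, Nat.cast_zero]
  rw [show -(T : ℤ) + T * (2 * 2 - 0 - 2) = T by ring]
  norm_num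

/-- The vertex operator map on the restricted dual, for all vectors. -/
theorem exists_contragredient_modes (hY : IsWeakTwistedModule A g T Y)
    (hA : A.IsConformal) (hg : IsConformalAut A g T) {S : V →ₗ[ℂ] (ℤ → Module.End ℂ M)}
    (hS : ∀ n, ∀ v ∈ A.wt n, ∀ p, S v p = contragredientMode A T Y n v p) :
    ∃ Y' : V →ₗ[ℂ] (ℤ → Module.End ℂ (restrictedDual (Y A.conf T))),
      ∀ v p (f : restrictedDual (Y A.conf T)) (w : M),
        (Y' v p f : Module.Dual ℂ M) w = (f : Module.Dual ℂ M) (S v p w) := by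
  have hmem : ∀ v p, ∀ f ∈ restrictedDual (Y A.conf T),
      (S v p).dualMap f ∈ restrictedDual (Y A.conf T) := by
    intro v
    have hv : v ∈ ⨆ n, A.wt n := hA.graded ▸ trivial
    induction hv using Submodule.iSup_induction' with
    | mem n v hv =>
      intro p f hf
      have hfin : {μ : ℂ | ∃ w ∈ Module.End.eigenspace (Y A.conf T) μ, f w ≠ 0}.Finite := hf
      refine (hfin.preimage (f := fun μ : ℂ => μ + (p / T - n + 1))
        (add_left_injective _).injOn).subset ?_
      rintro μ ⟨w, hw, hne⟩
      refine ⟨S v p w, ?_, hne⟩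
      rw [hS n v hv]
      exact contragredientMode_mem_eigenspace hY hA hg hv p hw
    | zero =>
      intro p f _
      have : (S 0 p).dualMap f = 0 := by
        ext w
        simp
      rw [this]
      exact Submodule.zero_mem _
    | add v v' _ _ ih ih' =>
      intro p f hf
      have : (S (v + v') p).dualMap f = (S v p).dualMap f + (S v' p).dualMap f := by
        ext w
        simp
      rw [this]
      exact Submodule.add_mem _ (ih p f hf) (ih' p f hf)
  refine ⟨{ toFun := fun v p => (S v p).dualMap.restrict (hmem v p), map_add' := ?_,
            map_smul' := ?_ }, fun v p f w => rfl⟩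
  · intro v v'
    ext p f w
    simp [LinearMap.restrict_apply]
  · intro c v
    ext p f w
    simp [LinearMap.restrict_apply]

variable {Y' : V →ₗ[ℂ] (ℤ → Module.End ℂ (restrictedDual (Y A.conf T)))}
  {S : V →ₗ[ℂ] (ℤ → Module.End ℂ M)}

/-- If `f` does not vanish on `v_p w`, the weight of `v_p w` lies in the finite set of weights seen
by `f`; the weight of `w` is lower by `p/T - n + 1`, so for large `p` it falls below the bound of
the grading. -/
theorem exists_contragredient_truncation (hY : IsTwistedModule A g T Y)
    (hA : A.IsConformal) (hg : IsConformalAut A g T)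
    (hS : ∀ n, ∀ v ∈ A.wt n, ∀ p, S v p = contragredientMode A T Y n v p)
    (hY' : ∀ v p (f : restrictedDual (Y A.conf T)) (w : M),
        (Y' v p f : Module.Dual ℂ M) w = (f : Module.Dual ℂ M) (S v p w))
    (v : V) (f : restrictedDual (Y A.conf T)) : ∃ N : ℤ, ∀ p : ℤ, N ≤ p → Y' v p f = 0 := by
  have hT : (T : ℂ) ≠ 0 := Nat.cast_ne_zero.mpr hg.pos.ne'
  have hv : v ∈ ⨆ n, A.wt n := hA.graded ▸ trivial
  induction hv using Submodule.iSup_induction' with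
  | mem n v hv =>
    have hfin : {μ : ℂ | ∃ w ∈ Module.End.eigenspace (Y A.conf T) μ,
      (f : Module.Dual ℂ M) w ≠ 0}.Finite := f.2
    choose B hB using hY.lower_bound
    obtain ⟨C, hC⟩ : ∃ C : ℤ, ∀ ν ∈ hfin.toFinset, -B ν ≤ C := by
      refine ⟨∑ ν ∈ hfin.toFinset, |B ν|, fun ν hν => (neg_le_abs _).trans ?_⟩
      exact Finset.single_le_sum (f := fun ν => |B ν|) (fun _ _ => abs_nonneg _) hν
    refine ⟨T * (n - 1) + C + 1, fun p hp => ?_⟩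
    refine Subtype.ext (restrictedDual_eq_zero hY.graded fun μ w hw => ?_)
    rw [hY']
    by_contra hne
    set ν : ℂ := μ + (p / T - n + 1) with hν
    have hmemν : ν ∈ hfin.toFinset := by
      rw [Set.Finite.mem_toFinset]
      refine ⟨S v p w, ?_, hne⟩
      rw [hS n v hv]
      exact contragredientMode_mem_eigenspace hY.toIsWeakTwistedModule hA hg hv p hw
    have hbot := hB ν (-p + T * (n - 1)) (by have := hC ν hmemν; omega)
    have : ν + ((-p + T * (n - 1) : ℤ) : ℂ) / T = μ := by
      rw [hν]
      push_cast
      field_simp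
      ring
    rw [this] at hbot
    rw [hbot, Submodule.mem_bot] at hw
    rw [hw] at hne
    simp at hne
  | zero => exact ⟨0, fun p _ => by simp⟩
  | add v v' _ _ ih ih' =>
    obtain ⟨N, hN⟩ := ih
    obtain ⟨N', hN'⟩ := ih'
    refine ⟨max N N', fun p hp => ?_⟩
    rw [map_add, Pi.add_apply, LinearMap.add_apply, hN p (le_of_max_le_left hp),
      hN' p (le_of_max_le_right hp), add_zero]

/-- Eigenvectors of `g'` are eigenvectors of `g` with inverse eigenvalue, and their homogeneous
components are too, since `g` commutes with `L(0)`. Everything reduces to homogeneous vectors, where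
the adjoint modes are explicit. -/
theorem contragredient_isWeakTwistedModule (hY : IsTwistedModule A g T Y)
    (hA : A.IsConformal) (hg : IsConformalAut A g T) (hgg' : ∀ v, g (g' v) = v)
    (hS : ∀ n, ∀ v ∈ A.wt n, ∀ p, S v p = contragredientMode A T Y n v p)
    (hY' : ∀ v p (f : restrictedDual (Y A.conf T)) (w : M),
        (Y' v p f : Module.Dual ℂ M) w = (f : Module.Dual ℂ M) (S v p w)) :
    IsWeakTwistedModule A g' T Y' := by
  have hw := hY.toIsWeakTwistedModule
  have htr := exists_contragredient_truncation hY hA hg hS hY'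
  -- homogeneous components of eigenvectors are eigenvectors
  have heig : ∀ (r : ℤ) (u : V), g' u = Complex.exp (2 * Real.pi * Complex.I * r / T) • u →
      u ∈ ⨆ n, A.wt n ⊓ LinearMap.ker (g -
        Complex.exp (2 * Real.pi * Complex.I * (-r : ℤ) / T) • LinearMap.id) := by
    intro r u hu
    refine mem_iSup_inf_ker A.wt_iSupIndep hA.graded (fun n x hx => ?_) ?_
    · rw [VertexData.mem_wt_iff] at hx ⊢
      rw [LinearMap.sub_apply, map_sub, ← hg.L_zero, hx, LinearMap.smul_apply, map_smul, map_smul,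
        LinearMap.id_apply, hx, smul_sub, smul_comm]
    · have h1 := hgg' u
      rw [hu, map_smul] at h1
      rw [LinearMap.sub_apply, LinearMap.smul_apply, LinearMap.id_apply, sub_eq_zero]
      rw [← h1, smul_smul, ← Complex.exp_add, h1]
      have : 2 * (Real.pi : ℂ) * Complex.I * (-r : ℤ) / T + 2 * Real.pi * Complex.I * r / T = 0 := by
        push_cast
        ring
      rw [this, Complex.exp_zero, one_smul]
  refine ⟨?_, htr, ?_, ?_⟩
  · intro r u hu p hp
    have hu' := heig r u hu
    clear hu
    induction hu' using Submodule.iSup_induction' with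
    | mem n u hu' =>
      obtain ⟨hun, huk⟩ := hu'
      have hgu : g u = Complex.exp (2 * Real.pi * Complex.I * (-r : ℤ) / T) • u := by
        simpa [sub_eq_zero] using huk
      ext f w
      rw [hY', hS n u hun]
      obtain ⟨N, hN⟩ := hA.exists_wt_eq_bot n
      rw [contragredientMode_eq_sum A T Y n p fun j hj => hA.dividedL_eq_zero hun (hN j hj),
        Finset.sum_eq_zero]
      · simp
      · intro j _
        refine hw.support (-r) _ (by rw [hg.dividedL, hgu, map_smul]) _ fun h => hp ?_
        have h1 := h.neg
        rw [neg_neg] at h1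
        exact Int.ModEq.trans (Int.modEq_iff_dvd.mpr ⟨-(2 * n - j - 2), by ring⟩) h1
    | zero => simp
    | add x y _ _ ih ih' => rw [map_add, Pi.add_apply, ih, ih', add_zero]
  · intro p
    have h0 : A.vac ∈ A.wt 0 := by
      rw [VertexData.mem_wt_iff, Int.cast_zero, zero_smul]
      exact (hA.creation A.conf).2 _ (by omega)
    have h1 : A.L 1 A.vac = 0 := (hA.creation A.conf).2 _ (by omega)
    ext f w
    rw [hY', hS 0 _ h0, contragredientMode_eq_sum A T Y 0 p (N := 1)
      (VertexData.IsConformal.dividedL_of_L_one_eq_zero h1)]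
    simp only [Finset.sum_range_one, VertexData.dividedL_zero, hw.vacuum, zpow_zero, one_smul]
    have : (-p + T * (2 * 0 - ((0 : ℕ) : ℤ) - 2) = -T) ↔ p = -T := by
      constructor
      · intro h
        linear_combination -h
      · rintro rfl
        push_cast
        ring
    simp only [this]
    split_ifs <;> simp
  · intro r u hu v f l m n hm
    -- all the sums are finite
    have hrange : ∀ u v : V, ∃ N₀ : ℕ, ∀ i, N₀ ≤ i → binom ((m : ℂ) / T) i •
          Y' (A.Y u (l + i) v) (m + n - T * i) f = 0 ∧
        ((-1 : ℂ) ^ i * binom l i) • (Y' u (m + T * l - T * i) (Y' v (n + T * i) f) -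
          (-1 : ℂ) ^ l • Y' v (n + T * l - T * i) (Y' u (m + T * i) f)) = 0 := by
      intro u v
      obtain ⟨N₁, h₁⟩ := hA.truncation u v
      obtain ⟨N₂, h₂⟩ := htr u f
      obtain ⟨N₃, h₃⟩ := htr v f
      have hTi : ∀ (a : ℤ) (i : ℕ), a ≤ i → a ≤ T * i := by
        intro a i h
        have hT := hg.pos
        have : (1 : ℤ) * i ≤ T * i := mul_le_mul_of_nonneg_right (by omega) (by omega)
        omega
      refine ⟨(N₁ - l).toNat + (N₂ - m).toNat + (N₃ - n).toNat, fun i hi => ⟨?_, ?_⟩⟩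
      · rw [h₁ _ (by omega)]
        simp
      · have e1 := hTi (N₂ - m) i (by omega)
        have e2 := hTi (N₃ - n) i (by omega)
        rw [h₂ _ (by omega), h₃ _ (by omega)]
        simp
    -- With finite sums up to every large `N` the identity is additive in `u` and `v`, unlike with
    -- `finsum`, where finiteness would have to be carried along.
    set P : V → V → Prop := fun u v => ∃ N₀ : ℕ, ∀ N, N₀ ≤ N →
      ∑ i ∈ Finset.range N, binom ((m : ℂ) / T) i • Y' (A.Y u (l + i) v) (m + n - T * i) f =
      ∑ i ∈ Finset.range N, ((-1 : ℂ) ^ i * binom l i) •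
        (Y' u (m + T * l - T * i) (Y' v (n + T * i) f) -
          (-1 : ℂ) ^ l • Y' v (n + T * l - T * i) (Y' u (m + T * i) f)) with hP
    suffices hPuv : P u v by
      obtain ⟨N₀, hN₀⟩ := hrange u v
      obtain ⟨N₁, hN₁⟩ := hPuv
      rw [finsum_eq_sum_range (N := max N₀ N₁) fun i hi =>
          (hN₀ i ((le_max_left _ _).trans hi)).1,
        finsum_eq_sum_range (N := max N₀ N₁) fun i hi =>
          (hN₀ i ((le_max_left _ _).trans hi)).2]
      exact hN₁ _ (le_max_right _ _)
    have hbase : ∀ h h' : ℤ, ∀ u v : V, u ∈ A.wt h → v ∈ A.wt h' →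
        g u = Complex.exp (2 * Real.pi * Complex.I * (-r : ℤ) / T) • u → P u v := by
      intro h h' u v hu hv hgu
      obtain ⟨N₀, hN₀⟩ := hrange u v
      refine ⟨N₀, fun N hN => Subtype.ext (LinearMap.ext fun w => ?_)⟩
      obtain ⟨N₁, hN₁⟩ := exists_contragredient_jacobi_sum hw hA hg hS hu hv hgu w l m n hm
      have e := congrArg (f : Module.Dual ℂ M) (hN₁ (max N N₁) (le_max_right _ _))
      rw [← sum_range_eq_of_le (fun i hi => (hN₀ i (hN.trans hi)).1) (le_max_left N N₁),
        ← sum_range_eq_of_le (fun i hi => (hN₀ i (hN.trans hi)).2) (le_max_left N N₁)]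
      simpa only [map_sum, map_smul, map_sub, AddSubmonoidClass.coe_finsetSum,
        LinearMap.sum_apply, Submodule.coe_smul, LinearMap.smul_apply, hY',
        AddSubgroupClass.coe_sub, LinearMap.sub_apply] using e
    have hadd₂ : ∀ u v v', P u v → P u v' → P u (v + v') := by
      rintro u v v' ⟨N₀, h₀⟩ ⟨N₁, h₁⟩
      refine ⟨max N₀ N₁, fun N hN => ?_⟩
      have e0 := h₀ N ((le_max_left _ _).trans hN)
      have e1 := h₁ N ((le_max_right _ _).trans hN)
      have := congrArg₂ (· + ·) e0 e1
      simp only [← Finset.sum_add_distrib, ← smul_add] at this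
      simp only [map_add, Pi.add_apply, LinearMap.add_apply]
      rw [this]
      refine Finset.sum_congr rfl fun i _ => ?_
      module
    have hadd₁ : ∀ u u' v, P u v → P u' v → P (u + u') v := by
      rintro u v v' ⟨N₀, h₀⟩ ⟨N₁, h₁⟩
      refine ⟨max N₀ N₁, fun N hN => ?_⟩
      have e0 := h₀ N ((le_max_left _ _).trans hN)
      have e1 := h₁ N ((le_max_right _ _).trans hN)
      have := congrArg₂ (· + ·) e0 e1
      simp only [← Finset.sum_add_distrib, ← smul_add] at this
      simp only [map_add, Pi.add_apply, LinearMap.add_apply]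
      rw [this]
      refine Finset.sum_congr rfl fun i _ => ?_
      module
    have hu' := heig r u hu
    clear hu
    induction hu' using Submodule.iSup_induction' with
    | mem h u hu =>
      obtain ⟨hun, huk⟩ := hu
      have hgu : g u = Complex.exp (2 * Real.pi * Complex.I * (-r : ℤ) / T) • u := by
        simpa [sub_eq_zero] using huk
      have hv : v ∈ ⨆ n, A.wt n := hA.graded ▸ trivial
      induction hv using Submodule.iSup_induction' with
      | mem h' v hv => exact hbase h h' u v hun hv hgu
      | zero => exact ⟨0, fun N _ => by simp⟩
      | add v v' _ _ ih ih' => exact hadd₂ u v v' ih ih'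
    | zero => exact ⟨0, fun N _ => by simp⟩
    | add u u' _ _ ih ih' => exact hadd₁ u u' v ih ih'

/-- The contragredient module of a `g`-twisted module exists, and is a `g⁻¹`-twisted module. -/
theorem exists_isContragredient (hY : IsTwistedModule A g T Y)
    (hA : A.IsConformal) (hg : IsConformalAut A g T) (hgg' : ∀ v, g (g' v) = v)
    {D : Submodule ℂ (Module.Dual ℂ M)} (hD : D = restrictedDual (Y A.conf T)) :
    ∃ Y' : V →ₗ[ℂ] (ℤ → Module.End ℂ D), IsContragredient A T Y D Y' ∧
      IsTwistedModule A g' T Y' := by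
  subst hD
  obtain ⟨S, hS⟩ := exists_contragredientMap hA T Y
  obtain ⟨Y', hY'⟩ := exists_contragredient_modes hY.toIsWeakTwistedModule hA hg hS
  have hconf : ∀ (f : restrictedDual (Y A.conf T)) (w : M),
      (Y' A.conf T f : Module.Dual ℂ M) w = (f : Module.Dual ℂ M) (Y A.conf T w) := by
    intro f w
    rw [hY', hS 2 _ hA.conf_mem, contragredientMode_conf hA]
  -- Because `L(0)` on the dual is the transpose, its `μ`-eigenvectors are the functionals supported
  -- on the `μ`-eigenspace of `M`.
  have hvan : ∀ (μ ν : ℂ) (f : restrictedDual (Y A.conf T)) (w : M),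
      f ∈ Module.End.eigenspace (Y' A.conf T) μ → w ∈ Module.End.eigenspace (Y A.conf T) ν →
      μ ≠ ν → (f : Module.Dual ℂ M) w = 0 := by
    intro μ ν f w hf hw hne
    rw [Module.End.mem_eigenspace_iff] at hf hw
    have h1 := hconf f w
    rw [hf, hw, map_smul, Submodule.coe_smul, LinearMap.smul_apply, ← sub_eq_zero, ← sub_smul] at h1
    exact (smul_eq_zero.mp h1).resolve_left (sub_ne_zero.mpr hne)
  have hind : iSupIndep fun μ : ℂ => Module.End.eigenspace (Y A.conf T) μ :=
    Module.End.eigenspaces_iSupIndep _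
  refine ⟨Y', ⟨rfl, fun n v hv p f w => by rw [hY', hS n v hv]⟩,
    contragredient_isWeakTwistedModule hY hA hg hgg' hS hY', ?_, ?_, ?_⟩
  · rw [eq_top_iff]
    intro f _
    classical
    choose π hπ using fun μ : ℂ => exists_linearMap_of_iSup_eq_top hind hY.graded
      (fun ν => if ν = μ then (Module.End.eigenspace (Y A.conf T) ν).subtype else 0)
    have hπ1 : ∀ μ, ∀ w ∈ Module.End.eigenspace (Y A.conf T) μ, π μ w = w := fun μ w hw => by
      simpa using hπ μ μ ⟨w, hw⟩
    have hπ0 : ∀ μ ν, ν ≠ μ → ∀ w ∈ Module.End.eigenspace (Y A.conf T) ν, π μ w = 0 :=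
      fun μ ν hne w hw => by simpa [hne] using hπ μ ν ⟨w, hw⟩
    have hfin : {μ : ℂ | ∃ w ∈ Module.End.eigenspace (Y A.conf T) μ,
      (f : Module.Dual ℂ M) w ≠ 0}.Finite := f.2
    have hmem : ∀ μ, (f : Module.Dual ℂ M) ∘ₗ π μ ∈ restrictedDual (Y A.conf T) := by
      intro μ
      refine (Set.finite_singleton μ).subset ?_
      rintro ν ⟨w, hw, hne⟩
      by_contra h
      rw [LinearMap.comp_apply, hπ0 μ ν h w hw, map_zero] at hne
      exact hne rfl
    have hsum : f = ∑ μ ∈ hfin.toFinset, ⟨(f : Module.Dual ℂ M) ∘ₗ π μ, hmem μ⟩ := by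
      refine Subtype.ext (linearMap_ext_of_iSup_eq_top hY.graded fun ν w hw => ?_)
      rw [AddSubmonoidClass.coe_finsetSum, LinearMap.sum_apply]
      by_cases hν : ν ∈ hfin.toFinset
      · rw [Finset.sum_eq_single ν]
        · rw [LinearMap.comp_apply, hπ1 ν w hw]
        · intro μ _ hne
          rw [LinearMap.comp_apply, hπ0 μ ν hne.symm w hw, map_zero]
        · exact fun h => absurd hν h
      · rw [Finset.sum_eq_zero]
        · by_contra hne
          exact hν (hfin.mem_toFinset.mpr ⟨w, hw, hne⟩)
        · intro μ hμ
          rw [LinearMap.comp_apply, hπ0 μ ν (fun h => hν (h ▸ hμ)) w hw, map_zero]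
    rw [hsum]
    refine Submodule.sum_mem _ fun μ _ => Submodule.mem_iSup_of_mem μ ?_
    rw [Module.End.mem_eigenspace_iff]
    refine Subtype.ext (linearMap_ext_of_iSup_eq_top hY.graded fun ν w hw => ?_)
    rw [hconf, Submodule.coe_smul, LinearMap.smul_apply, Module.End.mem_eigenspace_iff.mp hw]
    by_cases h : ν = μ
    · rw [h, map_smul]
    · simp only [LinearMap.comp_apply]
      rw [map_smul, hπ0 μ ν h w hw, smul_zero, map_zero, smul_zero]
  · intro μ
    have := hY.finite μ
    let φ : Module.End.eigenspace (Y' A.conf T) μ →ₗ[ℂ]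
        Module.Dual ℂ (Module.End.eigenspace (Y A.conf T) μ) :=
      (Module.End.eigenspace (Y A.conf T) μ).subtype.dualMap ∘ₗ
        (restrictedDual (Y A.conf T)).subtype ∘ₗ
          (Module.End.eigenspace (Y' A.conf T) μ).subtype
    refine Module.Finite.of_injective φ fun f f' hff => ?_
    refine Subtype.ext (Subtype.ext (linearMap_ext_of_iSup_eq_top hY.graded fun ν w hw => ?_))
    by_cases h : μ = ν
    · subst h
      exact LinearMap.congr_fun hff ⟨w, hw⟩
    · rw [hvan μ ν _ w f.2 hw h, hvan μ ν _ w f'.2 hw h]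
  · intro μ
    obtain ⟨N, hN⟩ := hY.lower_bound μ
    refine ⟨N, fun n hn => (Submodule.eq_bot_iff _).mpr fun f hf => ?_⟩
    refine Subtype.ext (restrictedDual_eq_zero hY.graded fun ν w hw => ?_)
    by_cases h : μ + n / T = ν
    · rw [← h, hN n hn, Submodule.mem_bot] at hw
      rw [hw, map_zero]
    · exact hvan _ ν f w hf hw h

end Contragredient

/-! ### The tensor power as a conformal vertex algebra -/

section TensorPower

variable {V : Type*} [AddCommGroup V] [Module ℂ V]

theorem tensor_ext {k : ℕ} {N : Type*} [AddCommGroup N] [Module ℂ N]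
    {f g : (⨂[ℂ] _ : Fin k, V) →ₗ[ℂ] N}
    (h : ∀ v, f (PiTensorProduct.tprod ℂ v) = g (PiTensorProduct.tprod ℂ v)) : f = g :=
  PiTensorProduct.ext (MultilinearMap.ext h)

/-- The operator `∑ᵢ 1 ⊗ ⋯ ⊗ φ ⊗ ⋯ ⊗ 1`. -/
noncomputable def sumOp (k : ℕ) (φ : Module.End ℂ V) : Module.End ℂ (⨂[ℂ] _ : Fin k, V) :=
  ∑ i, PiTensorProduct.map (Function.update (fun _ => LinearMap.id) i φ)

theorem map_update_tprod {k : ℕ} (i : Fin k) (φ : Module.End ℂ V) (v : Fin k → V) :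
    PiTensorProduct.map (Function.update (fun _ => LinearMap.id) i φ)
      (PiTensorProduct.tprod ℂ v) = PiTensorProduct.tprod ℂ (Function.update v i (φ (v i))) := by
  rw [PiTensorProduct.map_tprod]
  congr 1
  ext1 j
  by_cases h : j = i
  · subst h
    simp
  · simp [h]

theorem sumOp_tprod {k : ℕ} (φ : Module.End ℂ V) (v : Fin k → V) :
    sumOp k φ (PiTensorProduct.tprod ℂ v) =
      ∑ i, PiTensorProduct.tprod ℂ (Function.update v i (φ (v i))) := by
  simp only [sumOp, LinearMap.sum_apply, map_update_tprod]

variable (A : VOA V) (k : ℕ)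

theorem tensorPower_Y_apply (u v : ⨂[ℂ] _ : Fin k, V) (p : ℤ) :
    (tensorPower A k).Y u p v =
      ∑ᶠ n : {n : Fin k → ℤ // ∑ i, (n i + 1) = p + 1}, multiMode A k n.1 u v := rfl

/-- The vacuum has only the mode `-1`, so a single multi-index survives. -/
theorem tensorPower_inPosition (i : Fin k) (u : V) (p : ℤ) :
    (tensorPower A k).Y (inPosition A k i u) p =
      PiTensorProduct.map (Function.update (fun _ => LinearMap.id) i (A.Y u p)) := by
  refine tensor_ext fun v => ?_
  have hsum : ∀ q : ℤ, ∑ j, ((Function.update (fun _ => -1) i q : Fin k → ℤ) j + 1) = q + 1 := by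
    intro q
    rw [Finset.sum_eq_single i]
    · simp
    · intro j _ hj
      simp [hj]
    · simp
  have hvac : ∀ q : ℤ, A.Y A.vac q = if q = -1 then 1 else 0 := fun q => by
    simpa using A.adjoint.vacuum q
  rw [tensorPower_Y_apply, finsum_eq_single _ ⟨Function.update (fun _ => -1) i p, hsum p⟩,
    inPosition, multiMode_tprod, map_update_tprod]
  · congr 1
    ext1 j
    by_cases h : j = i
    · subst h
      simp
    · simp [h, hvac]
  · rintro ⟨n, hn⟩ hne
    obtain ⟨j, hji, hj⟩ : ∃ j, j ≠ i ∧ n j ≠ -1 := by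
      by_contra hc
      push Not at hc
      refine hne (Subtype.ext (funext fun j => ?_))
      have h1 : n = Function.update (fun _ => -1) i (n i) := by
        ext1 j
        by_cases h : j = i
        · subst h
          simp
        · simp [h, hc j h]
      rw [h1, hsum] at hn
      show n j = _
      rw [h1, show n i = p by omega]
    rw [inPosition, multiMode_tprod]
    refine MultilinearMap.map_coord_zero _ j ?_
    simp [hji, hvac, hj]

theorem tensorPower_L (n : ℤ) : (tensorPower A k).L n = sumOp k (A.L n) := by
  have : (tensorPower A k).conf = ∑ i, inPosition A k i A.conf := rfl
  rw [VertexData.L, this, map_sum, Finset.sum_apply, sumOp]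
  exact Finset.sum_congr rfl fun i _ => tensorPower_inPosition A k i A.conf (n + 1)

theorem sumOp_inPosition (φ : Module.End ℂ V) (hφ : φ A.vac = 0) (i : Fin k) (u : V) :
    sumOp k φ (inPosition A k i u) = inPosition A k i (φ u) := by
  rw [inPosition, sumOp_tprod, Finset.sum_eq_single i]
  · simp [inPosition]
  · intro j _ hj
    refine MultilinearMap.map_coord_zero _ j ?_
    simp [hj, hφ]
  · simp

variable {A k}

/-- Commutators with modes, on the tensor power. -/
theorem sumOp_mode {D D₁ D₂ : Module.End ℂ V} {e : ℤ}
    (h : ∀ (v : V) (p : ℤ) (x : V), D (A.Y v p x) = A.Y (D₁ v) p x + A.Y v p (D x) +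
      A.Y (D₂ v) (p + e) x - ((p : ℂ) + 1 + e) • A.Y v (p + e) x)
    (u : ⨂[ℂ] _ : Fin k, V) (p : ℤ) (v : ⨂[ℂ] _ : Fin k, V) :
    sumOp k D ((tensorPower A k).Y u p v) = (tensorPower A k).Y (sumOp k D₁ u) p v +
      (tensorPower A k).Y u p (sumOp k D v) + (tensorPower A k).Y (sumOp k D₂ u) (p + e) v -
      ((p : ℂ) + 1 + e) • (tensorPower A k).Y u (p + e) v := by
  induction u using PiTensorProduct.induction_on with
  | add x y hx hy =>
    simp only [map_add, Pi.add_apply, LinearMap.add_apply, hx, hy]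
    module
  | smul_tprod r u =>
    simp only [map_smul, Pi.smul_apply, LinearMap.smul_apply]
    induction v using PiTensorProduct.induction_on with
    | add x y hx hy =>
      simp only [map_add, smul_add] at hx hy ⊢
      rw [hx, hy]
      module
    | smul_tprod r' v =>
      simp only [map_smul]
      set F : (Fin k → ℤ) → (Fin k → V) → (Fin k → V) → ⨂[ℂ] _ : Fin k, V := fun n u v =>
        multiMode A k n (PiTensorProduct.tprod ℂ u) (PiTensorProduct.tprod ℂ v) with hF
      have hFt : ∀ n u v, F n u v = PiTensorProduct.tprod ℂ (fun i => A.Y (u i) (n i) (v i)) :=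
        fun n u v => multiMode_tprod A k n u v
      have hY : ∀ q u v, (tensorPower A k).Y (PiTensorProduct.tprod ℂ u) q
          (PiTensorProduct.tprod ℂ v) =
          ∑ᶠ n : {n : Fin k → ℤ // ∑ i, (n i + 1) = q + 1}, F n.1 u v := fun q u v => rfl
      have hfin : ∀ s u v, (Function.support fun n : {n : Fin k → ℤ // ∑ i, (n i + 1) = s} =>
          F n.1 u v).Finite := fun s u v => multiMode_finite A k s _ _
      have hsh : ∀ (i : Fin k) (n : Fin k → ℤ) (c : ℤ),
          ∑ j, (Function.update n i (n i + c) j + 1) = ∑ j, (n j + 1) + c := by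
        intro i n c
        rw [← Finset.add_sum_erase _ _ (Finset.mem_univ i),
          ← Finset.add_sum_erase _ (fun j => n j + 1) (Finset.mem_univ i),
          Function.update_self, Finset.sum_congr rfl fun j hj => by
            rw [Function.update_of_ne (Finset.ne_of_mem_erase hj)]]
        ring
      -- Terms in which the `i`-th mode index is raised by `e` are reindexed so that they are summed
      -- over the same multi-indices as the mode `p + e`.
      let σ : Fin k → ({n : Fin k → ℤ // ∑ i, (n i + 1) = p + 1} ≃
          {n : Fin k → ℤ // ∑ i, (n i + 1) = p + e + 1}) := fun i =>
        { toFun := fun n => ⟨Function.update n.1 i (n.1 i + e), by rw [hsh, n.2]; ring⟩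
          invFun := fun n => ⟨Function.update n.1 i (n.1 i + -e), by rw [hsh, n.2]; ring⟩
          left_inv := fun n => Subtype.ext (by simp)
          right_inv := fun n => Subtype.ext (by simp) }
      have hstep : ∀ n : {n : Fin k → ℤ // ∑ i, (n i + 1) = p + 1},
          sumOp k D (F n.1 u v) = ∑ i, (F n.1 (Function.update u i (D₁ (u i))) v +
            F n.1 u (Function.update v i (D (v i))) +
            F (σ i n).1 (Function.update u i (D₂ (u i))) v -
            (((σ i n).1 i : ℂ) + 1) • F (σ i n).1 u v) := by
        intro n
        rw [hFt, sumOp_tprod]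
        refine Finset.sum_congr rfl fun i _ => ?_
        have hupd : ∀ (m : Fin k → ℤ) (u' v' : Fin k → V), (∀ j, j ≠ i → m j = n.1 j) →
            (∀ j, j ≠ i → u' j = u j) → (∀ j, j ≠ i → v' j = v j) →
            F m u' v' = PiTensorProduct.tprod ℂ (Function.update
              (fun j => A.Y (u j) (n.1 j) (v j)) i (A.Y (u' i) (m i) (v' i))) := by
          intro m u' v' h1 h2 h3
          rw [hFt]
          congr 1
          ext1 j
          by_cases hj : j = i
          · subst hj
            simp
          · simp [hj, h1 j hj, h2 j hj, h3 j hj]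
        have hσi : (σ i n).1 i = n.1 i + e := by simp [σ]
        have hσj : ∀ j, j ≠ i → (σ i n).1 j = n.1 j := fun j hj => by simp [σ, hj]
        rw [hupd n.1 (Function.update u i (D₁ (u i))) v (fun _ _ => rfl)
            (fun j hj => by simp [hj]) (fun _ _ => rfl),
          hupd n.1 u (Function.update v i (D (v i))) (fun _ _ => rfl) (fun _ _ => rfl)
            (fun j hj => by simp [hj]),
          hupd (σ i n).1 (Function.update u i (D₂ (u i))) v hσj
            (fun j hj => by simp [hj]) (fun _ _ => rfl),
          hupd (σ i n).1 u v hσj (fun _ _ => rfl) (fun _ _ => rfl), hσi, h]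
        simp only [Function.update_self, MultilinearMap.map_update_add,
          MultilinearMap.map_update_sub, MultilinearMap.map_update_smul]
        push_cast
        rw [show (n.1 i : ℂ) + 1 + e = n.1 i + e + 1 by ring]
      have f1 : ∀ i, (Function.support fun n : {n : Fin k → ℤ // ∑ i, (n i + 1) = p + 1} =>
          F (σ i n).1 (Function.update u i (D₂ (u i))) v).Finite := fun i =>
        (hfin _ (Function.update u i (D₂ (u i))) v).preimage (σ i).injective.injOn
      have f2 : ∀ i, (Function.support fun n : {n : Fin k → ℤ // ∑ i, (n i + 1) = p + e + 1} =>
          ((n.1 i : ℂ) + 1) • F n.1 u v).Finite := fun i =>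
        (hfin _ u v).subset fun n hn h0 => hn (by
          have h0 : F n.1 u v = 0 := h0
          simp only [h0, smul_zero])
      have f3 : ∀ i, (Function.support fun n : {n : Fin k → ℤ // ∑ i, (n i + 1) = p + 1} =>
          (((σ i n).1 i : ℂ) + 1) • F (σ i n).1 u v).Finite := fun i =>
        (f2 i).preimage (σ i).injective.injOn
      have key : sumOp k D (∑ᶠ n : {n : Fin k → ℤ // ∑ i, (n i + 1) = p + 1}, F n.1 u v) =
          ∑ i, (∑ᶠ n : {n : Fin k → ℤ // ∑ i, (n i + 1) = p + 1},
              F n.1 (Function.update u i (D₁ (u i))) v +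
            ∑ᶠ n : {n : Fin k → ℤ // ∑ i, (n i + 1) = p + 1},
              F n.1 u (Function.update v i (D (v i))) +
            ∑ᶠ n : {n : Fin k → ℤ // ∑ i, (n i + 1) = p + e + 1},
              F n.1 (Function.update u i (D₂ (u i))) v -
            ∑ᶠ n : {n : Fin k → ℤ // ∑ i, (n i + 1) = p + e + 1},
              ((n.1 i : ℂ) + 1) • F n.1 u v) := by
        rw [map_finsum _ (hfin _ u v), finsum_congr hstep, finsum_sum_comm]
        · refine Finset.sum_congr rfl fun i _ => ?_
          have g1 := hfin (p + 1) (Function.update u i (D₁ (u i))) v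
          have g2 := hfin (p + 1) u (Function.update v i (D (v i)))
          rw [finsum_sub_distrib (((g1.union g2).union (f1 i)).subset ?_) (f3 i),
            finsum_add_distrib ((g1.union g2).subset ?_) (f1 i), finsum_add_distrib g1 g2]
          · congr 1
            · congr 1
              exact finsum_comp_equiv (σ i)
                (f := fun n => F n.1 (Function.update u i (D₂ (u i))) v)
            · exact finsum_comp_equiv (σ i) (f := fun n => ((n.1 i : ℂ) + 1) • F n.1 u v)
          · exact Function.support_add _ _
          · exact (Function.support_add _ _).trans
              (Set.union_subset_union_left _ (Function.support_add _ _))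
        · intro i _
          have g1 := hfin (p + 1) (Function.update u i (D₁ (u i))) v
          have g2 := hfin (p + 1) u (Function.update v i (D (v i)))
          refine (((g1.union g2).union (f1 i)).union (f3 i)).subset ?_
          exact (Function.support_sub _ _).trans (Set.union_subset_union_left _
            ((Function.support_add _ _).trans
              (Set.union_subset_union_left _ (Function.support_add _ _))))
      -- The scalars `n i + 1` add up over `i` to `p + e + 1`, so the factorwise corrections combine
      -- to the correction for the whole tensor. This is why the hypothesis is written with `p + 1 +
      -- e`.
      have hlast : ∑ i, ∑ᶠ n : {n : Fin k → ℤ // ∑ i, (n i + 1) = p + e + 1},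
          ((n.1 i : ℂ) + 1) • F n.1 u v = ((p : ℂ) + 1 + e) •
          ∑ᶠ n : {n : Fin k → ℤ // ∑ i, (n i + 1) = p + e + 1}, F n.1 u v := by
        rw [← finsum_sum_comm _ _ fun i _ => f2 i, smul_finsum' _ (hfin _ u v)]
        refine finsum_congr fun n => ?_
        rw [← Finset.sum_smul]
        congr 1
        have := congrArg (Int.cast : ℤ → ℂ) n.2
        push_cast at this
        rw [this]
        ring
      rw [hY, hY, key, sumOp_tprod, sumOp_tprod, sumOp_tprod]
      simp only [map_sum, Finset.sum_apply, LinearMap.sum_apply, hY, Finset.sum_add_distrib,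
        Finset.sum_sub_distrib, hlast, smul_add, smul_sub]
      rw [smul_comm r' ((p : ℂ) + 1 + e), smul_comm r ((p : ℂ) + 1 + e)]

theorem VOA.commutator_L (m : ℕ) (hm : m ≤ 2) (v : V) (p : ℤ) (x : V) :
    A.L (m - 1) (A.Y v p x) = A.Y v p (A.L (m - 1) x) + -(m + p : ℂ) • A.Y v (m + p - 1) x +
      (m : ℂ) • A.Y (A.L 0 v) (m + p - 1) x + binom m 2 • A.Y (A.L 1 v) (m + p - 2) x := by
  have hbinom : ∀ i, m < i → binom (m : ℂ) i = 0 := by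
    intro i hi
    rw [binom, Finset.prod_eq_zero (Finset.mem_range.mpr hi) (sub_self _), zero_div]
  have := VOA.commutator A.adjoint A.conf v m p x
  rw [finsum_eq_sum_range (N := 3)] at this
  · simp only [Finset.sum_range_succ, Finset.sum_range_zero, Int.cast_natCast, binom_zero_right,
      binom_one_right, one_smul, zero_add, Nat.cast_zero, Nat.cast_one, sub_zero,
      Nat.cast_ofNat] at this
    have e0 : A.Y A.conf 0 v = A.L (-1) v := rfl
    have e1 : A.Y A.conf 1 v = A.L 0 v := rfl
    have e2 : A.Y A.conf 2 v = A.L 1 v := rfl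
    have e3 : A.Y A.conf m = A.L (m - 1) := by rw [VertexData.L, sub_add_cancel]
    rw [e0, e1, e2, e3, A.derivative, LinearMap.smul_apply] at this
    rw [eq_sub_iff_add_eq] at this
    rw [← this]
    push_cast
    module
  · intro j hj
    rw [Int.cast_natCast, hbinom j (by omega), zero_smul]

theorem sumOp_zero : sumOp k (0 : Module.End ℂ V) = 0 :=
  tensor_ext fun v => by
    rw [sumOp_tprod]
    exact Finset.sum_eq_zero fun i _ => MultilinearMap.map_update_zero _ _ _

variable (A k)

theorem tensorPower_commutator_L_neg_one (u : ⨂[ℂ] _ : Fin k, V) (p : ℤ) (v : ⨂[ℂ] _ : Fin k, V) :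
    (tensorPower A k).L (-1) ((tensorPower A k).Y u p v) =
      (tensorPower A k).Y u p ((tensorPower A k).L (-1) v) -
        (p : ℂ) • (tensorPower A k).Y u (p - 1) v := by
  have := sumOp_mode (A := A) (k := k) (D := A.L (-1)) (D₁ := 0) (D₂ := 0) (e := -1) (fun v p x => by
    have := VOA.commutator_L (A := A) 0 (by omega) v p x
    have b : binom 0 2 = 0 := by norm_num [binom, Finset.prod_range_succ]
    simp only [Nat.cast_zero, zero_sub, zero_add, b, zero_smul, add_zero] at this
    rw [this, ← sub_eq_add_neg p 1]
    simp
    module) u p v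
  rw [tensorPower_L, this, ← sub_eq_add_neg p 1, sumOp_zero]
  simp

theorem tensorPower_commutator_L_zero (u : ⨂[ℂ] _ : Fin k, V) (p : ℤ) (v : ⨂[ℂ] _ : Fin k, V) :
    (tensorPower A k).L 0 ((tensorPower A k).Y u p v) =
      (tensorPower A k).Y ((tensorPower A k).L 0 u) p v +
      (tensorPower A k).Y u p ((tensorPower A k).L 0 v) -
        ((p : ℂ) + 1) • (tensorPower A k).Y u p v := by
  have := sumOp_mode (A := A) (k := k) (D := A.L 0) (D₁ := A.L 0) (D₂ := 0) (e := 0)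
    (fun v p x => by
      have := VOA.commutator_L (A := A) 1 (by omega) v p x
      have b : binom 1 2 = 0 := by norm_num [binom, Finset.prod_range_succ]
      simp only [Nat.cast_one, sub_self, b, zero_smul, add_zero, add_sub_cancel_left,
        one_smul] at this
      rw [this]
      simp
      module) u p v
  rw [tensorPower_L, this, sumOp_zero]
  simp

theorem tensorPower_commutator_L_one (u : ⨂[ℂ] _ : Fin k, V) (p : ℤ) (v : ⨂[ℂ] _ : Fin k, V) :
    (tensorPower A k).L 1 ((tensorPower A k).Y u p v) =
      (tensorPower A k).Y ((tensorPower A k).L 1 u) p v +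
      (tensorPower A k).Y u p ((tensorPower A k).L 1 v) +
      (2 : ℂ) • (tensorPower A k).Y ((tensorPower A k).L 0 u) (p + 1) v -
        ((p : ℂ) + 2) • (tensorPower A k).Y u (p + 1) v := by
  have := sumOp_mode (A := A) (k := k) (D := A.L 1) (D₁ := A.L 1) (D₂ := (2 : ℂ) • A.L 0) (e := 1)
    (fun v p x => by
      have := VOA.commutator_L (A := A) 2 le_rfl v p x
      have b : binom 2 2 = 1 := by norm_num [binom, Finset.prod_range_succ]
      simp only [Nat.cast_ofNat, b, one_smul, add_sub_cancel_left] at this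
      rw [show (2 : ℤ) - 1 = 1 by norm_num, show 2 + p - 1 = p + 1 by ring] at this
      rw [this]
      simp only [LinearMap.smul_apply, map_smul, Pi.smul_apply]
      push_cast
      module) u p v
  have h2 : sumOp k ((2 : ℂ) • A.L 0) = (2 : ℂ) • sumOp k (A.L 0) := by
    refine tensor_ext fun v => ?_
    simp [sumOp_tprod, Finset.smul_sum]
  rw [tensorPower_L, this, tensorPower_L, h2]
  simp only [LinearMap.smul_apply, map_smul, Pi.smul_apply]
  push_cast
  module

theorem tprod_mem_wt {v : Fin k → V} {h : Fin k → ℤ} (hv : ∀ i, v i ∈ A.wt (h i)) :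
    PiTensorProduct.tprod ℂ v ∈ (tensorPower A k).wt (∑ i, h i) := by
  rw [VertexData.mem_wt_iff, tensorPower_L, sumOp_tprod]
  push_cast
  rw [Finset.sum_smul]
  refine Finset.sum_congr rfl fun i _ => ?_
  rw [VertexData.mem_wt_iff.mp (hv i), MultilinearMap.map_update_smul, Function.update_eq_self]

/-- Pure tensors of homogeneous vectors span, and such a tensor is zero unless every factor has
weight at least `B`, so weights below `k * B` are not needed. -/
theorem exists_iSup_wt_eq_top :
    ∃ N : ℤ, ⨆ n : {n : ℤ // N ≤ n}, (tensorPower A k).wt n = ⊤ := by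
  obtain ⟨B, hB⟩ := A.lower_bound
  refine ⟨k * B, ?_⟩
  set G := ⨆ n : {n : ℤ // k * B ≤ n}, (tensorPower A k).wt n with hG
  -- Induction on the set of positions that are not yet homogeneous, decomposing one of them at a
  -- time.
  have hhom : ∀ s : Finset (Fin k), ∀ v : Fin k → V, (∀ i, i ∉ s → ∃ h, v i ∈ A.wt h) →
      PiTensorProduct.tprod ℂ v ∈ G := by
    intro s
    induction s using Finset.induction_on with
    | empty =>
      intro v hv
      choose h hh using fun i => hv i (Finset.notMem_empty i)
      by_cases hlt : ∃ i, h i < B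
      · obtain ⟨i, hi⟩ := hlt
        have h0 := hh i
        rw [hB _ hi, Submodule.mem_bot] at h0
        rw [MultilinearMap.map_coord_zero _ i h0]
        exact Submodule.zero_mem _
      · push Not at hlt
        have hle : k * B ≤ ∑ i, h i := by
          have := Finset.sum_le_sum fun i (_ : i ∈ Finset.univ) => hlt i
          simpa using this
        exact Submodule.mem_iSup_of_mem (⟨_, hle⟩ : {n : ℤ // k * B ≤ n}) (tprod_mem_wt A k hh)
    | insert i s hi ih =>
      intro v hv
      have key : ∀ x : V, PiTensorProduct.tprod ℂ (Function.update v i x) ∈ G := by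
        intro x
        have hx : x ∈ ⨆ n, A.wt n := A.graded ▸ trivial
        induction hx using Submodule.iSup_induction' with
        | mem n x hx =>
          refine ih _ fun j hj => ?_
          by_cases hji : j = i
          · subst hji
            exact ⟨n, by simpa using hx⟩
          · obtain ⟨h, hh⟩ := hv j (by simp [hji, hj])
            exact ⟨h, by simpa [hji] using hh⟩
        | zero =>
          rw [MultilinearMap.map_update_zero]
          exact Submodule.zero_mem _
        | add x y _ _ hx hy =>
          rw [MultilinearMap.map_update_add]
          exact Submodule.add_mem _ hx hy
      have := key (v i)
      rwa [Function.update_eq_self] at this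
  rw [eq_top_iff]
  intro x _
  induction x using PiTensorProduct.induction_on with
  | smul_tprod r v =>
    exact Submodule.smul_mem _ _ (hhom Finset.univ v fun i hi => absurd (Finset.mem_univ i) hi)
  | add x y hx hy => exact Submodule.add_mem _ (hx trivial) (hy trivial)

theorem tensorPower_truncation (u v : ⨂[ℂ] _ : Fin k, V) :
    ∃ N : ℤ, ∀ p : ℤ, N ≤ p → (tensorPower A k).Y u p v = 0 := by
  induction u using PiTensorProduct.induction_on with
  | add x y hx hy =>
    obtain ⟨N, hN⟩ := hx
    obtain ⟨N', hN'⟩ := hy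
    refine ⟨max N N', fun p hp => ?_⟩
    rw [map_add, Pi.add_apply, LinearMap.add_apply, hN p (le_of_max_le_left hp),
      hN' p (le_of_max_le_right hp), add_zero]
  | smul_tprod r u =>
    induction v using PiTensorProduct.induction_on with
    | add x y hx hy =>
      obtain ⟨N, hN⟩ := hx
      obtain ⟨N', hN'⟩ := hy
      refine ⟨max N N', fun p hp => ?_⟩
      rw [map_add, hN p (le_of_max_le_left hp), hN' p (le_of_max_le_right hp), add_zero]
    | smul_tprod r' v =>
      choose N hN using fun i => A.adjoint.truncation (u i) (v i)
      refine ⟨∑ i, N i, fun p hp => ?_⟩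
      have : (tensorPower A k).Y (PiTensorProduct.tprod ℂ u) p (PiTensorProduct.tprod ℂ v) = 0 := by
        rw [tensorPower_Y_apply]
        refine (finsum_congr fun n => ?_).trans finsum_zero
        obtain ⟨i, hi⟩ : ∃ i, N i ≤ n.1 i := by
          by_contra hc
          push Not at hc
          have := Finset.sum_le_sum fun i (_ : i ∈ Finset.univ) =>
            (show n.1 i + 1 ≤ N i from hc i)
          rw [n.2] at this
          omega
        rw [multiMode_tprod]
        exact MultilinearMap.map_coord_zero _ i (hN i _ hi)
      simp [this]

theorem tensorPower_creation (v : ⨂[ℂ] _ : Fin k, V) :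
    (tensorPower A k).Y v (-1) (tensorPower A k).vac = v ∧
      ∀ n : ℤ, 0 ≤ n → (tensorPower A k).Y v n (tensorPower A k).vac = 0 := by
  have hvac : (tensorPower A k).vac = PiTensorProduct.tprod ℂ (fun _ => A.vac) := rfl
  have hzero : ∀ (v : Fin k → V) (n : Fin k → ℤ) (i : Fin k), 0 ≤ n i →
      multiMode A k n (PiTensorProduct.tprod ℂ v) (PiTensorProduct.tprod ℂ fun _ => A.vac) = 0 := by
    intro v n i hi
    rw [multiMode_tprod]
    exact MultilinearMap.map_coord_zero _ i ((A.creation (v i)).2 _ hi)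
  induction v using PiTensorProduct.induction_on with
  | add x y hx hy =>
    refine ⟨?_, fun n hn => ?_⟩
    · rw [map_add, Pi.add_apply, LinearMap.add_apply, hx.1, hy.1]
    · rw [map_add, Pi.add_apply, LinearMap.add_apply, hx.2 n hn, hy.2 n hn, add_zero]
  | smul_tprod r v =>
    rw [hvac, map_smul]
    simp only [Pi.smul_apply, LinearMap.smul_apply]
    refine ⟨?_, fun p hp => ?_⟩
    · congr 1
      rw [tensorPower_Y_apply, finsum_eq_single _ ⟨fun _ => -1, by simp⟩, multiMode_tprod]
      · congr 1
        ext1 i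
        exact (A.creation (v i)).1
      · rintro ⟨n, hn⟩ hne
        obtain ⟨i, hi⟩ : ∃ i, 0 ≤ n i := by
          by_contra hc
          push Not at hc
          refine hne (Subtype.ext (funext fun i => ?_))
          have h1 : ∑ i, -(n i + 1) = 0 := by
            rw [Finset.sum_neg_distrib, hn]
            norm_num
          have := (Finset.sum_eq_zero_iff_of_nonneg fun j _ => by
            have := hc j
            omega).mp h1 i (Finset.mem_univ i)
          show n i = -1
          omega
        exact hzero v n i hi
    · rw [tensorPower_Y_apply]
      have : ∀ n : {n : Fin k → ℤ // ∑ i, (n i + 1) = p + 1}, multiMode A k n.1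
          (PiTensorProduct.tprod ℂ v) (PiTensorProduct.tprod ℂ fun _ => A.vac) = 0 := by
        intro n
        obtain ⟨i, hi⟩ : ∃ i, 0 ≤ n.1 i := by
          by_contra hc
          push Not at hc
          have := Finset.sum_nonpos fun i (_ : i ∈ Finset.univ) =>
            (show n.1 i + 1 ≤ 0 from hc i)
          rw [n.2] at this
          omega
        exact hzero v n.1 i hi
      rw [finsum_congr this, finsum_zero, smul_zero]

/-- These properties suffice for contragredients and for uniqueness; the Jacobi identity of the
tensor power itself is not used. -/
theorem tensorPower_isConformal : (tensorPower A k).IsConformal := by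
  have hA := A.isConformal
  have hcr := tensorPower_creation A k
  have hconf : (tensorPower A k).conf = ∑ i, inPosition A k i A.conf := rfl
  have hLv : ∀ n : ℤ, -1 ≤ n → A.L n A.vac = 0 := fun n hn => (A.creation A.conf).2 _ (by omega)
  have hLzero : (tensorPower A k).L 0 (tensorPower A k).conf =
      (2 : ℂ) • (tensorPower A k).conf := by
    rw [hconf, tensorPower_L, map_sum, Finset.smul_sum]
    refine Finset.sum_congr rfl fun i _ => ?_
    rw [sumOp_inPosition A k _ (hLv 0 (by omega)), VertexData.mem_wt_iff.mp hA.conf_mem,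
      inPosition, MultilinearMap.map_update_smul]
    rfl
  obtain ⟨N, hN⟩ := exists_iSup_wt_eq_top A k
  refine ⟨tensorPower_truncation A k, hcr, ?_, ?_, ?_, ?_, ?_, ?_, ?_, N, ?_⟩
  · intro v
    have h := tensorPower_commutator_L_neg_one A k v (-1) (tensorPower A k).vac
    have h0 : (tensorPower A k).L (-1) (tensorPower A k).vac = 0 := (hcr _).2 _ (by omega)
    rw [(hcr v).1, h0, map_zero] at h
    rw [h]
    norm_num
  · intro h v hv p x
    rw [tensorPower_commutator_L_zero, VertexData.mem_wt_iff.mp hv, map_smul, Pi.smul_apply,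
      LinearMap.smul_apply]
    module
  · intro h v hv p x
    rw [tensorPower_commutator_L_one, VertexData.mem_wt_iff.mp hv, map_smul, Pi.smul_apply,
      LinearMap.smul_apply]
    module
  · intro v
    -- The relation `[L(0), L(1)] = -L(1)` is the bracket of `L(0)` with the mode `ω_2`, where `ω`
    -- has weight two.
    have h := tensorPower_commutator_L_zero A k (tensorPower A k).conf 2 v
    rw [hLzero, map_smul, Pi.smul_apply, LinearMap.smul_apply] at h
    have e1 : (tensorPower A k).Y (tensorPower A k).conf 2 = (tensorPower A k).L 1 := rfl
    rw [e1] at h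
    rw [h]
    push_cast
    module
  · rw [VertexData.mem_wt_iff, hLzero]
    simp
  · rw [hconf, tensorPower_L, map_sum]
    refine Finset.sum_eq_zero fun i _ => ?_
    rw [sumOp_inPosition A k _ (hLv 1 (by omega)), hA.L_one_conf, inPosition]
    exact MultilinearMap.map_update_zero _ _ _
  · rw [eq_top_iff, ← hN]
    exact iSup_le fun n => le_iSup (tensorPower A k).wt n
  -- The weight spaces from `N` on already span, so by independence every other one is zero.
  · intro n hn
    have h1 := (tensorPower A k).wt_iSupIndep n
    have h2 : ⨆ (j : ℤ) (_ : j ≠ n), (tensorPower A k).wt j = ⊤ := by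
      rw [eq_top_iff, ← hN]
      refine iSup_le fun m => le_iSup₂_of_le (m : ℤ) ?_ le_rfl
      have := m.2
      omega
    rw [h2] at h1
    exact disjoint_top.mp h1

/-! ### Permutations of the tensor factors -/

theorem permAction_tprod (σ : Equiv.Perm (Fin k)) (v : Fin k → V) :
    permAction V σ (PiTensorProduct.tprod ℂ v) =
      PiTensorProduct.tprod ℂ (fun i => v (σ.symm i)) :=
  PiTensorProduct.reindex_tprod _ _

theorem permAction_mul (σ τ : Equiv.Perm (Fin k)) (x : ⨂[ℂ] _ : Fin k, V) :
    permAction V (σ * τ) x = permAction V σ (permAction V τ x) := by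
  have : permAction V (σ * τ) = permAction V σ ∘ₗ permAction V τ :=
    tensor_ext fun v => by
      rw [LinearMap.comp_apply, permAction_tprod, permAction_tprod, permAction_tprod]
      rfl
  rw [this]
  rfl

theorem permAction_one (x : ⨂[ℂ] _ : Fin k, V) :
    permAction V (1 : Equiv.Perm (Fin k)) x = x := by
  have : permAction V (1 : Equiv.Perm (Fin k)) = LinearMap.id :=
    tensor_ext fun v => by
      rw [permAction_tprod]
      rfl
  rw [this]
  rfl

theorem permAction_inPosition (σ : Equiv.Perm (Fin k)) (i : Fin k) (u : V) :
    permAction V σ (inPosition A k i u) = inPosition A k (σ i) u := by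
  rw [inPosition, permAction_tprod, inPosition]
  congr 1
  ext1 j
  by_cases h : j = σ i
  · subst h
    simp
  · have : σ.symm j ≠ i := fun h' => h (by rw [← h', Equiv.apply_symm_apply])
    simp [h, this]

theorem permAction_sumOp (σ : Equiv.Perm (Fin k)) (φ : Module.End ℂ V) (x : ⨂[ℂ] _ : Fin k, V) :
    permAction V σ (sumOp k φ x) = sumOp k φ (permAction V σ x) := by
  have : permAction V σ ∘ₗ sumOp k φ = sumOp k φ ∘ₗ permAction V σ := by
    refine tensor_ext fun v => ?_
    rw [LinearMap.comp_apply, LinearMap.comp_apply, permAction_tprod, sumOp_tprod, sumOp_tprod,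
      map_sum, ← Equiv.sum_comp σ (fun i => PiTensorProduct.tprod ℂ
        (Function.update (fun i => v (σ.symm i)) i (φ (v (σ.symm i)))))]
    refine Finset.sum_congr rfl fun i _ => ?_
    rw [permAction_tprod]
    congr 1
    ext1 j
    by_cases h : j = σ i
    · subst h
      simp
    · have : σ.symm j ≠ i := fun h' => h (by rw [← h', Equiv.apply_symm_apply])
      simp [h, this]
  exact LinearMap.congr_fun this x

theorem permAction_isConformalAut [NeZero k] {σ : Equiv.Perm (Fin k)} (hσ : σ ^ k = 1) :
    IsConformalAut (tensorPower A k) (permAction V σ) k where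
  pos := Nat.pos_of_ne_zero (NeZero.ne k)
  pow_eq_one := by
    have : ∀ j : ℕ, (permAction V σ : Module.End ℂ _) ^ j = permAction V (σ ^ j) := by
      intro j
      induction j with
      | zero =>
        refine LinearMap.ext fun x => ?_
        exact (permAction_one k x).symm
      | succ j ih =>
        refine LinearMap.ext fun x => ?_
        rw [pow_succ, pow_succ, permAction_mul, ih]
        rfl
    rw [this, hσ]
    exact LinearMap.ext (permAction_one k)
  conf := by
    have hconf : (tensorPower A k).conf = ∑ i, inPosition A k i A.conf := rfl
    rw [hconf, map_sum, ← Equiv.sum_comp σ (fun i => inPosition A k i A.conf)]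
    exact Finset.sum_congr rfl fun i _ => permAction_inPosition A k σ i _
  L_zero v := by rw [tensorPower_L, permAction_sumOp]
  L_one v := by rw [tensorPower_L, permAction_sumOp]

end TensorPower

/-! ### Powers of the rotation of `k` letters -/

theorem finRotate_pow_apply (n j : ℕ) (i : Fin (n + 1)) :
    ((finRotate (n + 1) ^ j) i : ℕ) = (i + j) % (n + 1) := by
  induction j with
  | zero => simp [Nat.mod_eq_of_lt i.2]
  | succ j ih =>
    rw [pow_succ', Equiv.Perm.mul_apply, finRotate_apply, Fin.val_add, ih, Fin.val_one',
      ← Nat.add_mod, add_assoc]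

theorem finRotate_pow_self (k : ℕ) [NeZero k] : finRotate k ^ k = 1 := by
  obtain ⟨n, rfl⟩ := Nat.exists_eq_succ_of_ne_zero (NeZero.ne k)
  refine Equiv.ext fun i => Fin.ext ?_
  rw [finRotate_pow_apply]
  simp [Nat.mod_eq_of_lt i.2]

theorem exists_finRotate_pow_zero (k : ℕ) [NeZero k] (i : Fin k) :
    ∃ j : ℕ, (finRotate k ^ j) 0 = i := by
  obtain ⟨n, rfl⟩ := Nat.exists_eq_succ_of_ne_zero (NeZero.ne k)
  refine ⟨i, Fin.ext ?_⟩
  rw [finRotate_pow_apply]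
  simp [Nat.mod_eq_of_lt i.2]

/-! ### Uniqueness of twisted modules -/

section Uniqueness

variable {V M : Type*} [AddCommGroup V] [Module ℂ V] [AddCommGroup M] [Module ℂ M]

theorem exp_eq_of_modEq {T : ℕ} (hT : 0 < T) {p r : ℤ} (h : p ≡ r [ZMOD T]) :
    Complex.exp (2 * Real.pi * Complex.I * p / T) =
      Complex.exp (2 * Real.pi * Complex.I * r / T) := by
  obtain ⟨c, hc⟩ := Int.modEq_iff_dvd.mp h
  have hT' : (T : ℂ) ≠ 0 := Nat.cast_ne_zero.mpr hT.ne'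
  obtain rfl : r = p + T * c := by omega
  have : 2 * Real.pi * Complex.I * ((p + T * c : ℤ) : ℂ) / T =
      2 * Real.pi * Complex.I * p / T + c * (2 * Real.pi * Complex.I) := by
    push_cast
    field_simp
  rw [this, Complex.exp_add, Complex.exp_int_mul_two_pi_mul_I, mul_one]

namespace IsWeakTwistedModule

variable {A : VertexData V} {g : V →ₗ[ℂ] V} {T : ℕ} {Y Y₁ Y₂ : V →ₗ[ℂ] (ℤ → Module.End ℂ M)}

/-- On the eigenspace `V^r` only modes `p ≡ r` occur, where `g` acts by `exp (2πi p / T)`. So the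
fields of `u` determine those of `g u`. -/
theorem mode_aut (hY : IsWeakTwistedModule A g T Y) (hg : IsConformalAut A g T) (v : V) (p : ℤ) :
    Y (g v) p = Complex.exp (2 * Real.pi * Complex.I * p / T) • Y v p := by
  have key : (LinearMap.proj p : (ℤ → Module.End ℂ M) →ₗ[ℂ] _) ∘ₗ Y ∘ₗ g =
      Complex.exp (2 * Real.pi * Complex.I * p / T) •
        ((LinearMap.proj p : (ℤ → Module.End ℂ M) →ₗ[ℂ] _) ∘ₗ Y) := by
    refine linearMap_ext_of_iSup_eq_top
      (iSup_eigenspace_eq_top_of_pow_eq_one hg.pos hg.pow_eq_one) fun r u hu => ?_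
    replace hu := Module.End.mem_eigenspace_iff.mp hu
    show Y (g u) p = Complex.exp (2 * Real.pi * Complex.I * p / T) • Y u p
    by_cases hp : p ≡ r [ZMOD T]
    · rw [hu, map_smul, Pi.smul_apply, exp_eq_of_modEq hg.pos hp]
    · rw [hu, map_smul, Pi.smul_apply, hY.support r u hu p hp, smul_zero, smul_zero]
  exact LinearMap.congr_fun key v

/-- The vectors on which two twisted module structures agree are closed under all modes. -/
theorem mode_mem_eqLocus (hY₁ : IsWeakTwistedModule A g T Y₁) (hY₂ : IsWeakTwistedModule A g T Y₂)
    (hA : A.IsConformal) (hg : IsConformalAut A g T) {u v : V} (hu : Y₁ u = Y₂ u)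
    (hv : Y₁ v = Y₂ v) (l : ℤ) : Y₁ (A.Y u l v) = Y₂ (A.Y u l v) := by
  set S := LinearMap.eqLocus Y₁ Y₂ with hS
  have hmem : ∀ x, x ∈ S ↔ Y₁ x = Y₂ x := fun x => LinearMap.mem_eqLocus
  have hgS : ∀ x ∈ S, g x ∈ S := by
    intro x hx
    rw [hmem] at hx ⊢
    ext1 p
    rw [hY₁.mode_aut hg, hY₂.mode_aut hg, hx]
  have heig : ∀ (r : ℤ) (u : V), g u = Complex.exp (2 * Real.pi * Complex.I * r / T) • u →
      Y₁ u = Y₂ u → Y₁ (A.Y u l v) = Y₂ (A.Y u l v) := by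
    intro r u hgu hu
    obtain ⟨B, hB⟩ := hA.truncation u v
    -- Downward induction on `l` from the truncation bound: in the Jacobi identity the term `i = 0`
    -- on the left is `Y(u_l v)`, the others involve larger `l`, and the right side only involves `Y
    -- u` and `Y v`.
    have hind : ∀ (j : ℕ) (l : ℤ), B - j ≤ l → Y₁ (A.Y u l v) = Y₂ (A.Y u l v) := by
      intro j
      induction j with
      | zero =>
        intro l hl
        rw [hB l (by simpa using hl), map_zero, map_zero]
      | succ j ih =>
        intro l hl
        ext1 q
        ext1 w
        obtain ⟨N₁, h₁⟩ := hY₁.exists_jacobi_sum hA hg.pos hgu v w l r (q - r) (Int.ModEq.refl r)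
        obtain ⟨N₂, h₂⟩ := hY₂.exists_jacobi_sum hA hg.pos hgu v w l r (q - r) (Int.ModEq.refl r)
        have e := (h₁ (N₁ + N₂ + 1) (by omega)).trans ((congrArg _ (by simp only [hu, hv])).trans
          (h₂ (N₁ + N₂ + 1) (by omega)).symm)
        rw [Finset.sum_range_succ', Finset.sum_range_succ', Finset.sum_congr rfl fun i _ => by
          rw [ih (l + (i + 1 : ℕ)) (by push_cast at hl ⊢; omega)]] at e
        simpa [binom_zero_right] using add_left_cancel e
    exact hind (B - l).toNat l (by omega)
  -- The Jacobi identity needs eigenvectors. The locus of agreement is `g`-stable and `g` has finite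
  -- order on it, so it is spanned by eigenvectors at which the two structures agree.
  let g' : Module.End ℂ S := g.restrict hgS
  have hpow : ∀ (j : ℕ) (x : S), ((g' ^ j) x : V) = ((g : Module.End ℂ V) ^ j) x := by
    intro j
    induction j with
    | zero => simp
    | succ j ih =>
      intro x
      rw [pow_succ', pow_succ', Module.End.mul_apply, Module.End.mul_apply, ← ih]
      rfl
  have htop : (⟨u, (hmem u).mpr hu⟩ : S) ∈
      ⨆ r : ℤ, Module.End.eigenspace g' (Complex.exp (2 * Real.pi * Complex.I * r / T)) := by
    rw [iSup_eigenspace_eq_top_of_pow_eq_one hg.pos]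
    · trivial
    · refine LinearMap.ext fun x => Subtype.ext ?_
      rw [hpow, hg.pow_eq_one]
      rfl
  have : ∀ x : S, x ∈ ⨆ r : ℤ, Module.End.eigenspace g'
      (Complex.exp (2 * Real.pi * Complex.I * r / T)) →
      Y₁ (A.Y (x : V) l v) = Y₂ (A.Y (x : V) l v) := by
    intro x hx
    induction hx using Submodule.iSup_induction' with
    | mem r x hx =>
      exact heig r x (congrArg Subtype.val (Module.End.mem_eigenspace_iff.mp hx)) ((hmem _).mp x.2)
    | zero => simp
    | add x y _ _ hx hy =>
      simp only [Submodule.coe_add, map_add, Pi.add_apply, LinearMap.add_apply, hx, hy]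
  exact this _ htop

end IsWeakTwistedModule

end Uniqueness

/-! ### Generation of the tensor power, and uniqueness of `T_σ(W)` -/

section CycleTwist

variable {V W : Type*} [AddCommGroup V] [Module ℂ V] [AddCommGroup W] [Module ℂ W]
  (A : VOA V) (k : ℕ)

/-- A subspace of the tensor power that contains the generators `u` in position `i` and is closed
under modes is everything. -/
theorem mem_of_inPosition_mem [NeZero k] {S : Submodule ℂ (⨂[ℂ] _ : Fin k, V)}
    (hpos : ∀ i u, inPosition A k i u ∈ S)
    (hmode : ∀ u ∈ S, ∀ v ∈ S, ∀ l, (tensorPower A k).Y u l v ∈ S) (x : ⨂[ℂ] _ : Fin k, V) :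
    x ∈ S := by
  have hfin : ∀ s : Finset (Fin k), ∀ v : Fin k → V, (∀ i, i ∉ s → v i = A.vac) →
      PiTensorProduct.tprod ℂ v ∈ S := by
    intro s
    induction s using Finset.induction_on with
    | empty =>
      intro v hv
      have : PiTensorProduct.tprod ℂ v = inPosition A k 0 A.vac := by
        rw [inPosition]
        congr 1
        ext1 i
        rw [hv i (Finset.notMem_empty i)]
        by_cases h : i = 0
        · subst h
          simp
        · simp [h]
      rw [this]
      exact hpos _ _
    | insert i s hi ih =>
      intro v hv
      -- By creation, the mode `-1` of `v i` in position `i` replaces the vacuum there by `v i`, so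
      -- the positions are filled one at a time.
      have h1 := hmode _ (hpos i (v i)) _ (ih (Function.update v i A.vac) fun j hj => by
        by_cases h : j = i
        · subst h
          simp
        · simpa [h] using hv j (by simp [h, hj])) (-1)
      rw [tensorPower_inPosition, map_update_tprod, Function.update_self, (A.creation _).1,
        Function.update_idem, Function.update_eq_self] at h1
      exact h1
  induction x using PiTensorProduct.induction_on with
  | smul_tprod r v =>
    exact Submodule.smul_mem _ _ (hfin Finset.univ v fun i hi => absurd (Finset.mem_univ i) hi)
  | add x y hx hy => exact Submodule.add_mem _ hx hy

theorem inPosition_add (i : Fin k) (u v : V) :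
    inPosition A k i (u + v) = inPosition A k i u + inPosition A k i v :=
  MultilinearMap.map_update_add _ _ _ _ _

theorem inPosition_smul (i : Fin k) (c : ℂ) (u : V) :
    inPosition A k i (c • u) = c • inPosition A k i u :=
  MultilinearMap.map_update_smul _ _ _ _ _

theorem inPosition_zero (i : Fin k) : inPosition A k i 0 = 0 :=
  MultilinearMap.map_update_zero _ _ _

theorem VOA.L_vac {n : ℤ} (hn : -1 ≤ n) : A.L n A.vac = 0 := (A.creation A.conf).2 _ (by omega)

variable {A k}

theorem tensorPower_dividedL_inPosition (i : Fin k) (j : ℕ) (u : V) :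
    (tensorPower A k).dividedL j (inPosition A k i u) = inPosition A k i (A.dividedL j u) := by
  rw [VertexData.dividedL, VertexData.dividedL, LinearMap.smul_apply, LinearMap.smul_apply,
    inPosition_smul]
  congr 1
  induction j with
  | zero => rfl
  | succ j ih =>
    rw [pow_succ', pow_succ', Module.End.mul_apply, Module.End.mul_apply, ih, tensorPower_L,
      sumOp_inPosition A k _ (A.L_vac (by omega))]

theorem inPosition_mem_wt (i : Fin k) {n : ℤ} {u : V} (hu : u ∈ A.wt n) :
    inPosition A k i u ∈ (tensorPower A k).wt n := by
  rw [VertexData.mem_wt_iff, tensorPower_L, sumOp_inPosition A k _ (A.L_vac (by omega)),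
    VertexData.mem_wt_iff.mp hu, inPosition_smul]

/-- The conditions that define `T_σ(W)` determine it. -/
theorem IsCycleTwist.unique [NeZero k] {σ : Equiv.Perm (Fin k)} (hσ : σ ^ k = 1)
    (hcyc : ∀ i, ∃ j : ℕ, (σ ^ j) 0 = i) {YW : V →ₗ[ℂ] (ℤ → Module.End ℂ W)}
    {Y₁ Y₂ : (⨂[ℂ] _ : Fin k, V) →ₗ[ℂ] (ℤ → Module.End ℂ W)}
    (h₁ : IsCycleTwist A k σ YW Y₁) (h₂ : IsCycleTwist A k σ YW Y₂) : Y₁ = Y₂ := by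
  have hA := tensorPower_isConformal A k
  have hg := permAction_isConformalAut A k hσ
  have h0 : ∀ u, Y₁ (inPosition A k 0 u) = Y₂ (inPosition A k 0 u) := by
    intro u
    have hu : u ∈ ⨆ n, A.wt n := A.graded ▸ trivial
    induction hu using Submodule.iSup_induction' with
    | mem n u hu =>
      ext1 p
      rw [h₁.field n u hu, h₂.field n u hu]
    | zero => simp only [inPosition_zero, map_zero]
    | add x y _ _ hx hy => rw [inPosition_add, map_add, map_add, hx, hy]
  have hj : ∀ (j : ℕ) (u : V), Y₁ (inPosition A k ((σ ^ j) 0) u) =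
      Y₂ (inPosition A k ((σ ^ j) 0) u) := by
    intro j u
    induction j with
    | zero => exact h0 u
    | succ j ih =>
      rw [pow_succ', Equiv.Perm.mul_apply, ← permAction_inPosition]
      ext1 p
      rw [h₁.twisted.mode_aut hg, h₂.twisted.mode_aut hg, ih]
  refine LinearMap.ext fun x => LinearMap.mem_eqLocus.mp
    (mem_of_inPosition_mem A k (fun i u => ?_) (fun u hu v hv l => ?_) x)
  · obtain ⟨j, rfl⟩ := hcyc i
    exact LinearMap.mem_eqLocus.mpr (hj j u)
  · exact h₁.twisted.mode_mem_eqLocus h₂.twisted hA hg hu hv l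

end CycleTwist

theorem finRotate_inv_pow_self (k : ℕ) [NeZero k] : (finRotate k)⁻¹ ^ k = 1 := by
  rw [inv_pow, finRotate_pow_self, inv_one]

theorem exists_finRotate_inv_pow_zero (k : ℕ) [NeZero k] (i : Fin k) :
    ∃ j : ℕ, ((finRotate k)⁻¹ ^ j) 0 = i := by
  obtain ⟨j, hj⟩ := exists_finRotate_pow_zero k i
  obtain ⟨n, rfl⟩ := Nat.exists_eq_succ_of_ne_zero (NeZero.ne k)
  -- Here `k = n + 1`, so the inverse of the `n j`-th power is the `j`-th power.
  refine ⟨n * j, ?_⟩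
  rw [← hj, inv_pow]
  congr 1
  rw [inv_eq_iff_mul_eq_one, ← pow_add, show n * j + j = n.succ * j by rw [Nat.succ_mul],
    pow_mul, finRotate_pow_self, one_pow]

/-! ### The operators `Δ_k` -/

section Delta

open Finset.HasAntidiagonal

variable {V W : Type*} [AddCommGroup V] [Module ℂ V] [AddCommGroup W] [Module ℂ W]

section VertexData

variable (A : VertexData V) (k : ℕ) [NeZero k]

theorem deltaExponent_eq_fieldSeries :
    deltaExponent A k = fieldSeries (fun n : ℕ => A.L n)
      (PowerSeries.X ^ 2 * PowerSeries.mk (deltaSeq k)) := by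
  ext1 n
  rw [deltaExponent, fieldSeries, PowerSeries.coeff_mk, PowerSeries.coeff_mk]
  cases n with
  | zero => simp [PowerSeries.coeff_X_pow_mul']
  | succ n =>
    rw [if_neg (Nat.succ_ne_zero n), show n + 1 + 1 = n + 2 from rfl, PowerSeries.coeff_X_pow_mul,
      PowerSeries.coeff_mk, Nat.add_sub_cancel]

theorem deltaExpCoeff_eq_coeff (j : ℕ) :
    deltaExpCoeff A k j = PowerSeries.coeff j (expSeries (fieldSeries (fun n : ℕ => A.L n)
      (PowerSeries.X ^ 2 * PowerSeries.mk (deltaSeq k)))) := by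
  rw [← deltaExponent_eq_fieldSeries, expSeries, adicSum, PowerSeries.coeff_mk, deltaExpCoeff]
  simp only [coeff_smul_complex]

theorem deltaExpCoeff_zero : deltaExpCoeff A k 0 = 1 := by
  simp [deltaExpCoeff]

variable {A}

theorem VertexData.IsConformal.L_mem (hA : A.IsConformal) {h : ℤ} {v : V} (hv : v ∈ A.wt h)
    (n : ℤ) : A.L n v ∈ A.wt (h - n) := by
  have := hA.mode_mem hA.conf_mem hv (n + 1)
  rwa [show 2 + h - (n + 1) - 1 = h - n by ring] at this

theorem VertexData.IsConformal.deltaExpCoeff_mem (hA : A.IsConformal) {h : ℤ} {v : V}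
    (hv : v ∈ A.wt h) (j : ℕ) : deltaExpCoeff A k j v ∈ A.wt (h - j) := by
  have hpow : ∀ (m j : ℕ) (h : ℤ) (v : V), v ∈ A.wt h →
      PowerSeries.coeff j (deltaExponent A k ^ m) v ∈ A.wt (h - j) := by
    intro m
    induction m with
    | zero =>
      intro j h v hv
      rw [pow_zero, PowerSeries.coeff_one]
      split_ifs with hj
      · simpa [hj] using hv
      · exact Submodule.zero_mem _
    | succ m ih =>
      intro j h v hv
      rw [pow_succ, PowerSeries.coeff_mul, LinearMap.sum_apply]
      refine Submodule.sum_mem _ fun p hp => ?_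
      rw [Module.End.mul_apply, ← mem_antidiagonal.mp hp, Nat.cast_add, add_comm, ← sub_sub]
      refine ih _ _ _ ?_
      rw [deltaExponent, PowerSeries.coeff_mk]
      split_ifs with h0
      · exact Submodule.zero_mem _
      · exact Submodule.smul_mem _ _ (hA.L_mem hv _)
  rw [deltaExpCoeff, LinearMap.sum_apply]
  exact Submodule.sum_mem _ fun m _ => Submodule.smul_mem _ _ (hpow m j h v hv)

theorem VertexData.IsConformal.deltaExpCoeff_eq_zero (hA : A.IsConformal) {h : ℤ} {v : V}
    (hv : v ∈ A.wt h) {j : ℕ} (hj : A.wt (h - j) = ⊥) : deltaExpCoeff A k j v = 0 := by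
  have := hA.deltaExpCoeff_mem k hv j
  rwa [hj, Submodule.mem_bot] at this

end VertexData

variable (A : VOA V) (k : ℕ) [NeZero k]

/-- `Δ` commutes with the exponential of `L(1)`, up to the change of variables by a `k`-th
root. -/
theorem VOA.sum_deltaExpCoeff_dividedL (s : ℕ) :
    ∑ p ∈ antidiagonal s, deltaExpCoeff A.toVertexData k p.1 *
      ((k : ℂ) ^ p.2 • A.dividedL p.2) =
    ∑ p ∈ antidiagonal s, A.dividedL p.1 *
      ((-1 : ℂ) ^ p.2 • deltaExpCoeff A.toVertexData k p.2) := by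
  have := exp_identity (L := fun n : ℕ => A.L n) (fun m n => by
    obtain ⟨c, hc⟩ := A.virasoro
    rw [hc]
    -- For nonnegative indices the central term could only occur at `m = n = 0`, where `m³ - m`
    -- vanishes.
    by_cases h : (m : ℤ) + n = 0
    · obtain rfl : m = 0 := by omega
      simp
    · simp [h]) k s
  simpa only [← deltaExpCoeff_eq_coeff, VertexData.dividedL, Nat.cast_one] using this

theorem VOA.L_conf {n : ℤ} (hn : 1 ≤ n) : ∃ c : ℂ, A.L n A.conf = c • A.vac := by
  obtain ⟨c, hc⟩ := A.virasoro
  have h1 : A.L (-2) A.vac = A.conf := (A.creation A.conf).1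
  have h2 := LinearMap.congr_fun (hc n (-2)) A.vac
  rw [LinearMap.sub_apply, Module.End.mul_apply, Module.End.mul_apply, h1, A.L_vac (by omega),
    map_zero, sub_zero, LinearMap.add_apply, LinearMap.smul_apply, LinearMap.smul_apply,
    A.L_vac (by omega), smul_zero, zero_add] at h2
  exact ⟨_, h2⟩

/-- For `n ≥ 1`, `L(n)` sends `ω` to a multiple of the vacuum, and then kills it. So `Δ_k(z) ω` is a
multiple of `ω` plus a multiple of the vacuum. -/
theorem VOA.deltaExpCoeff_conf (j : ℕ) :
    ∃ c : ℂ, deltaExpCoeff A.toVertexData k (j + 1) A.conf = c • A.vac := by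
  set P := deltaExponent A.toVertexData k with hP
  have hvac : ∀ j, PowerSeries.coeff j P A.vac = 0 := by
    intro j
    rw [hP, deltaExponent, PowerSeries.coeff_mk]
    split_ifs with h0
    · rfl
    · rw [LinearMap.smul_apply, A.L_vac (by omega), smul_zero]
  have hconf : ∀ j, PowerSeries.coeff j P A.conf ∈ ℂ ∙ A.vac := by
    intro j
    rw [hP, deltaExponent, PowerSeries.coeff_mk]
    split_ifs with h0
    · exact Submodule.zero_mem _
    · obtain ⟨c, hc⟩ := A.L_conf (n := j) (by omega)
      rw [LinearMap.smul_apply, hc]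
      exact Submodule.smul_mem _ _ (Submodule.smul_mem _ _ (Submodule.mem_span_singleton_self _))
  have hpow : ∀ m j, (PowerSeries.coeff j (P ^ m) : Module.End ℂ V) A.vac ∈ ℂ ∙ A.vac := by
    intro m j
    cases m with
    | zero =>
      rw [pow_zero, PowerSeries.coeff_one]
      split_ifs with h0
      · exact Submodule.mem_span_singleton_self _
      · exact Submodule.zero_mem _
    | succ m =>
      rw [pow_succ, PowerSeries.coeff_mul, LinearMap.sum_apply]
      refine Submodule.sum_mem _ fun p _ => ?_
      rw [Module.End.mul_apply, hvac, map_zero]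
      exact Submodule.zero_mem _
  have hspan : deltaExpCoeff A.toVertexData k (j + 1) A.conf ∈ ℂ ∙ A.vac := by
    rw [deltaExpCoeff, LinearMap.sum_apply]
    refine Submodule.sum_mem _ fun m _ => Submodule.smul_mem _ _ ?_
    cases m with
    | zero =>
      rw [pow_zero, PowerSeries.coeff_one, if_neg (Nat.succ_ne_zero j)]
      exact Submodule.zero_mem _
    | succ m =>
      rw [pow_succ, PowerSeries.coeff_mul, LinearMap.sum_apply]
      refine Submodule.sum_mem _ fun p _ => ?_
      obtain ⟨c, hc⟩ := Submodule.mem_span_singleton.mp (hconf p.2)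
      rw [Module.End.mul_apply, ← hP, ← hc, map_smul]
      exact Submodule.smul_mem _ _ (hpow _ _)
  obtain ⟨c, hc⟩ := Submodule.mem_span_singleton.mp hspan
  exact ⟨c, hc.symm⟩

variable {A k}

theorem VOA.deltaFieldMode_eq_sum (YW : V →ₗ[ℂ] (ℤ → Module.End ℂ W)) {n : ℤ} {u : V}
    {N : ℕ} (hN : ∀ j, N ≤ j → deltaExpCoeff A.toVertexData k j u = 0) (p : ℤ) :
    deltaFieldMode A.toVertexData k YW n u p = (k : ℂ) ^ (-n) • ∑ j ∈ Finset.range N,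
      YW (deltaExpCoeff A.toVertexData k j u) (p + k - 1 + (1 - k) * n - j) := by
  rw [deltaFieldMode, finsum_eq_sum_range (N := N), Finset.smul_sum]
  · exact Finset.sum_congr rfl fun j _ => by
      rw [deltaCoeff, LinearMap.smul_apply, map_smul, Pi.smul_apply]
  · intro j hj
    rw [deltaCoeff, LinearMap.smul_apply, hN j hj, smul_zero, map_zero, Pi.zero_apply]

/-! ### The grading of `T_σ(W)` -/

variable {σ : Equiv.Perm (Fin k)} {YW : V →ₗ[ℂ] (ℤ → Module.End ℂ W)}
  {YT : (⨂[ℂ] _ : Fin k, V) →ₗ[ℂ] (ℤ → Module.End ℂ W)}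

/-- On `T_σ(W)`, the operator `L(0)` is `L(0) / k` plus a constant. -/
theorem IsCycleTwist.exists_L_zero_eq (hσ : σ ^ k = 1) (hcyc : ∀ i, ∃ j : ℕ, (σ ^ j) 0 = i)
    (hW : IsWeakTwistedModule A.toVertexData LinearMap.id 1 YW) (hT : IsCycleTwist A k σ YW YT) :
    ∃ c : ℂ, YT (tensorPower A k).conf k = (k : ℂ)⁻¹ • YW A.conf 1 + c • 1 := by
  have hk : (k : ℂ) ≠ 0 := Nat.cast_ne_zero.mpr (NeZero.ne k)
  have hA := A.isConformal
  have hg := permAction_isConformalAut A k hσ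
  -- The mode `ω_1` has index `k`, for which the root of unity in `mode_aut` is `1`; all `k`
  -- positions therefore contribute equally.
  have hj : ∀ j : ℕ, YT (inPosition A k ((σ ^ j) 0) A.conf) k =
      YT (inPosition A k 0 A.conf) k := by
    intro j
    induction j with
    | zero => rfl
    | succ j ih =>
      have h1 : Complex.exp (2 * Real.pi * Complex.I * ((k : ℤ) : ℂ) / k) = 1 := by
        rw [Int.cast_natCast, mul_div_cancel_right₀ _ hk, Complex.exp_two_pi_mul_I]
      rw [pow_succ', Equiv.Perm.mul_apply, ← permAction_inPosition, hT.twisted.mode_aut hg, h1,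
        one_smul, ih]
  obtain ⟨N, hN⟩ := hA.exists_wt_eq_bot 2
  choose c hc using A.deltaExpCoeff_conf k
  have h0 : ∃ d : ℂ, YT (inPosition A k 0 A.conf) k =
      (k : ℂ) ^ (-2 : ℤ) • YW A.conf 1 + d • 1 := by
    -- The term of degree `j + 1` is a multiple of the mode `-j` of the vacuum, which is the
    -- identity exactly for `j = 1`, that is, in degree two.
    refine ⟨(k : ℂ) ^ (-2 : ℤ) * ∑ j ∈ Finset.range N, c j * if j = 1 then 1 else 0, ?_⟩
    rw [hT.field 2 _ hA.conf_mem, VOA.deltaFieldMode_eq_sum YW (N := N + 1) fun j hj =>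
      hA.deltaExpCoeff_eq_zero k hA.conf_mem (hN j (by omega)), Finset.sum_range_succ', smul_add,
      add_comm, mul_smul, Finset.sum_smul]
    congr 1
    · rw [deltaExpCoeff_zero, Module.End.one_apply]
      refine congrArg _ (congrArg (YW A.conf) ?_)
      push_cast
      ring
    · congr 1
      refine Finset.sum_congr rfl fun j _ => ?_
      rw [hc, map_smul, Pi.smul_apply, hW.vacuum, mul_smul]
      congr 1
      by_cases h : j = 1
      · subst h
        rw [if_pos (by push_cast; ring), if_pos rfl, one_smul]
      · rw [if_neg (by push_cast; intro h'; apply h; linarith), if_neg h, zero_smul]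
  obtain ⟨d, hd⟩ := h0
  refine ⟨k * d, ?_⟩
  have hconf : (tensorPower A k).conf = ∑ i, inPosition A k i A.conf := rfl
  rw [hconf, map_sum, Finset.sum_apply, Finset.sum_congr rfl
    (g := fun _ => YT (inPosition A k 0 A.conf) k) fun i _ => by
      obtain ⟨j, rfl⟩ := hcyc i
      exact hj j]
  rw [Finset.sum_const, Finset.card_univ, Fintype.card_fin, hd, ← Nat.cast_smul_eq_nsmul ℂ,
    smul_add, smul_smul, smul_smul]
  congr 2
  rw [zpow_neg, zpow_ofNat]
  field_simp

theorem eigenspace_smul_add_smul (L : Module.End ℂ W) {a : ℂ} (ha : a ≠ 0) (c μ : ℂ) :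
    Module.End.eigenspace (a • L + c • 1) μ = Module.End.eigenspace L (a⁻¹ * (μ - c)) := by
  ext w
  rw [Module.End.mem_eigenspace_iff, Module.End.mem_eigenspace_iff, LinearMap.add_apply,
    LinearMap.smul_apply, LinearMap.smul_apply, Module.End.one_apply, ← eq_sub_iff_add_eq,
    ← sub_smul, mul_smul, eq_inv_smul_iff₀ ha]

/-- An affine function of `L` with nonzero slope has the same eigenspaces with relabelled
eigenvalues, and the restricted dual ignores the labels. -/
theorem restrictedDual_smul_add_smul (L : Module.End ℂ W) {a : ℂ} (ha : a ≠ 0) (c : ℂ) :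
    restrictedDual (a • L + c • 1) = restrictedDual L := by
  ext f
  let e : ℂ ≃ ℂ := ((Equiv.subRight c).trans (Equiv.mulLeft₀ a⁻¹ (inv_ne_zero ha)))
  have : {μ : ℂ | ∃ w ∈ Module.End.eigenspace (a • L + c • 1) μ, f w ≠ 0} =
      e ⁻¹' {μ : ℂ | ∃ w ∈ Module.End.eigenspace L μ, f w ≠ 0} := by
    ext μ
    simp only [eigenspace_smul_add_smul L ha]
    rfl
  show Set.Finite _ ↔ Set.Finite _
  rw [this]
  exact ⟨fun h => h.of_preimage e.surjective, fun h => h.preimage e.injective.injOn⟩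

theorem IsCycleTwist.isTwistedModule (hσ : σ ^ k = 1) (hcyc : ∀ i, ∃ j : ℕ, (σ ^ j) 0 = i)
    (hW : IsVOAModule A YW) (hT : IsCycleTwist A k σ YW YT) :
    IsTwistedModule (tensorPower A k) (permAction V σ) k YT := by
  have hk : (k : ℂ) ≠ 0 := Nat.cast_ne_zero.mpr (NeZero.ne k)
  obtain ⟨c, hc⟩ := hT.exists_L_zero_eq hσ hcyc hW.toIsWeakTwistedModule
  have he : ∀ μ, Module.End.eigenspace (YT (tensorPower A k).conf k) μ =
      Module.End.eigenspace (YW A.conf 1) (k * (μ - c)) := by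
    intro μ
    rw [hc, eigenspace_smul_add_smul _ (inv_ne_zero hk), inv_inv]
  have hW1 := hW.graded
  have hW2 := hW.finite
  have hW3 := hW.lower_bound
  simp only [Nat.cast_one, div_one] at hW1 hW2 hW3
  refine { hT.twisted with graded := ?_, finite := ?_, lower_bound := ?_ }
  · have hs : Function.Surjective fun μ : ℂ => (k : ℂ) * (μ - c) := fun ν =>
      ⟨ν / k + c, by field_simp; ring⟩
    exact (iSup_congr he).trans
      ((hs.iSup_comp (g := Module.End.eigenspace (YW A.conf 1))).trans hW1)
  · intro μ
    rw [he]
    exact hW2 _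
  · intro μ
    obtain ⟨N, hN⟩ := hW3 (k * (μ - c))
    refine ⟨N, fun n hn => ?_⟩
    rw [he, ← hN n hn]
    congr 1
    field_simp
    ring

theorem IsCycleTwist.restrictedDual_eq (hσ : σ ^ k = 1) (hcyc : ∀ i, ∃ j : ℕ, (σ ^ j) 0 = i)
    (hW : IsVOAModule A YW) (hT : IsCycleTwist A k σ YW YT) :
    restrictedDual (YW A.conf 1) = restrictedDual (YT (tensorPower A k).conf k) := by
  obtain ⟨c, hc⟩ := hT.exists_L_zero_eq hσ hcyc hW.toIsWeakTwistedModule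
  rw [hc, restrictedDual_smul_add_smul _ (inv_ne_zero (Nat.cast_ne_zero.mpr (NeZero.ne k)))]

/-! ### The contragredient module of `T_σ(W)` -/

/-- The generating fields of the contragredient module of `T_σ(W)` are those of `T_σ⁻¹(W')`. -/
theorem IsCycleTwist.contragredientMode_inPosition (hT : IsCycleTwist A k σ YW YT) {n : ℤ} {u : V}
    (hu : u ∈ A.wt n) {N : ℕ} (hN : ∀ j : ℕ, N ≤ j → A.wt (n - j) = ⊥) (p : ℤ) :
    contragredientMode (tensorPower A k) k YT n (inPosition A k 0 u) p =
      (k : ℂ) ^ (-n) • ∑ i ∈ Finset.range N, contragredientMode A.toVertexData 1 YW (n - i)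
        (deltaExpCoeff A.toVertexData k i u) (p + k - 1 + (1 - k) * n - i) := by
  have hk : (k : ℂ) ≠ 0 := Nat.cast_ne_zero.mpr (NeZero.ne k)
  have hA := A.isConformal
  -- The index of `Y_W` common to both sides in degree zero; in degree `j + i` both have `q - (j +
  -- i)`.
  set q : ℤ := -p + k * n - k - 1 + n with hq
  have hN' : ∀ i j : ℕ, N ≤ i + j → A.wt (n - i - j) = ⊥ := fun i j h => by
    rw [sub_sub, ← Nat.cast_add]
    exact hN _ h
  -- `L(1)^j / j!` lowers the weight to `n - j`, so `k^(-L(0))` contributes the extra `k^j`;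
  -- likewise the extra `(-1)^i` in `e2` comes from `(-1)^(L(0))` in weight `n - i`.
  have e1 : ∀ j : ℕ, YT (inPosition A k 0 (A.dividedL j u)) (-p + k * (2 * n - j - 2)) =
      (k : ℂ) ^ (-n) • ∑ i ∈ Finset.range N,
        YW ((deltaExpCoeff A.toVertexData k i * ((k : ℂ) ^ j • A.dividedL j)) u) (q - (j + i : ℕ)) := by
    intro j
    rw [hT.field _ _ (hA.dividedL_mem hu j), VOA.deltaFieldMode_eq_sum YW (N := N) fun i hi =>
      hA.deltaExpCoeff_eq_zero k (hA.dividedL_mem hu j) (hN' j i (by omega)), Finset.smul_sum,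
      Finset.smul_sum]
    refine Finset.sum_congr rfl fun i _ => ?_
    rw [Module.End.mul_apply, LinearMap.smul_apply, map_smul, map_smul, Pi.smul_apply, smul_smul,
      neg_sub, sub_eq_neg_add, zpow_add₀ hk, zpow_natCast]
    refine congrArg _ (congrArg (YW _) ?_)
    rw [hq]
    push_cast
    ring
  have e2 : ∀ i ∈ Finset.range N, contragredientMode A.toVertexData 1 YW (n - i) (deltaExpCoeff A.toVertexData k i u)
      (p + k - 1 + (1 - k) * n - i) = (-1 : ℂ) ^ n • ∑ j ∈ Finset.range N,
        YW ((A.dividedL j * ((-1 : ℂ) ^ i • deltaExpCoeff A.toVertexData k i)) u) (q - (j + i : ℕ)) := by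
    intro i _
    rw [contragredientMode_eq_sum _ _ _ _ _ (N := N) fun j hj =>
      hA.dividedL_eq_zero (hA.deltaExpCoeff_mem k hu i) (hN' i j (by omega)), Finset.smul_sum,
      Finset.smul_sum]
    refine Finset.sum_congr rfl fun j _ => ?_
    have hs : (-1 : ℂ) ^ (n - i) = (-1 : ℂ) ^ n * (-1) ^ i := by
      rw [zpow_sub₀ (by norm_num), zpow_natCast, div_eq_mul_inv, ← inv_pow]
      norm_num
    rw [Module.End.mul_apply, LinearMap.smul_apply, map_smul, map_smul, Pi.smul_apply, smul_smul,
      hs]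
    refine congrArg _ (congrArg (YW _) ?_)
    rw [hq]
    push_cast
    ring
  rw [contragredientMode_eq_sum _ _ _ _ _ (N := N) fun j hj =>
    by rw [tensorPower_dividedL_inPosition, hA.dividedL_eq_zero hu (hN j hj), inPosition_zero]]
  simp only [tensorPower_dividedL_inPosition, e1]
  rw [Finset.sum_congr rfl e2, ← Finset.smul_sum, ← Finset.smul_sum, smul_comm]
  congr 2
  rw [sum_range_sum_range_eq (fun j i => YW ((deltaExpCoeff A.toVertexData k i * ((k : ℂ) ^ j • A.dividedL j)) u)
    (q - (j + i : ℕ))) N, Finset.sum_comm, sum_range_sum_range_eq (fun j i =>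
    YW ((A.dividedL j * ((-1 : ℂ) ^ i • deltaExpCoeff A.toVertexData k i)) u) (q - (j + i : ℕ))) N]
  · refine Finset.sum_congr rfl fun s _ => ?_
    -- In each total degree `s` the mode index is constant, so the operator identity on `V` can be
    -- applied inside `Y_W`.
    have key := congrArg (fun φ : Module.End ℂ V => YW (φ u) (q - s))
      (A.sum_deltaExpCoeff_dividedL k s)
    simp only [LinearMap.sum_apply, map_sum, Finset.sum_apply] at key
    rw [← Finset.Nat.sum_antidiagonal_swap] at key
    refine Eq.trans (Finset.sum_congr rfl fun x hx => ?_) (key.trans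
      (Finset.sum_congr rfl fun x hx => ?_))
    · rw [mem_antidiagonal.mp hx]
      rfl
    · rw [mem_antidiagonal.mp hx]
  · intro j i hij
    rw [Module.End.mul_apply, hA.dividedL_eq_zero (h := n - i) 
      (v := ((-1 : ℂ) ^ i • deltaExpCoeff A.toVertexData k i) u)
      (Submodule.smul_mem _ _ (hA.deltaExpCoeff_mem k hu i)) (hN' i j (by omega)), map_zero, Pi.zero_apply]
  · intro j i hij
    rw [Module.End.mul_apply, hA.deltaExpCoeff_eq_zero (h := n - j) k
      (v := ((k : ℂ) ^ j • A.dividedL j) u)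
      (Submodule.smul_mem _ _ (hA.dividedL_mem hu j)) (hN' j i hij), map_zero, Pi.zero_apply]

theorem IsCycleTwist.contragredient_field {D : Submodule ℂ (Module.Dual ℂ W)}
    (hT : IsCycleTwist A k σ YW YT)
    {YW' : V →ₗ[ℂ] (ℤ → Module.End ℂ D)} (hYW' : IsContragredient A.toVertexData 1 YW D YW')
    {YT' : (⨂[ℂ] _ : Fin k, V) →ₗ[ℂ] (ℤ → Module.End ℂ D)}
    (hYT' : IsContragredient (tensorPower A k) k YT D YT') {n : ℤ} {u : V} (hu : u ∈ A.wt n)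
    (p : ℤ) : YT' (inPosition A k 0 u) p = deltaFieldMode A.toVertexData k YW' n u p := by
  have hA := A.isConformal
  obtain ⟨N, hN⟩ := hA.exists_wt_eq_bot n
  refine LinearMap.ext fun f => Subtype.ext (LinearMap.ext fun w => ?_)
  rw [hYT'.2 n _ (inPosition_mem_wt 0 hu), hT.contragredientMode_inPosition hu hN,
    VOA.deltaFieldMode_eq_sum YW' fun j hj => hA.deltaExpCoeff_eq_zero k hu (hN j hj)]
  simp only [LinearMap.smul_apply, LinearMap.sum_apply, map_smul, map_sum, Submodule.coe_smul,
    Submodule.coe_sum]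
  congr 1
  exact Finset.sum_congr rfl fun i _ =>
    (hYW'.2 _ _ (hA.deltaExpCoeff_mem k hu i) _ f w).symm

end Delta

/-- If `(W, Y_T)` is `T_g(W)` for `g = (1 2 ⋯ k)` (it is unique), then the contragredient modules `W'` of `W` and
`T_g(W)'` of `T_g(W)` exist, have the same underlying space, are a `V`-module and a `g⁻¹`-twisted
`V^{⊗k}`-module, respectively, and `T_g(W)'` is the unique twisted module `T_{g⁻¹}(W')`. -/
theorem mainTheorem4 {V W : Type*} [AddCommGroup V] [Module ℂ V] [AddCommGroup W] [Module ℂ W]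
    (A : VOA V) (k : ℕ) [NeZero k]
    (YW : V →ₗ[ℂ] (ℤ → Module.End ℂ W)) (hW : IsVOAModule A YW)
    (YT : (⨂[ℂ] _ : Fin k, V) →ₗ[ℂ] (ℤ → Module.End ℂ W))
    (hT : IsCycleTwist A k (finRotate k) YW YT) :
    (∀ Y, IsCycleTwist A k (finRotate k) YW Y → Y = YT) ∧
    ∃ YW' : V →ₗ[ℂ] (ℤ → Module.End ℂ (restrictedDual (YW A.conf 1))),
      IsContragredient A.toVertexData 1 YW (restrictedDual (YW A.conf 1)) YW' ∧
      IsVOAModule A YW' ∧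
      ∃ YT' : (⨂[ℂ] _ : Fin k, V) →ₗ[ℂ] (ℤ → Module.End ℂ (restrictedDual (YW A.conf 1))),
        IsContragredient (tensorPower A k) k YT (restrictedDual (YW A.conf 1)) YT' ∧
        IsTwistedModule (tensorPower A k) (permAction V (finRotate k)⁻¹) k YT' ∧
        IsCycleTwist A k (finRotate k)⁻¹ YW' YT' ∧
        ∀ Y, IsCycleTwist A k (finRotate k)⁻¹ YW' Y → Y = YT' := by
  have hσ := finRotate_pow_self k
  have hcyc := exists_finRotate_pow_zero k
  have hid : IsConformalAut A.toVertexData LinearMap.id 1 :=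
    ⟨one_pos, one_pow 1, rfl, fun _ => rfl, fun _ => rfl⟩
  refine ⟨fun Y hY => hY.unique hσ hcyc hT, ?_⟩
  obtain ⟨YW', hYW', hW'⟩ := exists_isContragredient hW A.isConformal hid (g' := LinearMap.id) (fun _ => rfl)
    (D := restrictedDual (YW A.conf 1)) (by rw [Nat.cast_one])
  obtain ⟨YT', hYT', hT'⟩ := exists_isContragredient (hT.isTwistedModule hσ hcyc hW)
    (tensorPower_isConformal A k) (permAction_isConformalAut A k hσ)
    (g' := permAction V (finRotate k)⁻¹)
    (fun v => by rw [← permAction_mul, mul_inv_cancel, permAction_one])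
    (hT.restrictedDual_eq hσ hcyc hW)
  -- The two contragredient constructions meet here: one gives the `g⁻¹`-twisted structure, and the
  -- comparison of generating fields identifies it.
  have hC : IsCycleTwist A k (finRotate k)⁻¹ YW' YT' :=
    ⟨hT'.toIsWeakTwistedModule, fun n u hu p => hT.contragredient_field hYW' hYT' hu p⟩
  exact ⟨YW', hYW', hW', YT', hYT', hT', hC, fun Y hY =>
    hY.unique (finRotate_inv_pow_self k) (exists_finRotate_inv_pow_zero k) hC⟩
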